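/- All graphs are finite and simple. A graph is \emph{unicyclic} if it is connected and contains exactly one cycle. The \emph{matching number} of $G$ is the largest number of pairwise disjoint edges of $G$, and the \emph{Wiener index} is $W(G)=\sum_{\{u,v\}\subset V(G)} d(u,v)$, the sum of the distances over all unordered pairs of vertices. For integers $a,c,j\ge 0$ let $G^3_{a,j}$ be the graph on $a+j+3$ vertices consisting of a triangle $A_0B_0C_0$, a path $A_0A_1\cdots A_j$ starting at $A_0$, and $a$ pendent vertices attached to $A_j$; let $G^4_{a,c,j}$ be the graph on $a+c+j+4$ vertices consisting of a $4$-cycle $A_0B_0C_0D_0$, a path $A_0A_1\cdots A_j$ starting at $A_0$, $a$ pendent vertices attached to $A_j$, and $c$ pendent vertices attached to $C_0$. \textbf{Theorem.} Let $n,m$ be integers with $2\le m\le\lfloor n/2\rfloor$ and let $G$ be a unicyclic graph with $n$ vertices and matching number $m$. \begin{itemize} \item If $n\le 2m+2$, then $$W(G)\le 2-\tfrac83m^3+2m^2+\tfrac53m+2m^2n-3mn-2n+n^2,$$ with equality if and only if $G$ is isomorphic to $G^4_{0,0,0}$ or $G^3_{0,1}$ when $(n,m)=(4,2)$, to $G^4_{1,1,0}$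 or $G^3_{2,1}$ when $(n,m)=(6,2)$, and to $G^3_{n-2m,2m-3}$ otherwise. \item If $n\ge 2m+3$ and $n$ is odd, then $$W(G)\le \tfrac92-n-\tfrac23m^3+\tfrac12n^2-2nm+2m^2+\tfrac12mn^2-\tfrac{11}6m,$$ with equality if and only if $G$ is isomorphic to $G^4_{\frac{n+1}{2}-m,\frac{n-1}{2}-m,2m-4}$. \item If $n\ge 2m+4$ and $n$ is even, then $$W(G)\le 6-n-\tfrac23m^3+\tfrac12n^2-2nm+2m^2+\tfrac12mn^2-\tfrac73m,$$ with equality if and only if $G$ is isomorphic to $G^4_{\frac n2-m,\frac n2-m,2m-4}$. \end{itemize} Moreover, the bounds are sharp: in each case the listed graphs are unicyclic with $n$ vertices and matching number $m$, so the bound is attained for every such pair $(n,m)$. -/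

import Mathlib

/-- The Wiener index: the sum of `d(u, v)` over all unordered pairs `{u, v}` of vertices
(the diagonal pairs `s(v, v)` contribute `0`). -/
noncomputable def wienerIndex {V : Type*} [Fintype V] (G : SimpleGraph V) : ℕ :=
  ∑ e : Sym2 V, Sym2.lift ⟨fun u v => G.dist u v, fun _ _ => G.dist_comm⟩ e

/-- The matching number: the largest size of a set of pairwise disjoint edges. For a finite graph
the set below is nonempty and bounded, so the supremum is a maximum. -/
noncomputable def matchingNumber {V : Type*} (G : SimpleGraph V) : ℕ :=
  sSup {k : ℕ | ∃ M : G.Subgraph, M.IsMatching ∧ M.edgeSet.ncard = k}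

/-- A unicyclic graph is a connected graph with exactly one cycle. A cycle, as a subgraph, is
recorded by its set of edges. -/
def IsUnicyclic {V : Type*} (G : SimpleGraph V) : Prop :=
  G.Connected ∧ ∃! C : Set (Sym2 V), ∃ (v : V) (p : G.Walk v v), p.IsCycle ∧ p.edgeSet = C

/-- `G` belongs to `𝒰(n, m)`: unicyclic, with `n` vertices and matching number `m`. -/
def MemU (n m : ℕ) {V : Type*} [Fintype V] (G : SimpleGraph V) : Prop :=
  IsUnicyclic G ∧ Fintype.card V = n ∧ matchingNumber G = m

/-- Vertices of `G³_{a,j}`: the path `A₀, …, A_j`, the two other triangle vertices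
`B₀, C₀`, and `a` leaves. -/
abbrev G3Vertex (a j : ℕ) : Type := Fin (j + 1) ⊕ Fin 2 ⊕ Fin a

namespace G3Vertex
variable {a j : ℕ}
/-- The path vertex `A_i`. -/
abbrev A (i : Fin (j + 1)) : G3Vertex a j := .inl i
/-- The triangle vertex `B₀`. -/
abbrev B : G3Vertex a j := .inr (.inl 0)
/-- The triangle vertex `C₀`. -/
abbrev C : G3Vertex a j := .inr (.inl 1)
/-- The `i`-th leaf. -/
abbrev leaf (i : Fin a) : G3Vertex a j := .inr (.inr i)
end G3Vertex

open G3Vertex in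
/-- The edges of `G³_{a,j}`, each listed in one orientation. -/
inductive G3Edge (a j : ℕ) : G3Vertex a j → G3Vertex a j → Prop
  | ab : G3Edge a j (A 0) B
  | bc : G3Edge a j B C
  | ca : G3Edge a j C (A 0)
  | path (i : Fin j) : G3Edge a j (A i.castSucc) (A i.succ)
  | pendant (i : Fin a) : G3Edge a j (A (Fin.last j)) (leaf i)

/-- The graph `G³_{a,j}`: a triangle `A₀B₀C₀` with a path `A₀A₁…A_j` starting at `A₀`
and `a` leaves attached to `A_j`. -/
def G3 (a j : ℕ) : SimpleGraph (G3Vertex a j) := SimpleGraph.fromRel (G3Edge a j)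

/-- Vertices of `G⁴_{a,c,j}`: the path `A₀, …, A_j`, the three other vertices `B₀, C₀, D₀`
of the 4-cycle, the `a` leaves at `A_j` and the `c` leaves at `C₀`. -/
abbrev G4Vertex (a c j : ℕ) : Type := Fin (j + 1) ⊕ Fin 3 ⊕ Fin a ⊕ Fin c

namespace G4Vertex
variable {a c j : ℕ}
/-- The path vertex `A_i`. -/
abbrev A (i : Fin (j + 1)) : G4Vertex a c j := .inl i
/-- The vertex `B₀` of the 4-cycle. -/
abbrev B : G4Vertex a c j := .inr (.inl 0)
/-- The vertex `C₀` of the 4-cycle, opposite to `A₀`. -/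
abbrev C : G4Vertex a c j := .inr (.inl 1)
/-- The vertex `D₀` of the 4-cycle. -/
abbrev D : G4Vertex a c j := .inr (.inl 2)
/-- The `i`-th leaf at `A_j`. -/
abbrev leafA (i : Fin a) : G4Vertex a c j := .inr (.inr (.inl i))
/-- The `i`-th leaf at `C₀`. -/
abbrev leafC (i : Fin c) : G4Vertex a c j := .inr (.inr (.inr i))
end G4Vertex

open G4Vertex in
/-- The edges of `G⁴_{a,c,j}`, each listed in one orientation. -/
inductive G4Edge (a c j : ℕ) : G4Vertex a c j → G4Vertex a c j → Prop
  | ab : G4Edge a c j (A 0) B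
  | bc : G4Edge a c j B C
  | cd : G4Edge a c j C D
  | da : G4Edge a c j D (A 0)
  | path (i : Fin j) : G4Edge a c j (A i.castSucc) (A i.succ)
  | pendantA (i : Fin a) : G4Edge a c j (A (Fin.last j)) (leafA i)
  | pendantC (i : Fin c) : G4Edge a c j C (leafC i)

/-- The graph `G⁴_{a,c,j}`: a 4-cycle `A₀B₀C₀D₀` with a path `A₀A₁…A_j` starting at `A₀`,
`a` leaves attached to `A_j` and `c` leaves attached to `C₀`. -/
def G4 (a c j : ℕ) : SimpleGraph (G4Vertex a c j) := SimpleGraph.fromRel (G4Edge a c j)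

/-- The upper bound for `n ≤ 2m + 2`. -/
def boundSmall (n m : ℚ) : ℚ :=
  2 - 8 / 3 * m ^ 3 + 2 * m ^ 2 + 5 / 3 * m + 2 * m ^ 2 * n - 3 * m * n - 2 * n + n ^ 2

/-- The upper bound for odd `n ≥ 2m + 3`. -/
def boundOdd (n m : ℚ) : ℚ :=
  9 / 2 - n - 2 / 3 * m ^ 3 + 1 / 2 * n ^ 2 - 2 * n * m + 2 * m ^ 2 + 1 / 2 * m * n ^ 2
    - 11 / 6 * m

/-- The upper bound for even `n ≥ 2m + 4`. -/
def boundEven (n m : ℚ) : ℚ :=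
  6 - n - 2 / 3 * m ^ 3 + 1 / 2 * n ^ 2 - 2 * n * m + 2 * m ^ 2 + 1 / 2 * m * n ^ 2
    - 7 / 3 * m

/-- Isomorphism of graphs, as a proposition. -/
def GraphIso {V W : Type*} (G : SimpleGraph V) (H : SimpleGraph W) : Prop := Nonempty (G ≃g H)

/-! Write `n = 2m + e`. Every estimate is a sum over cuts: a cut into parts of weight `p` and `N -
p` separates `cutVal N p` pairs. Along a path the parts are prefix sums, hence distinct, and `cutSum
q N` bounds the contribution of `q` distinct cuts (`sum_cutVal_le_cutSum`).

The matching number enters through leaves. In a rooted spanning tree, choose an edge to a child at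
every vertex that has one; the edges starting at even heights form a matching, and so do those
starting at odd heights. Hence the tree has at least `e + 1` leaves
(`card_le_leaves_add_matchingNumber`). Removing `e` leaves of `G` costs `n - 1` each; moving their
weights to their neighbours leaves a unicyclic graph with `2m` vertices and total weight `2m + e`. A
sparse `G` with fewer than `e` leaves must be a cycle with `e = 1`, which is bounded directly.

The weighted problem is solved for sparse graphs (`weightedWiener_sparse_le`). A leaf of weight at
most `(e + 2) / 2` is peeled off by induction, raising the excess weight `e` by one. If there is no
such leaf, there is at most one leaf, and the graph is a path with a chord from its last vertex. Its
Wiener index is the cut sum of the path minus the savings due to the chord. A triangle is best for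
`e ≤ 2`, a 4-cycle for `e ≥ 3`, with ties on four vertices for `e = 0, 2`; longer cycles lose
strictly.

If `G` is not sparse, some cycle edge joins two vertices of degree at least three. A suitable cycle
edge can then be deleted so that the Wiener index grows by at least two and the resulting tree has
at least `max (e + 2) 3` leaves; the tree bound is strictly below the target
(`weightedWiener_lt_of_not_isSparse`).

Equality is traced back through the peeling. For the listed graphs, integer functions that change by
at most one along an edge bound the distances from below, and the upper bound then determines their
Wiener indices. -/

section WienerIndexUnicyclic

open Finset

/-! ### Sums over distinct cuts -/

/-- The number `p * (N - p)` of pairs separated by a cut of an `N`-set into parts of size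
`p` and `N - p`. -/
def cutVal (N p : ℤ) : ℤ := p * (N - p)

/-- The largest value of `∑ p ∈ P, cutVal N p` over sets `P` of `q` integers. -/
def cutSum (q N : ℕ) : ℤ := ∑ i ∈ range q, cutVal N (((N - i) / 2 : ℕ) : ℤ)

/-- The function `p * (N - p)` is symmetric about `N / 2` and increases up to it; the hypotheses say
that `p` is at least as far from the middle as `r`. -/
theorem cutVal_le_cutVal {N p r : ℤ} (h : p ≤ r) (h' : p + r ≤ N) : cutVal N p ≤ cutVal N r := by
  unfold cutVal
  nlinarith [mul_nonneg (sub_nonneg.2 h) (sub_nonneg.2 h')]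

theorem cutVal_lt_cutVal {N p r : ℤ} (h : p < r) (h' : p + r < N) : cutVal N p < cutVal N r := by
  unfold cutVal
  nlinarith [mul_pos (sub_pos.2 h) (sub_pos.2 h')]

theorem cutVal_symm (N p : ℤ) : cutVal N (N - p) = cutVal N p := by
  unfold cutVal
  ring

theorem cutSum_succ (q N : ℕ) :
    cutSum (q + 1) N = cutSum q N + cutVal N (((N - q) / 2 : ℕ) : ℤ) := by
  simp [cutSum, sum_range_succ]

/-- Among `q + 1` distinct integers the extremes differ by at least `q`, so one of them is at
distance at most `(N - q) / 2` from the corresponding end of `[0, N]`. Its cut is at most the last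
summand of `cutSum`; remove it and induct. -/
theorem sum_cutVal_le_cutSum (N : ℕ) (q : ℕ) (P : Finset ℕ) (hq : P.card = q)
    (hP : ∀ p ∈ P, p ≤ N) : ∑ p ∈ P, cutVal N p ≤ cutSum q N := by
  induction q generalizing P with
  | zero => simp [cutSum, card_eq_zero.1 hq]
  | succ q ih =>
    have hne : P.Nonempty := card_pos.1 (by omega)
    have hab : P ⊆ Icc (P.min' hne) (P.max' hne) := fun p hp =>
      mem_Icc.2 ⟨P.min'_le p hp, P.le_max' p hp⟩
    have hc := card_le_card hab
    rw [Nat.card_Icc, hq] at hc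
    have hb := hP _ (P.max'_mem hne)
    have key : ∀ c ∈ P, cutVal N c ≤ cutVal N (((N - q) / 2 : ℕ) : ℤ) →
        ∑ p ∈ P, cutVal N p ≤ cutSum (q + 1) N := by
      intro c hc hle
      rw [← add_sum_erase P _ hc, cutSum_succ, add_comm]
      exact add_le_add (ih _ (by rw [card_erase_of_mem hc, hq]; rfl)
        fun p hp => hP p (mem_of_mem_erase hp)) hle
    by_cases h : P.min' hne ≤ (N - q) / 2
    · exact key _ (P.min'_mem hne) (cutVal_le_cutVal (by omega) (by omega))
    · refine key _ (P.max'_mem hne) ?_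
      rw [← cutVal_symm]
      exact cutVal_le_cutVal (by omega) (by omega)

theorem sum_cutVal_le_cutSum_of_strictMono (N q : ℕ) (p : ℕ → ℕ)
    (hp : ∀ i j, 1 ≤ i → i < j → j ≤ q → p i < p j) (hN : ∀ i, 1 ≤ i → i ≤ q → p i ≤ N) :
    ∑ s ∈ Icc 1 q, cutVal N (p s) ≤ cutSum q N := by
  have hinj : Set.InjOn p (Icc 1 q : Finset ℕ) := by
    intro i hi j hj hij
    simp only [coe_Icc, Set.mem_Icc] at hi hj
    rcases lt_trichotomy i j with h | h | h
    · have := hp i j hi.1 h hj.2; omega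
    · exact h
    · have := hp j i hj.1 h hi.2; omega
  rw [← sum_image (f := fun p : ℕ => cutVal N p) hinj]
  refine sum_cutVal_le_cutSum N q _ (by rw [card_image_of_injOn hinj]; simp) ?_
  intro x hx
  obtain ⟨i, hi, rfl⟩ := mem_image.1 hx
  rw [mem_Icc] at hi
  exact hN i hi.1 hi.2

/-- The maximum of the Wiener index of a weighted unicyclic graph with `k` vertices and total
weight `k + e` in which no two adjacent vertices of the cycle are heavy. -/
def sparseMax (k e : ℕ) : ℤ :=
  if e ≤ 2 then cutSum (k - 2) (k + e) + 1
  else cutSum (k - 2) (k + e) - k + 4 + (if Even e then 1 else 0)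

/-! ### Weighted distances on a path with a chord -/

/-- The weight `w i` occurs in the prefix sums of lengths `i + 1, …, k`, that is `k - i` times. -/
theorem sum_weighted_prefix (w : ℕ → ℤ) (k : ℕ) :
    ∑ i ∈ range k, w i * ((k : ℤ) - i) = ∑ s ∈ range (k + 1), ∑ i ∈ range s, w i := by
  induction k with
  | zero => simp
  | succ k ih =>
    rw [sum_range_succ _ (k + 1), ← ih, sum_range_succ, sum_range_succ]
    push_cast
    have : ∀ i ∈ range k, w i * ((k : ℤ) + 1 - i) = w i * ((k : ℤ) - i) + w i :=
      fun i _ => by ring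
    rw [sum_congr rfl this, sum_add_distrib]
    ring

/-- A pair contributes once to every path edge between its two members, and the edge before `s`
separates the prefix of length `s` from the rest. The term `s = 0` is zero. -/
theorem sum_path_distances (w : ℕ → ℤ) (k : ℕ) :
    ∑ j ∈ range k, ∑ i ∈ range j, w i * w j * ((j : ℤ) - i) =
      ∑ s ∈ range k, cutVal (∑ i ∈ range k, w i) (∑ i ∈ range s, w i) := by
  induction k with
  | zero => simp
  | succ k ih =>
    rw [sum_range_succ, ih, sum_range_succ _ k]
    have h1 : ∑ i ∈ range k, w i * w k * ((k : ℤ) - i)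
        = w k * ∑ s ∈ range (k + 1), ∑ i ∈ range s, w i := by
      rw [← sum_weighted_prefix, mul_sum]
      exact sum_congr rfl fun i _ => by ring
    have h2 : ∀ s ∈ range k, cutVal (∑ i ∈ range (k + 1), w i) (∑ i ∈ range s, w i) =
        cutVal (∑ i ∈ range k, w i) (∑ i ∈ range s, w i) + w k * ∑ i ∈ range s, w i := by
      intro s _
      rw [sum_range_succ]
      unfold cutVal
      ring
    rw [h1, sum_congr rfl h2, sum_add_distrib, sum_range_succ _ k, sum_range_succ _ k, ← mul_sum]
    unfold cutVal
    ring

/-- Distances in a path `0, …, K + 1` with an extra edge from `K + 1` to `t`: an upper bound for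
the weighted Wiener index. -/
theorem sum_lollipop_distances_le (w : ℕ → ℕ) (D : ℕ → ℕ → ℕ) (K t g : ℕ) (hg : K + 2 = t + g)
    (hg3 : 3 ≤ g)
    (h1 : ∀ i j, i < j → j < K + 2 → D i j ≤ j - i)
    (h2 : ∀ i, i ≤ t → D i (K + 1) ≤ t - i + 1)
    (h3 : ∀ i, i ≤ t → D i K ≤ t - i + 2)
    (h4 : D (t + 1) (K + 1) ≤ 2) (hw : w (K + 1) = 1) :
    ∑ j ∈ range (K + 2), ∑ i ∈ range j, (w i : ℤ) * w j * D i j ≤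
      ∑ s ∈ Icc 1 K, cutVal (∑ i ∈ range (K + 2), (w i : ℤ)) (∑ i ∈ range s, (w i : ℤ))
        + (∑ i ∈ range (K + 2), (w i : ℤ)) - 1
        - (g - 2) * (∑ i ∈ range (t + 1), (w i : ℤ))
        - (g - 4 : ℕ) * ((∑ i ∈ range (t + 1), (w i : ℤ)) * w K + w (t + 1)) := by
  have hpath := sum_path_distances (fun i => (w i : ℤ)) (K + 2)
  rw [sum_range_succ, sum_range_succ] at hpath
  rw [sum_range_succ, sum_range_succ]
  have e1 : ∑ j ∈ range K, ∑ i ∈ range j, (w i : ℤ) * w j * D i j ≤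
      ∑ j ∈ range K, ∑ i ∈ range j, (w i : ℤ) * w j * ((j : ℤ) - i) := by
    refine sum_le_sum fun j hj => sum_le_sum fun i hi => ?_
    rw [mem_range] at hi hj
    have := h1 i j hi (by omega)
    exact mul_le_mul_of_nonneg_left (by omega) (by positivity)
  have split : ∀ (c : ℤ) (M : ℕ), t + 1 ≤ M →
      ∑ i ∈ range M, (w i : ℤ) * (if i ≤ t then c else 0) =
        c * ∑ i ∈ range (t + 1), (w i : ℤ) := by
    intro c M hM
    rw [mul_sum, ← sum_subset (range_mono hM)]
    · exact sum_congr rfl fun i hi => by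
        rw [mem_range] at hi
        rw [if_pos (by omega)]
        ring
    · intro i _ hi
      rw [mem_range] at hi
      rw [if_neg (by omega)]
      ring
  -- Through the chord a vertex `i ≤ t` reaches `K` in `t - i + 2` steps, saving `g - 4`; the
  -- truncated subtraction makes the saving zero for a triangle.
  have e2 : ∑ i ∈ range K, (w i : ℤ) * w K * D i K ≤
      ∑ i ∈ range K, (w i : ℤ) * w K * ((K : ℤ) - i)
        - w K * ∑ i ∈ range K, (w i : ℤ) * (if i ≤ t then ((g - 4 : ℕ) : ℤ) else 0) := by
    rw [mul_sum, ← sum_sub_distrib]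
    refine sum_le_sum fun i hi => ?_
    rw [mem_range] at hi
    have a1 := h1 i K hi (by omega)
    have : (D i K : ℤ) ≤ (K : ℤ) - i - (if i ≤ t then ((g - 4 : ℕ) : ℤ) else 0) := by
      split_ifs with h
      · have := h3 i h
        omega
      · omega
    calc (w i : ℤ) * w K * D i K ≤ (w i : ℤ) * w K * _ :=
          mul_le_mul_of_nonneg_left this (by positivity)
      _ = _ := by ring
  -- For the last vertex the chord saves `g - 2` from every `i ≤ t`, and `g - 4` from `t + 1`.
  have e3 : ∑ i ∈ range (K + 1), (w i : ℤ) * w (K + 1) * D i (K + 1) ≤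
      ∑ i ∈ range (K + 1), (w i : ℤ) * w (K + 1) * (((K + 1 : ℕ) : ℤ) - i)
        - (∑ i ∈ range (K + 1), (w i : ℤ) * (if i ≤ t then ((g : ℤ) - 2) else 0)
          + ∑ i ∈ range (K + 1), (w i : ℤ) * (if i = t + 1 then ((g - 4 : ℕ) : ℤ) else 0)) := by
    rw [← sum_add_distrib, ← sum_sub_distrib]
    refine sum_le_sum fun i hi => ?_
    rw [mem_range] at hi
    have a1 := h1 i (K + 1) hi (by omega)
    have : (D i (K + 1) : ℤ) ≤ ((K + 1 : ℕ) : ℤ) - i - (if i ≤ t then ((g : ℤ) - 2) else 0)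
        - (if i = t + 1 then ((g - 4 : ℕ) : ℤ) else 0) := by
      split_ifs with h h' h'
      · omega
      · have := h2 i h
        omega
      · subst h'
        omega
      · omega
    calc (w i : ℤ) * w (K + 1) * D i (K + 1) ≤ (w i : ℤ) * w (K + 1) * _ :=
          mul_le_mul_of_nonneg_left this (by positivity)
      _ = _ := by rw [hw]; push_cast; ring
  have e4 : ∑ i ∈ range (K + 1), (w i : ℤ) * (if i = t + 1 then ((g - 4 : ℕ) : ℤ) else 0) =
      (g - 4 : ℕ) * w (t + 1) := by
    rw [sum_eq_single (t + 1)]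
    · simp; ring
    · intro b _ hb
      simp [hb]
    · intro h
      exact absurd (mem_range.2 (by omega)) h
  rw [split _ _ (by omega)] at e2
  rw [split _ _ (by omega), e4] at e3
  -- The cut `s = 0` is empty, and the cut `s = K + 1` splits off the last vertex, of weight one,
  -- with value `N - 1`.
  have e5 : ∑ s ∈ range (K + 2), cutVal (∑ i ∈ range (K + 2), (w i : ℤ)) (∑ i ∈ range s, (w i : ℤ))
      = ∑ s ∈ Icc 1 K, cutVal (∑ i ∈ range (K + 2), (w i : ℤ)) (∑ i ∈ range s, (w i : ℤ))
        + (∑ i ∈ range (K + 2), (w i : ℤ)) - 1 := by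
    rw [sum_range_succ, range_eq_Ico, sum_eq_sum_Ico_succ_bot (by omega)]
    have : Ico (0 + 1) (K + 1) = Icc 1 K := by ext; simp
    rw [this, sum_range_succ _ (K + 1), hw]
    simp [cutVal]
    ring
  rw [e5] at hpath
  push_cast at *
  linarith

/-- The candidate maximum realised by weighted 4-cycles with a tail. -/
def squareMax (K e : ℕ) : ℤ := cutSum K (K + 2 + e) - K + 2 + (if Even e then 1 else 0)

/-- For `e ≥ 3` both sides agree by definition. For `e ≤ 2` the comparison is `-K + 2 + [e even] ≤
1`, with equality exactly for `K = 2` and even `e`: the source of the exceptional 4-cycles. -/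
theorem squareMax_le_sparseMax {K e : ℕ} (hK : 2 ≤ K) :
    squareMax K e ≤ sparseMax (K + 2) e ∧
      (squareMax K e = sparseMax (K + 2) e → 3 ≤ e ∨ (K = 2 ∧ (e = 0 ∨ e = 2))) := by
  unfold squareMax sparseMax
  rw [Nat.add_sub_cancel]
  by_cases he : e ≤ 2
  · rw [if_pos he]
    interval_cases e <;> simp <;> omega
  · rw [if_neg he]
    push_cast
    exact ⟨by linarith, fun _ => .inl (by omega)⟩

/-- This trades the last two summands of `cutSum` for the two cuts of the 4-cycle, each cutting off
the vertex opposite the tail with one light neighbour. The size `e / 2 + 2` is that of the extremal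
graph, and the subtracted term is what is lost against the best path cuts. -/
theorem cutSum_sub_two_add {t e N : ℕ} (hN : N = t + 4 + e) :
    squareMax (t + 2) e = cutSum t N + 2 * cutVal N ((e / 2 + 2 : ℕ) : ℤ)
      - (if Even e then 2 * t else t) := by
  unfold squareMax
  rw [show t + 2 + 2 + e = N by omega, cutSum_succ, cutSum_succ]
  rcases Nat.even_or_odd' e with ⟨c, rfl | rfl⟩
  · rw [show (N - t) / 2 = c + 2 by omega, show (N - (t + 1)) / 2 = c + 1 by omega,
      show 2 * c / 2 + 2 = c + 2 by omega, if_pos (by simp), if_pos (by simp), hN]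
    simp only [cutVal]
    push_cast
    ring
  · rw [show (N - t) / 2 = c + 2 by omega, show (N - (t + 1)) / 2 = c + 2 by omega,
      show (2 * c + 1) / 2 + 2 = c + 2 by omega, if_neg (by simp), if_neg (by simp)]
    push_cast
    ring

/-! ### Optimal weights for each cycle length -/

section numeric

variable {w : ℕ → ℕ} {K t e : ℕ}

theorem prefix_add_le (hpos : ∀ i < K + 2, 1 ≤ w i) {r s : ℕ} (hrs : r ≤ s) (hs : s ≤ K + 2) :
    ∑ i ∈ range r, w i + (s - r) ≤ ∑ i ∈ range s, w i := by
  induction s, hrs using Nat.le_induction with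
  | base => simp
  | succ s hrs ih =>
    have := ih (by omega)
    have := hpos s (by omega)
    rw [sum_range_succ]
    omega

theorem sum_cutVal_prefix_le (hpos : ∀ i < K + 2, 1 ≤ w i) {q : ℕ} (hq : q ≤ K + 2) :
    ∑ s ∈ Icc 1 q, cutVal ((∑ i ∈ range (K + 2), w i : ℕ) : ℤ) ((∑ i ∈ range s, w i : ℕ) : ℤ) ≤
      cutSum q (∑ i ∈ range (K + 2), w i) := by
  refine sum_cutVal_le_cutSum_of_strictMono _ q _ (fun i j _ hij hj => ?_) fun i _ hi => ?_
  · have := prefix_add_le hpos hij.le (hj.trans hq)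
    omega
  · have := prefix_add_le hpos (hi.trans hq) le_rfl
    omega

/-- The case of a triangle. -/
theorem triangle_numeric (hK : 2 ≤ K) (hpos : ∀ i < K + 2, 1 ≤ w i)
    (hN : ∑ i ∈ range (K + 2), w i = K + 2 + e) (h1 : w (K + 1) = 1) (h2 : w K = 1)
    (hc : e + 3 ≤ 2 * w 0 ∨ K = 2) {Z : ℤ}
    (hZ : Z = ∑ s ∈ Icc 1 K, cutVal ((∑ i ∈ range (K + 2), w i : ℕ) : ℤ)
      ((∑ i ∈ range s, w i : ℕ) : ℤ) + 1) :
    Z ≤ sparseMax (K + 2) e ∧ (Z = sparseMax (K + 2) e →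
      e ≤ 2 ∧ w 0 = e + 1 ∧ ∀ i, 0 < i → i < K + 2 → w i = 1) := by
  have hP2 : ∑ i ∈ range K, w i = K + e := by
    rw [sum_range_succ, sum_range_succ] at hN
    omega
  have hle := sum_cutVal_prefix_le hpos (q := K) (by omega)
  have hones : w 0 = e + 1 → ∀ i, 0 < i → i < K + 2 → w i = 1 := by
    intro h0 i hi hi'
    have a := prefix_add_le hpos (r := 1) (s := i) (by omega) (by omega)
    have b := prefix_add_le hpos (r := i + 1) (s := K + 2) (by omega) le_rfl
    rw [sum_range_succ] at b
    rw [sum_range_one] at a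
    have := hpos i hi'
    omega
  by_cases he : e ≤ 2
  · refine ⟨?_, fun heq => ?_⟩
    · rw [hZ, sparseMax, if_pos he, ← hN]
      simpa using hle
    · have h0 : w 0 = e + 1 := by
        have a := prefix_add_le hpos (r := 1) (s := K + 2) (by omega) le_rfl
        rw [sum_range_one] at a
        have hp := hpos 0 (by omega)
        -- For `e ≤ 2` a heavy end already has `w 0 = e + 1`; for `K = 2` the few other values of `w
        -- 0` are checked against the maximum.
        rcases hc with hc | rfl
        · omega
        · rw [hZ, sparseMax, if_pos he, hN, show Icc 1 2 = {1, 2} from rfl] at heq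
          rw [sum_pair (by norm_num), hP2, sum_range_one] at heq
          have hw : w 0 ≤ 3 := by omega
          generalize w 0 = x at *
          simp only [cutSum, cutVal, sum_range_succ, range_zero, sum_empty] at heq
          interval_cases e <;> interval_cases x <;> simp_all
      exact ⟨he, h0, hones h0⟩
  -- For `e ≥ 3` a triangle is too costly: its last prefix has weight `N - 2` and yields only `2 *
  -- (N - 2)`, where the last summand of `cutSum` is at least `3 * (N - 3)`. The resulting margin is
  -- at least `e - 2`.
  · have hlt : Z < sparseMax (K + 2) e := by
      obtain ⟨L, rfl⟩ : ∃ L, K = L + 1 := ⟨K - 1, by omega⟩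
      have hle' := sum_cutVal_prefix_le hpos (q := L) (by omega)
      have hI : Icc 1 (L + 1) = insert (L + 1) (Icc 1 L) := by
        ext
        simp
        omega
      rw [hZ, hI, sum_insert (by simp), hP2, sparseMax, if_neg he, hN]
      rw [hN] at hle'
      simp only [Nat.add_sub_cancel, cutSum_succ]
      have h3 : cutVal ((L + 1 + 2 + e : ℕ) : ℤ) (3 : ℤ) ≤ cutVal ((L + 1 + 2 + e : ℕ) : ℤ)
          (((L + 1 + 2 + e - L) / 2 : ℕ) : ℤ) := cutVal_le_cutVal (by omega) (by omega)
      have : (0 : ℤ) ≤ if Even e then 1 else 0 := by split_ifs <;> simp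
      simp only [cutVal] at *
      push_cast at *
      have : (3 : ℤ) ≤ e := by omega
      linarith
    exact ⟨hlt.le, fun h => absurd h hlt.ne⟩

/-- The case of a 4-cycle. -/
theorem square_numeric (hpos : ∀ i < t + 2 + 2, 1 ≤ w i)
    (hN : ∑ i ∈ range (t + 2 + 2), w i = t + 2 + 2 + e) (h1 : w (t + 3) = 1) (h2 : w (t + 1) = 1)
    (hc : (1 ≤ t ∧ e + 3 ≤ 2 * w 0) ∨ (t = 0 ∧ w 2 ≤ w 0)) {Z : ℤ}
    (hZ : Z = ∑ s ∈ Icc 1 t, cutVal ((∑ i ∈ range (t + 2 + 2), w i : ℕ) : ℤ)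
      ((∑ i ∈ range s, w i : ℕ) : ℤ) +
        2 * cutVal ((∑ i ∈ range (t + 2 + 2), w i : ℕ) : ℤ) ((w (t + 2) + 1 : ℕ) : ℤ)) :
    Z ≤ squareMax (t + 2) e ∧ (Z = squareMax (t + 2) e →
      w 0 = (e + 1) / 2 + 1 ∧ w (t + 2) = e / 2 + 1 ∧
        ∀ i < t + 2 + 2, i ≠ 0 → i ≠ t + 2 → w i = 1) := by
  have hS : ∑ i ∈ range (t + 1), w i + 1 + w (t + 2) + 1 = t + 2 + 2 + e := by
    rw [← hN, sum_range_succ _ (t + 3), sum_range_succ _ (t + 2), sum_range_succ _ (t + 1), h1, h2]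
  have hle := sum_cutVal_prefix_le hpos (q := t) (by omega)
  have ha := prefix_add_le hpos (r := 1) (s := t + 1) (by omega) (by omega)
  rw [sum_range_one] at ha
  have hy := hpos (t + 2) (by omega)
  set y := w (t + 2) with hydef
  set c := e / 2 with hcdef
  have hones : w 0 = (e + 1) / 2 + 1 → y = c + 1 →
      ∀ i < t + 2 + 2, i ≠ 0 → i ≠ t + 2 → w i = 1 := by
    intro h0 hyc i hi hi0 hit
    rcases lt_or_ge i (t + 1) with h | h
    · have a := prefix_add_le hpos (r := 1) (s := i) (by omega) (by omega)
      have b := prefix_add_le hpos (r := i + 1) (s := t + 1) (by omega) (by omega)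
      rw [sum_range_succ] at b
      rw [sum_range_one] at a
      have := hpos i hi
      omega
    · obtain rfl | rfl : i = t + 1 ∨ i = t + 3 := by omega
      · exact h2
      · exact h1
  rw [hN] at hZ hle
  have hN' : ((t + 2 + 2 + e : ℕ) : ℤ) = t + 4 + e := by push_cast; ring
  rw [cutSum_sub_two_add (N := t + 2 + 2 + e) (by omega)]
  -- If `y ≤ c`, each of the two cuts of the 4-cycle falls short by at least `t + 1`, together more
  -- than the correction of at most `2 * t`.
  by_cases hyc : y ≤ c
  · have hlt : Z < cutSum t (t + 2 + 2 + e) + 2 * cutVal ((t + 2 + 2 + e : ℕ) : ℤ)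
        ((c + 2 : ℕ) : ℤ) - (if Even e then 2 * t else t) := by
      have hf := cutVal_le_cutVal (N := ((t + 2 + 2 + e : ℕ) : ℤ)) (p := ((y + 1 : ℕ) : ℤ))
        (r := ((c + 1 : ℕ) : ℤ)) (by omega) (by omega)
      have hd : cutVal ((t + 2 + 2 + e : ℕ) : ℤ) ((c + 2 : ℕ) : ℤ) =
          cutVal ((t + 2 + 2 + e : ℕ) : ℤ) ((c + 1 : ℕ) : ℤ) + (t + 1 + e - 2 * c) := by
        simp only [cutVal]
        push_cast
        ring
      have : (2 * (c : ℤ)) ≤ e := by omega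
      have : ((if Even e then 2 * t else t : ℕ) : ℤ) ≤ 2 * t := by split_ifs <;> push_cast <;> omega
      rw [hZ]
      linarith
    exact ⟨hlt.le, fun h => absurd h hlt.ne⟩
  · have hyc' : y = c + 1 := by
      rcases hc with hc | ⟨rfl, hc⟩
      · omega
      · rw [sum_range_one] at hS
        simp only [zero_add] at *
        omega
    have h0 : w 0 = (e + 1) / 2 + 1 := by
      rcases hc with hc | ⟨rfl, hc⟩
      · omega
      · rw [sum_range_one] at hS
        simp only [zero_add] at *
        omega
    refine ⟨?_, fun _ => ⟨h0, hyc', hones h0 hyc'⟩⟩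
    rw [hZ, hyc']
    have : ∑ s ∈ Icc 1 t, cutVal ((t + 2 + 2 + e : ℕ) : ℤ) ((∑ i ∈ range s, w i : ℕ) : ℤ) ≤
        cutSum t (t + 2 + 2 + e) - (if Even e then 2 * t else t) := by
      rcases hc with ⟨ht, hc⟩ | ⟨rfl, hc⟩
      · have hodd : e = 2 * c + 1 := by omega
        have hP : ∀ s ∈ Icc 1 t, cutVal ((t + 2 + 2 + e : ℕ) : ℤ) ((∑ i ∈ range s, w i : ℕ) : ℤ)
            = cutVal ((t + 2 + 2 + e : ℕ) : ℤ) ((c + 1 + s : ℕ) : ℤ) := by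
          intro s hs
          rw [mem_Icc] at hs
          have a := prefix_add_le hpos (r := 1) (s := s) (by omega) (by omega)
          have b := prefix_add_le hpos (r := s) (s := t + 1) (by omega) (by omega)
          rw [sum_range_one] at a
          congr 2
          omega
        rw [sum_congr rfl hP, if_neg (by rw [hodd]; simp)]
        -- The prefixes have weights `c + 2, …, c + 1 + t`, whereas the block symmetric about `N /
        -- 2` is one unit to the right. The shift telescopes to a difference of two cuts, equal to
        -- `-t`.
        have hshift := sum_cutVal_le_cutSum_of_strictMono (t + 2 + 2 + e) t (fun s => c + 2 + s)
          (fun i j _ h _ => by simpa using h) (fun i _ h => by omega)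
        have htel : ∀ T : ℕ, ∑ s ∈ Icc 1 T, cutVal ((t + 2 + 2 + e : ℕ) : ℤ) ((c + 1 + s : ℕ) : ℤ)
            = ∑ s ∈ Icc 1 T, cutVal ((t + 2 + 2 + e : ℕ) : ℤ) ((c + 2 + s : ℕ) : ℤ)
              + cutVal ((t + 2 + 2 + e : ℕ) : ℤ) ((c + 2 : ℕ) : ℤ)
              - cutVal ((t + 2 + 2 + e : ℕ) : ℤ) ((c + 2 + T : ℕ) : ℤ) := by
          intro T
          induction T with
          | zero => simp
          | succ T ih =>
            rw [sum_Icc_succ_top (by omega), sum_Icc_succ_top (by omega), ih, show c + 1 + (T + 1) = c + 2 + T by omega]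
            ring
        rw [htel]
        simp only [cutVal] at *
        rw [hodd] at *
        push_cast at *
        nlinarith
      · simp [cutSum]
    linarith

/-- The case of a cycle with at least five vertices. -/
theorem long_cycle_numeric {g : ℕ} (hg : K + 2 = t + g) (hg5 : 5 ≤ g)
    (hpos : ∀ i < K + 2, 1 ≤ w i)
    (hN : ∑ i ∈ range (K + 2), w i = K + 2 + e) (h1 : w (K + 1) = 1) (h2 : w (t + 1) = 1)
    (hc : (1 ≤ t ∧ e + 3 ≤ 2 * w 0) ∨ (t = 0 ∧ ∀ i < K + 2, w i ≤ w 0)) {Z : ℤ}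
    (hZ : Z = ∑ s ∈ Icc 1 K, cutVal ((∑ i ∈ range (K + 2), w i : ℕ) : ℤ)
      ((∑ i ∈ range s, w i : ℕ) : ℤ) + ((∑ i ∈ range (K + 2), w i : ℕ) : ℤ) - 1
        - (g - 2) * ((∑ i ∈ range (t + 1), w i : ℕ) : ℤ)
        - (g - 4 : ℕ) * (((∑ i ∈ range (t + 1), w i : ℕ) : ℤ) * w K + w (t + 1))) :
    Z < squareMax K e := by
  have hle := sum_cutVal_prefix_le hpos (q := K) (by omega)
  have ha := prefix_add_le hpos (r := 1) (s := t + 1) (by omega) (by omega)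
  rw [sum_range_one] at ha
  have hwK := hpos K (by omega)
  have hw0 := hpos 0 (by omega)
  rw [hN] at hZ hle
  set P := ∑ i ∈ range (t + 1), w i with hP
  have hcast : ((g - 4 : ℕ) : ℤ) = (g : ℤ) - 4 := by omega
  rw [h2, hcast] at hZ
  have hPK : (P : ℤ) ≤ P * w K := by
    have : P * 1 ≤ P * w K := Nat.mul_le_mul_left _ hwK
    rw [mul_one] at this
    exact_mod_cast this
  have hg4 : (0 : ℤ) ≤ (g : ℤ) - 4 := by omega
  have hd := mul_le_mul_of_nonneg_left hPK hg4
  unfold squareMax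
  -- What remains after bounding the path cuts by `cutSum`: the savings through the chord outweigh
  -- the slack in `squareMax`.
  have key : (K : ℤ) + 2 + e - 1 - (g - 2) * P - (g - 4) * (P + 1)
      < - K + 2 + (if Even e then 1 else 0) := by
    have hev : (0 : ℤ) ≤ if Even e then 1 else 0 := by split_ifs <;> simp
    have hgK : (K : ℤ) = t + g - 2 := by omega
    rcases hc with ⟨ht, hc⟩ | ⟨rfl, hc⟩
    · have e1 : (e : ℤ) + 3 + 2 * t ≤ 2 * P := by omega
      have e2 : (1 : ℤ) ≤ P := by omega
      nlinarith
    · have hPw : P = w 0 := by simp [hP]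
      -- Without a tail, `P` is the maximal weight; the two neighbours of that vertex weigh one and
      -- the other `g - 2` vertices at most `P` each.
      have hsum : K + 2 + e ≤ (g - 2) * P + 2 := by
        rw [← hN, sum_range_succ, h1, range_eq_Ico, sum_eq_sum_Ico_succ_bot (by omega),
          sum_eq_sum_Ico_succ_bot (by omega)]
        rw [zero_add] at h2
        have : ∑ i ∈ Ico (0 + 1 + 1) (K + 1), w i ≤ (K - 1) * P := by
          calc _ ≤ ∑ i ∈ Ico (0 + 1 + 1) (K + 1), P := sum_le_sum fun i hi => by
                rw [mem_Ico] at hi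
                rw [hPw]
                exact hc i (by omega)
            _ = _ := by simp
        simp only [zero_add] at this ⊢
        rw [h2, ← hPw]
        have h3 : (g - 2) * P = (K - 1) * P + P := by
          rw [show g - 2 = K - 1 + 1 by omega, add_mul, one_mul]
        omega
      have hsum' : (K : ℤ) + 2 + e ≤ (g - 2) * P + 2 := by
        have : ((g - 2 : ℕ) : ℤ) = (g : ℤ) - 2 := by omega
        rw [← this]
        exact_mod_cast hsum
      rcases Nat.lt_or_ge P 2 with hlt | hge
      · have hP1 : P = 1 := by omega
        have he : e = 0 := by
          rw [hP1] at hsum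
          omega
        subst he
        rw [hP1]
        simp
        omega
      · have : (2 : ℤ) ≤ P := by exact_mod_cast hge
        nlinarith
  rw [hZ]
  push_cast at *
  nlinarith

end numeric

/-! ### Removing leaves; weighted trees -/

section peel

universe u

/-- The number of neighbours of a vertex. -/
noncomputable def vdeg {V : Type*} (G : SimpleGraph V) (x : V) : ℕ := (G.neighborSet x).ncard

/-- The sum of `w x * w y * d(x, y)` over ordered pairs of vertices. -/
noncomputable def weightedWiener {V : Type*} [Fintype V] (G : SimpleGraph V) (w : V → ℕ) : ℤ :=
  ∑ x, ∑ y, (w x : ℤ) * w y * G.dist x y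

open scoped Classical in
/-- The weight of a vertex after the weights have been moved along `r`. -/
noncomputable def pushWeight {V V' : Type*} [Fintype V] (r : V → V') (w : V → ℕ) (z : V') : ℕ :=
  ∑ x with r x = z, w x

open scoped Classical in
theorem sum_pushWeight {V V' : Type*} [Fintype V] [Fintype V'] (r : V → V') (w : V → ℕ) :
    ∑ z, pushWeight r w z = ∑ x, w x :=
  sum_fiberwise univ r w

open scoped Classical in
-- The cost `c x` is paid once for every pair containing `x`, which totals `c x` times the cut
-- separating `x` from everything else. The factor two comes from ordered pairs.
theorem weightedWiener_le_push {V V' : Type*} [Fintype V] [Fintype V'] (G : SimpleGraph V)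
    (H : SimpleGraph V') (w c : V → ℕ) (r : V → V')
    (h : ∀ x y, x ≠ y → G.dist x y ≤ c x + c y + H.dist (r x) (r y)) :
    weightedWiener G w ≤ 2 * ∑ x, c x * cutVal (∑ y, (w y : ℤ)) (w x) +
      weightedWiener H (pushWeight r w) := by
  have h1 : weightedWiener H (pushWeight r w) =
      ∑ x, ∑ y, (w x : ℤ) * w y * H.dist (r x) (r y) := by
    unfold weightedWiener pushWeight
    rw [← sum_fiberwise univ r]
    refine sum_congr rfl fun z _ => ?_
    rw [sum_comm' (t' := univ) (s' := fun _ => univ.filter (r · = z)) (by simp), ← sum_fiberwise univ r]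
    refine sum_congr rfl fun z' _ => ?_
    push_cast
    rw [sum_mul_sum, sum_mul, sum_comm]
    refine sum_congr rfl fun y hy => ?_
    rw [sum_mul]
    refine sum_congr rfl fun x hx => ?_
    rw [(mem_filter.1 hx).2, (mem_filter.1 hy).2]
  have h2 : ∀ x y : V, (w x : ℤ) * w y * G.dist x y ≤
      (if x = y then 0 else (w x : ℤ) * w y * (c x + c y)) + w x * w y * H.dist (r x) (r y) := by
    intro x y
    split_ifs with hxy
    · subst hxy
      simp
    · rw [← mul_add]
      exact mul_le_mul_of_nonneg_left (by exact_mod_cast h x y hxy) (by positivity)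
  have h3 : ∑ x, ∑ y, (if x = y then (0 : ℤ) else (w x : ℤ) * w y * (c x + c y)) =
      2 * ∑ x, c x * cutVal (∑ y, (w y : ℤ)) (w x) := by
    have e1 : ∀ x y : V, (if x = y then (0 : ℤ) else (w x : ℤ) * w y * (c x + c y)) =
        (w x * c x * w y + w x * (w y * c y)) - (if x = y then 2 * ((w x : ℤ) * w x * c x) else 0) := by
      intro x y
      split_ifs with hxy
      · subst hxy; ring
      · ring
    simp only [e1, sum_sub_distrib, sum_add_distrib, ← mul_sum, sum_ite_eq, mem_univ, if_true]
    rw [← sum_mul, ← sum_mul]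
    simp only [cutVal, mul_sub, sum_sub_distrib]
    have e2 : ∑ x, (c x : ℤ) * (w x * ∑ y, (w y : ℤ)) = (∑ x, (w x : ℤ) * c x) * ∑ y, (w y : ℤ) := by
      rw [sum_mul]
      exact sum_congr rfl fun _ _ => by ring
    have e3 : ∑ x, (c x : ℤ) * ((w x : ℤ) * w x) = ∑ x, (w x : ℤ) * w x * c x :=
      sum_congr rfl fun _ _ => by ring
    rw [e2, e3]
    ring
  rw [h1, ← h3, ← sum_add_distrib, weightedWiener]
  refine sum_le_sum fun x _ => ?_
  rw [← sum_add_distrib]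
  exact sum_le_sum fun y _ => h2 x y

/-- `r` maps every vertex of the set `S` of leaves to its neighbour, which lies outside `S`, and
fixes the other vertices. -/
structure IsPendantRetraction {V : Type*} (G : SimpleGraph V) (S : Set V)
    (r : V → (Sᶜ : Set V)) : Prop where
  adj_iff : ∀ x ∈ S, ∀ y, G.Adj x y ↔ y = r x
  fix : ∀ x : (Sᶜ : Set V), r x = x

namespace IsPendantRetraction

variable {V : Type*} {G : SimpleGraph V} {S : Set V} {r : V → (Sᶜ : Set V)}

theorem adj (h : IsPendantRetraction G S r) {x y : V} (hxy : G.Adj x y) :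
    r x = r y ∨ (G.induce Sᶜ).Adj (r x) (r y) := by
  by_cases hx : x ∈ S
  · have h1 := (h.adj_iff x hx y).1 hxy
    left
    rw [h1, h.fix]
  · by_cases hy : y ∈ S
    · have h1 := (h.adj_iff y hy x).1 hxy.symm
      left
      rw [h1, h.fix]
    · right
      have e1 := h.fix ⟨x, hx⟩
      have e2 := h.fix ⟨y, hy⟩
      simp only at e1 e2
      rw [e1, e2]
      exact hxy

theorem reachable (h : IsPendantRetraction G S r) {x y : V} (hxy : G.Reachable x y) :
    (G.induce Sᶜ).Reachable (r x) (r y) := by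
  obtain ⟨p⟩ := hxy
  induction p with
  | nil => exact .refl _
  | cons ha _ ih =>
    rcases h.adj ha with h1 | h1
    · rwa [h1]
    · exact h1.reachable.trans ih

theorem connected (h : IsPendantRetraction G S r) (hG : G.Connected) :
    (G.induce Sᶜ).Connected := by
  have := hG.nonempty
  refine (SimpleGraph.connected_iff _).2 ⟨fun x y => ?_, ⟨r (Classical.arbitrary V)⟩⟩
  rw [← h.fix x, ← h.fix y]
  exact h.reachable (hG _ _)

open scoped Classical in
theorem dist_le (h : IsPendantRetraction G S r) (hG : G.Connected) (x y : V) :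
    G.dist x y ≤ (if x ∈ S then 1 else 0) + (if y ∈ S then 1 else 0) +
      (G.induce Sᶜ).dist (r x) (r y) := by
  have h1 : ∀ x, G.dist x (r x) ≤ if x ∈ S then 1 else 0 := by
    intro x
    split_ifs with hx
    · exact (SimpleGraph.dist_eq_one_iff_adj.2 ((h.adj_iff x hx _).2 rfl)).le
    · have e := h.fix ⟨x, hx⟩
      simp only at e
      rw [e]
      simp
  have h2 : G.dist (r x) (r y) ≤ (G.induce Sᶜ).dist (r x) (r y) := by
    obtain ⟨p, hp⟩ := (h.connected hG).exists_walk_length_eq_dist (r x) (r y)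
    rw [← hp, ← p.length_map (SimpleGraph.Embedding.induce Sᶜ).toHom]
    exact SimpleGraph.dist_le _
  have t1 := hG.dist_triangle (u := x) (v := r x) (w := y)
  have t2 := hG.dist_triangle (u := (r x : V)) (v := r y) (w := y)
  have := h1 x
  have := h1 y
  rw [SimpleGraph.dist_comm] at this
  omega

theorem vdeg_eq [Finite V] (h : IsPendantRetraction G S r) (z : (Sᶜ : Set V)) :
    vdeg G z = vdeg (G.induce Sᶜ) z + {x | x ∈ S ∧ r x = z}.ncard := by
  unfold vdeg
  rw [← Set.ncard_image_of_injective _ (Subtype.val_injective (p := (· ∈ Sᶜ))),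
    ← Set.ncard_union_eq]
  · congr 1
    ext y
    simp only [SimpleGraph.mem_neighborSet, Set.mem_union, Set.mem_image, Set.mem_ofPred_eq]
    constructor
    · intro hy
      by_cases hyS : y ∈ S
      · exact .inr ⟨hyS, Subtype.ext ((h.adj_iff y hyS z).1 hy.symm).symm⟩
      · exact .inl ⟨⟨y, hyS⟩, hy, rfl⟩
    · rintro (⟨y, hy, rfl⟩ | ⟨hyS, hy⟩)
      · exact hy
      · exact ((h.adj_iff y hyS z).2 (congrArg Subtype.val hy.symm)).symm
  · rw [Set.disjoint_left]
    rintro _ ⟨y, _, rfl⟩ ⟨hyS, _⟩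
    exact y.2 hyS

theorem vdeg_eq_one (h : IsPendantRetraction G S r) {x : V} (hx : x ∈ S) : vdeg G x = 1 := by
  unfold vdeg
  rw [Set.ncard_eq_one]
  exact ⟨r x, Set.ext fun y => h.adj_iff x hx y⟩

open scoped Classical in
-- A removed leaf loses its own degree and lowers that of its neighbour by one. Thus the degree-sum
-- conditions for trees and for unicyclic graphs survive peeling.
theorem sum_vdeg [Fintype V] [Fintype (Sᶜ : Set V)] (h : IsPendantRetraction G S r) :
    ∑ x, vdeg G x = ∑ z, vdeg (G.induce Sᶜ) z + 2 * S.ncard := by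
  have h1 : ∑ x, vdeg G x = ∑ x with x ∈ S, vdeg G x + ∑ x with x ∉ S, vdeg G x :=
    (sum_filter_add_sum_filter_not _ _ _).symm
  have h2 : ∑ x with x ∈ S, vdeg G x = S.ncard := by
    rw [sum_congr rfl fun x hx => h.vdeg_eq_one (mem_filter.1 hx).2, Set.ncard_eq_toFinset_card']
    simp
  have h3 : ∑ x with x ∉ S, vdeg G x = ∑ z : (Sᶜ : Set V), vdeg G z :=
    sum_subtype _ (by simp) _
  have h4 : ∑ z : (Sᶜ : Set V), {x | x ∈ S ∧ r x = z}.ncard = S.ncard := by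
    rw [Set.ncard_eq_toFinset_card', card_eq_sum_card_fiberwise (f := r) (t := univ) (by simp)]
    refine sum_congr rfl fun z _ => ?_
    rw [Set.ncard_eq_toFinset_card']
    congr 1
    ext
    simp
  rw [h1, h2, h3, sum_congr rfl fun z _ => h.vdeg_eq z, sum_add_distrib, h4]
  ring

open scoped Classical in
theorem push_eq [Fintype V] (h : IsPendantRetraction G S r) (w : V → ℕ) (z : (Sᶜ : Set V)) :
    pushWeight r w z = w z + ∑ x with x ∈ S ∧ r x = z, w x := by
  have : ∀ x, r x = z ↔ x = z ∨ (x ∈ S ∧ r x = z) := by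
    intro x
    constructor
    · intro hx
      by_cases hxS : x ∈ S
      · exact .inr ⟨hxS, hx⟩
      · have e := h.fix ⟨x, hxS⟩
        simp only at e
        rw [e] at hx
        exact .inl (congrArg Subtype.val hx)
    · rintro (rfl | hx)
      · exact h.fix z
      · exact hx.2
  have hd : Disjoint (univ.filter (· = (z : V))) (univ.filter fun x => x ∈ S ∧ r x = z) := by
    rw [Finset.disjoint_left]
    intro x hx hx'
    rw [mem_filter] at hx hx'
    rw [hx.2] at hx'
    exact z.2 hx'.2.1
  have h1 : ∑ x with x = (z : V), w x = w z := by
    rw [sum_eq_single_of_mem (z : V) (by simp)]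
    exact fun b hb hbz => absurd (mem_filter.1 hb).2 hbz
  rw [← h1, ← sum_union hd, pushWeight]
  refine sum_congr ?_ fun _ _ => rfl
  ext x
  simp only [mem_filter, mem_union, mem_univ, true_and]
  exact this x

theorem le_pushWeight [Fintype V] (h : IsPendantRetraction G S r) (w : V → ℕ)
    (z : (Sᶜ : Set V)) : w z ≤ pushWeight r w z := by
  rw [h.push_eq]
  exact Nat.le_add_right _ _

theorem pushWeight_one [Fintype V] (h : IsPendantRetraction G S r) (z : (Sᶜ : Set V)) :
    pushWeight r (fun _ => 1) z = 1 + {x | x ∈ S ∧ r x = z}.ncard := by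
  classical
  rw [h.push_eq, Set.ncard_eq_toFinset_card', ← card_eq_sum_ones]
  congr 2
  ext
  simp

theorem pushWeight_of_adj [Fintype V] {v : V} {r : V → (({v} : Set V)ᶜ : Set V)}
    (h : IsPendantRetraction G {v} r) (w : V → ℕ) : pushWeight r w (r v) = w (r v) + w v := by
  classical
  rw [h.push_eq]
  congr 1
  rw [sum_eq_single v]
  · intro b hb hbv
    simp at hb
    exact absurd hb.1 hbv
  · simp

theorem pushWeight_of_ne [Fintype V] {v : V} {r : V → (({v} : Set V)ᶜ : Set V)}
    (h : IsPendantRetraction G {v} r) (w : V → ℕ) (z : (({v} : Set V)ᶜ : Set V)) (hz : z ≠ r v) :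
    pushWeight r w z = w z := by
  classical
  rw [h.push_eq, sum_eq_zero, add_zero]
  intro x hx
  simp at hx
  rw [hx.1] at hx
  exact absurd hx.2.symm hz

open scoped Classical in
-- The edge at a removed leaf contributes the cut that separates the leaf; all other distances are
-- at most those between the neighbours to which the weights have moved.
theorem weightedWiener_le [Fintype V] [Fintype (Sᶜ : Set V)] (h : IsPendantRetraction G S r) (hG : G.Connected)
    (w : V → ℕ) (A : Finset V) (hA : ∀ x, x ∈ A ↔ x ∈ S) :
    weightedWiener G w ≤ 2 * ∑ x ∈ A, cutVal (∑ y, (w y : ℤ)) (w x) +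
      weightedWiener (G.induce Sᶜ) (pushWeight r w) := by
  refine (weightedWiener_le_push G (G.induce Sᶜ) w (fun x => if x ∈ S then 1 else 0) r
    fun x y _ => h.dist_le hG x y).trans (le_of_eq ?_)
  have : ∀ x, (((if x ∈ S then 1 else 0 : ℕ) : ℤ)) * cutVal (∑ y, (w y : ℤ)) (w x) =
      if x ∈ A then cutVal (∑ y, (w y : ℤ)) (w x) else 0 := by
    intro x
    by_cases hx : x ∈ S
    · simp [hx, hA]
    · simp [hx, hA]
  rw [sum_congr rfl fun x _ => this x, sum_ite_mem, univ_inter]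

end IsPendantRetraction

theorem exists_isPendantRetraction {V : Type*} {G : SimpleGraph V} {S : Set V}
    (h : ∀ x ∈ S, ∃ u ∉ S, ∀ y, G.Adj x y ↔ y = u) :
    ∃ r : V → (Sᶜ : Set V), IsPendantRetraction G S r := by
  classical
  choose! n hn hadj using h
  refine ⟨fun x => if hx : x ∈ S then ⟨n x, hn x hx⟩ else ⟨x, hx⟩, fun x hx y => ?_, fun x => ?_⟩
  · rw [dif_pos hx]
    exact hadj x hx y
  · rw [dif_neg x.2]

theorem exists_unique_adj_of_vdeg_eq_one {V : Type*} {G : SimpleGraph V} {v : V}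
    (h : vdeg G v = 1) : ∃ u, ∀ y, G.Adj v y ↔ y = u := by
  obtain ⟨u, hu⟩ := Set.ncard_eq_one.1 h
  exact ⟨u, fun y => Set.ext_iff.1 hu y⟩

theorem exists_isPendantRetraction_singleton {V : Type*} {G : SimpleGraph V} {v : V}
    (h : vdeg G v = 1) : ∃ r, IsPendantRetraction G {v} r := by
  obtain ⟨u, hu⟩ := exists_unique_adj_of_vdeg_eq_one h
  refine exists_isPendantRetraction fun x hx => ⟨u, fun huv => ?_, ?_⟩
  · have := (hu u).2 rfl
    rw [Set.mem_singleton_iff.1 huv] at this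
    exact this.ne rfl
  · rw [Set.mem_singleton_iff.1 hx]
    exact hu

theorem one_le_vdeg {V : Type*} [Finite V] [Nontrivial V] {G : SimpleGraph V} (hG : G.Connected)
    (x : V) : 1 ≤ vdeg G x := by
  obtain ⟨y, hy⟩ := hG.preconnected.exists_adj_of_nontrivial x
  exact (Set.ncard_pos (Set.toFinite _)).2 ⟨y, hy⟩

open scoped Classical in
theorem card_le_sum_of_one_le {V : Type*} [Fintype V] {w : V → ℕ} (hw : ∀ x, 1 ≤ w x) (A : Finset V) :
    ∑ x ∈ A, w x + (Fintype.card V - A.card) ≤ ∑ x, w x := by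
  rw [← sum_add_sum_compl A, ← card_compl]
  gcongr
  simpa using card_nsmul_le_sum Aᶜ w 1 fun x _ => hw x

open scoped Classical in
-- Peel the lighter of two leaves. The other vertices weigh at least one each, so this leaf weighs
-- at most half of what they leave, and its cut is at most the last summand of `cutSum`.
theorem weightedWiener_tree_le (k : ℕ) : ∀ {V : Type u} [Fintype V] (G : SimpleGraph V)
    (w : V → ℕ), Fintype.card V = k + 1 → G.Connected → ∑ x, vdeg G x = 2 * k →
    (∀ x, 1 ≤ w x) → weightedWiener G w ≤ 2 * cutSum k (∑ x, w x) := by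
  induction k with
  | zero =>
    intro V _ G w hc _ _ _
    obtain ⟨a, ha⟩ := Fintype.card_eq_one_iff.1 hc
    have : ∀ x y : V, G.dist x y = 0 := fun x y => by rw [ha x, ha y, SimpleGraph.dist_self]
    simp [weightedWiener, cutSum, this]
  | succ k ih =>
    intro V _ G w hc hG hd hw
    have : Nontrivial V := Fintype.one_lt_card_iff_nontrivial.1 (by omega)
    have hdeg := fun x => one_le_vdeg hG x
    have key : ∃ v, vdeg G v = 1 ∧ w v ≤ (∑ x, w x - k) / 2 := by
      have h1 : ∃ a, vdeg G a = 1 := by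
        by_contra! hne
        have : ∑ x : V, 2 ≤ ∑ x, vdeg G x :=
          sum_le_sum fun x _ => by have := hne x; have := hdeg x; omega
        simp at this
        omega
      obtain ⟨a, ha⟩ := h1
      have h2 : ∃ b, b ≠ a ∧ vdeg G b = 1 := by
        by_contra! hne
        have : ∑ x ∈ univ.erase a, 2 ≤ ∑ x ∈ univ.erase a, vdeg G x :=
          sum_le_sum fun x hx => by
            have := hne x (ne_of_mem_erase hx); have := hdeg x; omega
        have h3 := add_sum_erase univ (vdeg G) (mem_univ a)
        simp [card_erase_of_mem] at this
        omega
      obtain ⟨b, hba, hb⟩ := h2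
      have := card_le_sum_of_one_le hw {a, b}
      rw [sum_pair hba.symm, card_pair hba.symm] at this
      by_cases hab : w a ≤ w b
      · exact ⟨a, ha, by omega⟩
      · exact ⟨b, hb, by omega⟩
    obtain ⟨v, hv, hwv⟩ := key
    obtain ⟨r, hr⟩ := exists_isPendantRetraction_singleton hv
    refine (hr.weightedWiener_le hG w {v} (by simp)).trans ?_
    have hcard : Fintype.card (({v}ᶜ : Set V)) = k + 1 := by
      rw [Fintype.card_compl_set, hc]
      simp
    have hs := hr.sum_vdeg
    rw [Set.ncard_singleton, hd] at hs
    have hsum := sum_pushWeight r w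
    have := ih (G.induce {v}ᶜ) (pushWeight r w) hcard (hr.connected hG) (by omega)
      (fun z => (hw _).trans (hr.le_pushWeight w z))
    rw [hsum] at this
    rw [cutSum_succ]
    have hle : cutVal (∑ y, (w y : ℤ)) (w v) ≤
        cutVal ((∑ x, w x : ℕ) : ℤ) (((∑ x, w x - k) / 2 : ℕ) : ℤ) := by
      push_cast
      refine cutVal_le_cutVal (by exact_mod_cast hwv) ?_
      have h4 := Nat.div_mul_le_self (∑ x, w x - k) 2
      rw [← Nat.cast_sum]
      omega
    rw [sum_singleton]
    linarith

end peel

/-! ### Paths with a chord from the last vertex -/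

/-- `φ` enumerates the vertices of `G` along a path `φ 0, …, φ (k - 1)`, whose last vertex is also
adjacent to `φ t`. -/
structure IsLollipop {V : Type*} (G : SimpleGraph V) (k t : ℕ) (φ : ℕ → V) : Prop where
  inj : ∀ i < k, ∀ j < k, φ i = φ j → i = j
  surj : ∀ v, ∃ i < k, φ i = v
  adj : ∀ i, i + 1 < k → G.Adj (φ i) (φ (i + 1))
  chord : G.Adj (φ (k - 1)) (φ t)
  le : t + 3 ≤ k

theorem card_le_vdeg {V : Type*} [Finite V] {G : SimpleGraph V} {x : V} (A : Finset V)
    (h : ∀ y ∈ A, G.Adj x y) : A.card ≤ vdeg G x := by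
  rw [← Set.ncard_coe_finset]
  exact Set.ncard_le_ncard h (Set.toFinite _)

open scoped Classical in
theorem exists_maximal_path {V : Type*} [Fintype V] (G : SimpleGraph V) (v : V) :
    ∃ (L : ℕ) (φ : ℕ → V), φ 0 = v ∧ (∀ i ≤ L, ∀ j ≤ L, φ i = φ j → i = j) ∧
      (∀ i < L, G.Adj (φ i) (φ (i + 1))) ∧ ∀ y, G.Adj (φ L) y → ∃ i ≤ L, φ i = y := by
  let s : Set ℕ := {n | ∃ (u : V) (p : G.Walk v u), p.IsPath ∧ p.length = n}
  have hne : s.Nonempty := ⟨0, v, .nil, by simp, rfl⟩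
  have hbd : BddAbove s := ⟨Fintype.card V, by rintro n ⟨u, p, hp, rfl⟩; exact hp.length_lt.le⟩
  obtain ⟨u, p, hp, hL⟩ := Nat.sSup_mem hne hbd
  refine ⟨p.length, p.getVert, by simp, fun i hi j hj h => hp.getVert_injOn hi hj h,
    fun i hi => p.adj_getVert_succ hi, fun y hy => ?_⟩
  rw [p.getVert_length] at hy
  by_cases hys : y ∈ p.support
  · obtain ⟨i, hi, hi'⟩ := (SimpleGraph.Walk.mem_support_iff_exists_getVert).1 hys
    exact ⟨i, hi', hi⟩
  · have h1 : (p.concat hy).length ∈ s := ⟨y, _, hp.concat hys hy, rfl⟩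
    have h2 := le_csSup hbd h1
    rw [SimpleGraph.Walk.length_concat, ← hL] at h2
    omega

open scoped Classical in
-- Take a maximal path from `v`. Its end has a second neighbour, which by maximality is on the path;
-- this is the chord. The path and the chord already account for the whole degree sum, so nothing
-- lies outside the path.
theorem exists_isLollipop {V : Type*} [Fintype V] {G : SimpleGraph V} (hG : G.Connected) (v : V)
    (hd : ∑ x, vdeg G x = 2 * Fintype.card V) (hdeg : ∀ x, x ≠ v → 2 ≤ vdeg G x)
    (h3 : 2 ≤ Fintype.card V) :
    ∃ t φ, IsLollipop G (Fintype.card V) t φ ∧ φ 0 = v ∧ (1 ≤ t → 3 ≤ vdeg G (φ t)) ∧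
      (vdeg G v = 1 → 1 ≤ t) ∧ (2 ≤ vdeg G v → t = 0) := by
  have : Nontrivial V := Fintype.one_lt_card_iff_nontrivial.1 (by omega)
  obtain ⟨L, φ, h0, hinj, hadj, hmax⟩ := exists_maximal_path G v
  have hv := one_le_vdeg hG v
  have hL : 1 ≤ L := by
    by_contra hL
    obtain rfl : L = 0 := by omega
    obtain ⟨y, hy⟩ := hG.preconnected.exists_adj_of_nontrivial v
    rw [← h0] at hy
    obtain ⟨i, hi, rfl⟩ := hmax y hy
    obtain rfl : i = 0 := by omega
    exact hy.ne rfl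
  have hLv : φ L ≠ v := fun h => by
    have := hinj L le_rfl 0 (by omega) (h.trans h0.symm)
    omega
  obtain ⟨t, ht, htadj⟩ : ∃ t, t + 2 ≤ L ∧ G.Adj (φ L) (φ t) := by
    obtain ⟨y, hy, hne⟩ := Set.exists_ne_of_one_lt_ncard (hdeg _ hLv) (φ (L - 1))
    obtain ⟨t, ht, rfl⟩ := hmax y hy
    refine ⟨t, ?_, hy⟩
    have h1 : t ≠ L := fun h => by rw [h] at hy; exact hy.ne rfl
    have h2 : t ≠ L - 1 := fun h => hne (by rw [h])
    omega
  have hprev : ∀ i, 1 ≤ i → i ≤ L → G.Adj (φ i) (φ (i - 1)) := fun i hi hi' => by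
    have := hadj (i - 1) (by omega)
    rw [Nat.sub_add_cancel hi] at this
    exact this.symm
  have hcount : ∀ (i : ℕ) (J : Finset ℕ), i ≤ L → (∀ j ∈ J, j ≤ L ∧ G.Adj (φ i) (φ j)) →
      ∀ B : Finset V, (∀ b ∈ B, G.Adj (φ i) b ∧ ∀ j ≤ L, φ j ≠ b) →
      J.card + B.card ≤ vdeg G (φ i) := by
    intro i J hi hJ B hB
    rw [← card_image_of_injOn (f := φ) (s := J)
      (fun a ha b hb hab => hinj a (hJ a ha).1 b (hJ b hb).1 hab), ← card_union_of_disjoint]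
    · refine card_le_vdeg _ fun y hy => ?_
      rcases mem_union.1 hy with h | h
      · obtain ⟨j, hj, rfl⟩ := mem_image.1 h
        exact (hJ j hj).2
      · exact (hB y h).1
    · rw [Finset.disjoint_left]
      intro y hy hyB
      obtain ⟨j, hj, rfl⟩ := mem_image.1 hy
      exact (hB _ hyB).2 j (hJ j hj).1 rfl
  -- Two neighbours on the path for each vertex, one fewer at the start, one more at `φ t` because
  -- of the chord; `B` collects neighbours off the path.
  have hpos : ∀ i ≤ L, ∀ B : Finset V, (∀ b ∈ B, G.Adj (φ i) b ∧ ∀ j ≤ L, φ j ≠ b) →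
      2 + (if i = t then 1 else 0) + B.card ≤ vdeg G (φ i) + (if i = 0 then 1 else 0) := by
    intro i hi B hB
    by_cases hi0 : i = 0
    · subst hi0
      have a1 := hadj 0 (by omega)
      by_cases hit : 0 = t
      · rw [if_pos hit, if_pos rfl]
        rw [← hit] at htadj
        have := hcount 0 {1, L} (by omega) (by
          intro j hj
          rw [mem_insert, mem_singleton] at hj
          rcases hj with rfl | rfl
          · exact ⟨by omega, a1⟩
          · exact ⟨le_rfl, htadj.symm⟩) B hB
        rw [card_pair (by omega)] at this
        omega
      · rw [if_neg hit, if_pos rfl]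
        have := hcount 0 {1} (by omega) (by
          intro j hj
          rw [mem_singleton] at hj
          subst hj
          exact ⟨by omega, a1⟩) B hB
        rw [card_singleton] at this
        omega
    · rw [if_neg hi0]
      have a0 := hprev i (by omega) hi
      by_cases hiL : i = L
      · subst hiL
        rw [if_neg (by omega)]
        have := hcount i {i - 1, t} (by omega) (by
          intro j hj
          rw [mem_insert, mem_singleton] at hj
          rcases hj with rfl | rfl
          · exact ⟨by omega, a0⟩
          · exact ⟨by omega, htadj⟩) B hB
        rw [card_pair (by omega)] at this
        omega
      · have a1 := hadj i (by omega)
        by_cases hit : i = t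
        · subst hit
          rw [if_pos rfl]
          have := hcount i {i - 1, i + 1, L} (by omega) (by
            intro j hj
            rw [mem_insert, mem_insert, mem_singleton] at hj
            rcases hj with rfl | rfl | rfl
            · exact ⟨by omega, a0⟩
            · exact ⟨by omega, a1⟩
            · exact ⟨by omega, htadj.symm⟩) B hB
          rw [card_insert_of_notMem (by simp; omega), card_pair (by omega)] at this
          omega
        · rw [if_neg hit]
          have := hcount i {i - 1, i + 1} (by omega) (by
            intro j hj
            rw [mem_insert, mem_singleton] at hj
            rcases hj with rfl | rfl
            · exact ⟨by omega, a0⟩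
            · exact ⟨by omega, a1⟩) B hB
          rw [card_pair (by omega)] at this
          omega
  have hφ0 : ∀ i ≤ L, φ i = v ↔ i = 0 := fun i hi =>
    ⟨fun h => hinj i hi 0 (by omega) (h.trans h0.symm), fun h => by rw [h, h0]⟩
  have hsurj : ∀ x, ∃ i ≤ L, φ i = x := by
    by_contra! hx
    obtain ⟨x, hx⟩ := hx
    obtain ⟨p⟩ := hG v x
    -- An edge leaving the path adds one to the degree of its endpoint on the path. With the chord
    -- counted at `φ t` and a deficit of at most one at `v`, the degree sum would exceed twice the
    -- number of vertices.
    obtain ⟨d, -, ⟨i, hi, hd1⟩, hd2⟩ := p.exists_boundary_dart {y | ∃ i ≤ L, φ i = y}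
      ⟨0, by omega, h0⟩ (by rintro ⟨i, hi, h⟩; exact hx i hi h)
    have hd2' : ∀ j ≤ L, φ j ≠ d.snd := fun j hj h => hd2 ⟨j, hj, h⟩
    have hb : ∀ y, 2 + (if y = φ t then 1 else 0) + (if y = d.fst then 1 else 0) ≤
        vdeg G y + (if y = v then 1 else 0) := by
      intro y
      by_cases hy : ∃ j ≤ L, φ j = y
      · obtain ⟨j, hj, rfl⟩ := hy
        have := hpos j hj (if φ j = d.fst then {d.snd} else ∅) (by
          intro b hb
          split_ifs at hb with h
          · rw [mem_singleton] at hb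
            subst hb
            exact ⟨h ▸ d.adj, hd2'⟩
          · simp at hb)
        have e1 : (φ j = φ t) ↔ j = t := ⟨hinj j hj t (by omega), fun h => by rw [h]⟩
        simp only [e1, hφ0 j hj]
        refine le_trans (le_of_eq ?_) this
        split_ifs <;> simp
      · push Not at hy
        rw [if_neg fun h => hy t (by omega) h.symm, if_neg fun h => hy i hi (hd1.trans h.symm)]
        have := hdeg y fun h => hy 0 (by omega) (h0.trans h.symm)
        omega
    have := sum_le_sum fun y (_ : y ∈ univ) => hb y
    simp [sum_add_distrib] at this
    omega
  have hcard : Fintype.card V = L + 1 := by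
    have : univ = (range (L + 1)).image φ := by
      ext y
      obtain ⟨i, hi, rfl⟩ := hsurj y
      simp only [mem_univ, mem_image, mem_range, true_iff]
      exact ⟨i, by omega, rfl⟩
    rw [← card_univ, this, card_image_of_injOn, card_range]
    intro a ha b hb hab
    rw [coe_range, Set.mem_Iio] at ha hb
    exact hinj a (by omega) b (by omega) hab
  have hpos' := fun i hi => hpos i hi ∅ (by simp)
  refine ⟨t, φ, ⟨fun i hi j hj => hinj i (by omega) j (by omega), fun x => ?_,
    fun i hi => hadj i (by omega), ?_, by omega⟩, h0, fun ht1 => ?_, fun hv1 => ?_, fun hv2 => ?_⟩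
  · obtain ⟨i, hi, h⟩ := hsurj x
    exact ⟨i, by omega, h⟩
  · rw [hcard]
    exact htadj
  · have := hpos' t (by omega)
    rw [if_pos rfl, if_neg (by omega)] at this
    exact this
  · by_contra ht0
    obtain rfl : t = 0 := by omega
    have := hpos' 0 (by omega)
    rw [if_pos rfl, h0] at this
    simp at this
    omega
  · by_contra ht0
    -- If `t ≠ 0` while `v` is not a leaf, all degrees are at least two and that of `φ t` is at
    -- least three, again too much.
    have hb : ∀ y, 2 + (if y = φ t then 1 else 0) ≤ vdeg G y := by
      intro y
      obtain ⟨j, hj, rfl⟩ := hsurj y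
      by_cases hj0 : j = 0
      · subst hj0
        rw [if_neg fun h => ht0 (hinj 0 (by omega) t (by omega) h).symm, h0]
        exact hv2
      · have := hpos' j hj
        rw [if_neg hj0] at this
        have e1 : (φ j = φ t) ↔ j = t := ⟨hinj j hj t (by omega), fun h => by rw [h]⟩
        simp only [e1]
        simpa using this
    have := sum_le_sum fun y (_ : y ∈ univ) => hb y
    simp [sum_add_distrib] at this
    omega

/-! ### The weighted bound for sparse graphs -/

section sparse

universe u

namespace IsLollipop

variable {V : Type*} {G : SimpleGraph V} {k t : ℕ} {φ : ℕ → V}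

theorem dist_le (h : IsLollipop G k t φ) (hG : G.Connected) {i j : ℕ} (hij : i ≤ j) (hj : j < k) :
    G.dist (φ i) (φ j) ≤ j - i := by
  induction j, hij using Nat.le_induction with
  | base => simp
  | succ j hij ih =>
    have h1 := ih (by omega)
    have h2 := hG.dist_triangle (u := φ i) (v := φ j) (w := φ (j + 1))
    rw [SimpleGraph.dist_eq_one_iff_adj.2 (h.adj j hj)] at h2
    omega

theorem dist_last_le (h : IsLollipop G k t φ) (hG : G.Connected) {i : ℕ} (hi : i ≤ t) :
    G.dist (φ i) (φ (k - 1)) ≤ t - i + 1 := by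
  have := h.le
  have h1 := h.dist_le hG hi (by omega)
  have h2 := hG.dist_triangle (u := φ i) (v := φ t) (w := φ (k - 1))
  rw [SimpleGraph.dist_eq_one_iff_adj.2 h.chord.symm] at h2
  omega

theorem dist_penultimate_le (h : IsLollipop G k t φ) (hG : G.Connected) {i : ℕ} (hi : i ≤ t) :
    G.dist (φ i) (φ (k - 2)) ≤ t - i + 2 := by
  have := h.le
  have h1 := h.dist_last_le hG hi
  have h2 := hG.dist_triangle (u := φ i) (v := φ (k - 1)) (w := φ (k - 2))
  have h3 := h.dist_le hG (i := k - 2) (j := k - 1) (by omega) (by omega)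
  rw [SimpleGraph.dist_comm] at h3
  omega

theorem dist_succ_last_le (h : IsLollipop G k t φ) (hG : G.Connected) :
    G.dist (φ (t + 1)) (φ (k - 1)) ≤ 2 := by
  have := h.le
  have h1 := h.dist_last_le hG le_rfl
  have h2 := hG.dist_triangle (u := φ (t + 1)) (v := φ t) (w := φ (k - 1))
  have h3 := h.dist_le hG (i := t) (j := t + 1) (by omega) (by omega)
  rw [SimpleGraph.dist_comm] at h3
  omega

theorem sum_eq [Fintype V] (h : IsLollipop G k t φ) {M : Type*} [AddCommMonoid M] (f : V → M) :
    ∑ x, f x = ∑ i ∈ range k, f (φ i) := by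
  symm
  refine sum_nbij φ (fun _ _ => mem_univ _) (fun i hi j hj hij => ?_) (fun x _ => ?_) fun _ _ => rfl
  · rw [coe_range, Set.mem_Iio] at hi hj
    exact h.inj i hi j hj hij
  · obtain ⟨i, hi, rfl⟩ := h.surj x
    exact ⟨i, by simpa using hi, rfl⟩

theorem reachable_deleteEdges (h : IsLollipop G k t φ) (E : Set (Sym2 V)) {i j : ℕ} (hij : i ≤ j)
    (hj : j < k) (hE : ∀ l, i ≤ l → l < j → s(φ l, φ (l + 1)) ∉ E) :
    (G.deleteEdges E).Reachable (φ i) (φ j) := by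
  induction j, hij using Nat.le_induction with
  | base => exact .refl _
  | succ j hij ih =>
    refine (ih (by omega) fun l hl hl' => hE l hl (by omega)).trans
      (SimpleGraph.Adj.reachable ?_)
    rw [SimpleGraph.deleteEdges_adj]
    exact ⟨h.adj j hj, hE j hij (by omega)⟩

theorem sym2_ne (h : IsLollipop G k t φ) {a b c d : ℕ} (ha : a < k) (hb : b < k) (hc : c < k)
    (hd : d < k) (h1 : a ≠ c ∨ b ≠ d) (h2 : a ≠ d ∨ b ≠ c) : s(φ a, φ b) ≠ s(φ c, φ d) := by
  rw [Ne, Sym2.eq_iff]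
  rintro (⟨e1, e2⟩ | ⟨e1, e2⟩)
  · have := h.inj a ha c hc e1
    have := h.inj b hb d hd e2
    omega
  · have := h.inj a ha d hd e1
    have := h.inj b hb c hc e2
    omega

/-- The rest of the path and the chord lead around the cycle. Sparsity is applied only at the two
cycle edges meeting in `φ t`, this one and the chord. -/
theorem not_isBridge_succ (h : IsLollipop G k t φ) : ¬ G.IsBridge s(φ t, φ (t + 1)) := by
  have := h.le
  rw [SimpleGraph.isBridge_iff, not_not]
  have h1 : (G.deleteEdges {s(φ t, φ (t + 1))}).Reachable (φ (t + 1)) (φ (k - 1)) :=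
    h.reachable_deleteEdges _ (by omega) (by omega) fun l hl hl' =>
      h.sym2_ne (by omega) (by omega) (by omega) (by omega) (by omega) (by omega)
  refine SimpleGraph.Reachable.trans (SimpleGraph.Adj.reachable ?_) h1.symm
  rw [SimpleGraph.deleteEdges_adj]
  exact ⟨h.chord.symm,
    h.sym2_ne (by omega) (by omega) (by omega) (by omega) (by omega) (by omega)⟩

theorem not_isBridge_last (h : IsLollipop G k t φ) : ¬ G.IsBridge s(φ t, φ (k - 1)) := by
  have := h.le
  rw [SimpleGraph.isBridge_iff, not_not]
  exact h.reachable_deleteEdges _ (by omega) (by omega) fun l hl hl' =>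
      h.sym2_ne (by omega) (by omega) (by omega) (by omega) (by omega) (by omega)

theorem weightedWiener_eq [Fintype V] (h : IsLollipop G k t φ) (w : V → ℕ) :
    weightedWiener G w =
      2 * ∑ j ∈ range k, ∑ i ∈ range j, (w (φ i) : ℤ) * w (φ j) * G.dist (φ i) (φ j) := by
  have key : ∀ (F : ℕ → ℕ → ℤ), (∀ i, F i i = 0) → (∀ i j, F i j = F j i) → ∀ n,
      ∑ i ∈ range n, ∑ j ∈ range n, F i j = 2 * ∑ j ∈ range n, ∑ i ∈ range j, F i j := by
    intro F h0 hs n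
    induction n with
    | zero => simp
    | succ n ih =>
      rw [sum_range_succ, sum_range_succ _ n, sum_range_succ _ n, h0]
      simp only [sum_range_succ _ n, sum_add_distrib]
      rw [ih, sum_congr rfl fun j _ => hs n j]
      ring
  rw [← key, weightedWiener, h.sum_eq]
  · exact sum_congr rfl fun i _ => h.sum_eq _
  · simp
  · intro i j
    rw [SimpleGraph.dist_comm]
    ring

/-- Attaching a new leaf at the start of the path. -/
theorem cons {V : Type*} {G : SimpleGraph V} {v : V} {r : V → (({v} : Set V)ᶜ : Set V)}
    {φ : ℕ → (({v} : Set V)ᶜ : Set V)}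
    (h : IsLollipop (G.induce {v}ᶜ) k t φ) (hr : IsPendantRetraction G {v} r) (h0 : r v = φ 0) :
    IsLollipop G (k + 1) (t + 1) (fun i => Nat.casesOn i v fun j => (φ j : V)) := by
  have hk := h.le
  obtain ⟨k, rfl⟩ : ∃ k', k = k' + 1 := ⟨k - 1, by omega⟩
  have hne : ∀ j, (φ j : V) ≠ v := fun j => (φ j).2
  refine ⟨?_, fun x => ?_, ?_, ?_, by omega⟩
  · rintro (_ | i) hi (_ | j) hj hij
    · rfl
    · exact absurd hij.symm (hne j)
    · exact absurd hij (hne i)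
    · rw [h.inj i (by omega) j (by omega) (Subtype.ext hij)]
  · by_cases hx : x = v
    · exact ⟨0, by omega, hx.symm⟩
    · obtain ⟨i, hi, hi'⟩ := h.surj ⟨x, hx⟩
      exact ⟨i + 1, by omega, congrArg Subtype.val hi'⟩
  · rintro (_ | i) hi
    · exact (hr.adj_iff v rfl _).2 (congrArg Subtype.val h0).symm
    · exact h.adj i (by omega)
  · exact h.chord

end IsLollipop

/-- In a cycle of `G` every edge has an endpoint that has degree 2 and weight 1. -/
def IsSparse {V : Type*} (G : SimpleGraph V) (w : V → ℕ) : Prop :=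
  ∀ x y, G.Adj x y → ¬ G.IsBridge s(x, y) →
    (vdeg G x = 2 ∧ w x = 1) ∨ (vdeg G y = 2 ∧ w y = 1)

theorem two_le_vdeg_of_not_isBridge {V : Type*} [Finite V] {G : SimpleGraph V} {x y : V}
    (h : G.Adj x y) (hb : ¬ G.IsBridge s(x, y)) : 2 ≤ vdeg G x := by
  rw [SimpleGraph.isBridge_iff, not_not] at hb
  obtain ⟨p⟩ := hb
  cases p with
  | nil => exact absurd h (G.loopless.irrefl _)
  | @cons _ z _ hz q =>
    rw [SimpleGraph.deleteEdges_adj] at hz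
    have hne : y ≠ z := fun e => hz.2 (by rw [e]; rfl)
    classical
    rw [← card_pair hne]
    refine card_le_vdeg _ fun a ha => ?_
    rw [mem_insert, mem_singleton] at ha
    rcases ha with rfl | rfl
    · exact h
    · exact hz.1

theorem isBridge_induce {V : Type*} {G : SimpleGraph V} {S : Set V} {x y : S}
    (h : G.IsBridge s((x : V), (y : V))) : (G.induce S).IsBridge s(x, y) := by
  rw [SimpleGraph.isBridge_iff] at h ⊢
  intro hr
  let f : (G.induce S).deleteEdges {s(x, y)} →g G.deleteEdges {s((x : V), (y : V))} :=
    { toFun := Subtype.val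
      map_rel' := by
        intro a b hab
        rw [SimpleGraph.deleteEdges_adj] at hab ⊢
        refine ⟨hab.1, fun h => hab.2 ?_⟩
        rw [Set.mem_singleton_iff, Sym2.eq_iff] at h ⊢
        simpa only [Subtype.ext_iff] using h }
  exact h (hr.map f)

/-- A vertex of degree two on a cycle has no pendant neighbour, so it receives no weight and keeps
its degree. Edges that are not bridges after the removal were not bridges before. -/
theorem IsPendantRetraction.isSparse {V : Type*} [Fintype V] {G : SimpleGraph V} {S : Set V}
    {r : V → (Sᶜ : Set V)} (h : IsPendantRetraction G S r) {w : V → ℕ} (hs : IsSparse G w) :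
    IsSparse (G.induce Sᶜ) (pushWeight r w) := by
  classical
  have key : ∀ z z' : (Sᶜ : Set V), (G.induce Sᶜ).Adj z z' → ¬ (G.induce Sᶜ).IsBridge s(z, z') →
      vdeg G z = 2 ∧ w z = 1 → vdeg (G.induce Sᶜ) z = 2 ∧ pushWeight r w z = 1 := by
    rintro z z' hzz hb ⟨h2, h1⟩
    have h3 := two_le_vdeg_of_not_isBridge hzz hb
    have h4 := h.vdeg_eq z
    have h5 : {x | x ∈ S ∧ r x = z}.ncard = 0 := by omega
    refine ⟨by omega, ?_⟩
    rw [h.push_eq, h1, sum_eq_zero, add_zero]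
    intro x hx
    rw [Set.ncard_eq_zero] at h5
    exact absurd (show x ∈ {x | x ∈ S ∧ r x = z} by simpa using hx) (by rw [h5]; simp)
  intro z z' hzz hb
  rcases hs z z' hzz (fun h' => hb (isBridge_induce h')) with h' | h'
  · exact .inl (key z z' hzz hb h')
  · exact .inr (key z' z hzz.symm (by rwa [Sym2.eq_swap]) h')

/-- `G` with the weights `w` is the extremal weighted graph with `k` vertices and total weight
`k + e`. -/
def IsExtremal {V : Type*} (G : SimpleGraph V) (w : V → ℕ) (k e : ℕ) : Prop :=
  ∃ φ, (e ≤ 2 ∧ IsLollipop G k (k - 3) φ ∧ w (φ 0) = e + 1 ∧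
      ∀ i, 0 < i → i < k → w (φ i) = 1) ∨
    ((3 ≤ e ∨ (k = 4 ∧ (e = 0 ∨ e = 2))) ∧ IsLollipop G k (k - 4) φ ∧ w (φ 0) = (e + 1) / 2 + 1 ∧
      w (φ (k - 2)) = e / 2 + 1 ∧ ∀ i < k, i ≠ 0 → i ≠ k - 2 → w (φ i) = 1)

/-- Peeling keeps the total weight, so `cutSum` loses just its last summand, the cut of size `(e +
3) / 2`. For even `e ≥ 4` the correction terms balance and equality needs `x = e / 2 + 1`. For odd
`e ≥ 3` this size exceeds the allowed `x` by at least one, which costs `K + 1`, more than the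
corrections return. -/
theorem peel_numeric {K e x : ℕ} (hK : 2 ≤ K) (hx : 1 ≤ x) (hxe : x ≤ (e + 2) / 2) :
    cutVal ((K + 3 + e : ℕ) : ℤ) x + sparseMax (K + 2) (e + 1) ≤ sparseMax (K + 3) e ∧
      (cutVal ((K + 3 + e : ℕ) : ℤ) x + sparseMax (K + 2) (e + 1) = sparseMax (K + 3) e →
        (e = 0 ∧ x = 1) ∨ (4 ≤ e ∧ Even e ∧ x = e / 2 + 1)) := by
  have hN : K + 2 + (e + 1) = K + 3 + e := by omega
  unfold sparseMax
  rw [hN, Nat.add_sub_cancel, show K + 3 - 2 = K + 1 by omega, cutSum_succ,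
    show (K + 3 + e - K) / 2 = (e + 3) / 2 by omega]
  generalize cutSum K (K + 3 + e) = T
  by_cases he : e ≤ 2
  · interval_cases e
    · obtain rfl : x = 1 := by omega
      simp
      linarith
    · obtain rfl : x = 1 := by omega
      simp only [cutVal]
      constructor <;> grind
    · have hx2 : x ≤ 2 := hxe
      interval_cases x <;> simp [cutVal] <;> (try constructor) <;> (try grind)
  · rw [if_neg he, if_neg (by omega)]
    rcases Nat.even_or_odd' e with ⟨c, rfl | rfl⟩
    · rw [if_neg (by simp), if_pos (by simp), show (2 * c + 3) / 2 = c + 1 by omega,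
        show 2 * c / 2 + 1 = c + 1 by omega]
      have hle := cutVal_le_cutVal (N := ((K + 3 + 2 * c : ℕ) : ℤ)) (p := x) (r := ((c + 1 : ℕ) : ℤ))
        (by omega) (by omega)
      push_cast at *
      refine ⟨by linarith, fun h => .inr ⟨by omega, by simp, ?_⟩⟩
      by_contra hne
      have hlt := cutVal_lt_cutVal (N := ((K + 3 + 2 * c : ℕ) : ℤ)) (p := x)
        (r := ((c + 1 : ℕ) : ℤ)) (by omega) (by omega)
      push_cast at hlt
      linarith
    · rw [if_pos (by simp [parity_simps]), if_neg (by simp), show (2 * c + 1 + 3) / 2 = c + 2 by omega]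
      have hle := cutVal_le_cutVal (N := ((K + 3 + (2 * c + 1) : ℕ) : ℤ)) (p := x)
        (r := ((c + 1 : ℕ) : ℤ)) (by omega) (by omega)
      have hd : cutVal ((K + 3 + (2 * c + 1) : ℕ) : ℤ) ((c + 2 : ℕ) : ℤ) =
          cutVal ((K + 3 + (2 * c + 1) : ℕ) : ℤ) ((c + 1 : ℕ) : ℤ) + K + 1 := by
        unfold cutVal
        push_cast
        ring
      push_cast at *
      have : (2 : ℤ) ≤ K := by exact_mod_cast hK
      exact ⟨by linarith, fun h => by linarith⟩

open scoped Classical in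
/-- The case of a graph with at most one leaf, which has to be heavy. -/
theorem weightedWiener_le_of_lollipop {K e : ℕ} (hK : 2 ≤ K) {V : Type*} [Fintype V]
    {G : SimpleGraph V} {w : V → ℕ} (hc : Fintype.card V = K + 2) (hG : G.Connected)
    (hd : ∑ x, vdeg G x = 2 * (K + 2)) (hw : ∀ x, 1 ≤ w x) (hN : ∑ x, w x = K + 2 + e)
    (hs : IsSparse G w) (v : V) (hdeg : ∀ x, x ≠ v → 2 ≤ vdeg G x)
    (hv : (vdeg G v = 1 ∧ (e + 3 ≤ 2 * w v ∨ K = 2)) ∨ (2 ≤ vdeg G v ∧ ∀ x, w x ≤ w v)) :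
    weightedWiener G w ≤ 2 * sparseMax (K + 2) e ∧
      (weightedWiener G w = 2 * sparseMax (K + 2) e → IsExtremal G w (K + 2) e) := by
  obtain ⟨t, φ, hl, h0, ht3, ht1, ht0⟩ := exists_isLollipop hG v (by rw [hd, hc]) hdeg (by omega)
  rw [hc] at hl
  have hle := hl.le
  have hpos : ∀ i < K + 2, 1 ≤ w (φ i) := fun i _ => hw _
  have hNφ : ∑ i ∈ range (K + 2), w (φ i) = K + 2 + e := by rw [← hl.sum_eq, hN]
  -- If `t ≥ 1` then `φ t` has degree at least three, so its neighbours on the cycle must be the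
  -- light endpoints. If `t = 0` then `φ t = v` has maximal weight, so it can be light only if they
  -- are too.
  have hlight : w (φ (t + 1)) = 1 ∧ w (φ (K + 1)) = 1 := by
    have a1 := hs _ _ (hl.adj t (by omega)) hl.not_isBridge_succ
    have a2 := hs _ _ hl.chord.symm hl.not_isBridge_last
    rw [show K + 2 - 1 = K + 1 by omega] at a2
    by_cases ht : 1 ≤ t
    · have := ht3 ht
      omega
    · obtain rfl : t = 0 := by omega
      rcases hv with hv | hv
      · have := ht1 hv.1
        omega
      · have b0 := hw v
        have b1 := hv.2 (φ (0 + 1))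
        have b2 := hv.2 (φ (K + 1))
        have c1 := hw (φ (0 + 1))
        have c2 := hw (φ (K + 1))
        rw [h0] at a1 a2
        omega
  have hnum := sum_lollipop_distances_le (fun i => w (φ i)) (fun i j => G.dist (φ i) (φ j)) K t
    (K + 2 - t) (by omega) (by omega) (fun i j hij hj => hl.dist_le hG hij.le hj)
    (fun i hi => hl.dist_last_le hG hi) (fun i hi => hl.dist_penultimate_le hG hi)
    (hl.dist_succ_last_le hG) hlight.2
  rw [hl.weightedWiener_eq]
  simp only [← Nat.cast_sum] at hnum
  set Z := ∑ j ∈ range (K + 2), ∑ i ∈ range j, (w (φ i) : ℤ) * w (φ j) * G.dist (φ i) (φ j)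
  suffices h : Z ≤ sparseMax (K + 2) e ∧ (Z = sparseMax (K + 2) e → IsExtremal G w (K + 2) e) by
    refine ⟨by linarith [h.1], fun h' => h.2 (by linarith)⟩
  -- The cycle has `K + 2 - t` vertices: three, four, or at least five.
  obtain hg | hg | hg : t + 3 = K + 2 ∨ t + 4 = K + 2 ∨ t + 5 ≤ K + 2 := by omega
  · obtain rfl : K = t + 1 := by omega
    have hv1 : vdeg G v = 1 := by
      by_contra hne
      have := ht0 (by rcases hv with hv | hv <;> omega)
      omega
    have hPK : ∑ i ∈ range (t + 1), w (φ i) = t + 1 + e := by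
      rw [sum_range_succ, sum_range_succ, hlight.1, hlight.2] at hNφ
      omega
    obtain ⟨hle, heq⟩ := triangle_numeric (w := fun i => w (φ i)) hK hpos hNφ hlight.2 hlight.1
      (by rw [h0]; rcases hv with hv | hv <;> omega) rfl
    rw [hNφ] at hle heq hnum
    rw [show t + 1 + 2 - t = 3 by omega, hPK] at hnum
    have hZ : Z ≤ ∑ s ∈ Icc 1 (t + 1), cutVal ((t + 1 + 2 + e : ℕ) : ℤ)
        ((∑ i ∈ range s, w (φ i) : ℕ) : ℤ) + 1 := by
      refine hnum.trans (le_of_eq ?_)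
      generalize ∑ s ∈ Icc 1 (t + 1), cutVal ((t + 1 + 2 + e : ℕ) : ℤ)
        ((∑ i ∈ range s, w (φ i) : ℕ) : ℤ) = Y
      push_cast
      ring
    refine ⟨hZ.trans hle, fun h => ⟨φ, .inl ?_⟩⟩
    obtain ⟨e1, e2, e3⟩ := heq (le_antisymm hle (h ▸ hZ))
    exact ⟨e1, by rwa [show t + 1 + 2 - 3 = t by omega], e2, e3⟩
  · obtain rfl : K = t + 2 := by omega
    obtain ⟨hle, heq⟩ := square_numeric (w := fun i => w (φ i)) hpos hNφ hlight.2 hlight.1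
      (by
        by_cases ht : 1 ≤ t
        · left
          refine ⟨ht, ?_⟩
          rcases hv with hv | hv
          · rw [h0]
            omega
          · have := ht0 hv.1
            omega
        · right
          have htz : t = 0 := by omega
          refine ⟨htz, ?_⟩
          rcases hv with hv | hv
          · have := ht1 hv.1
            omega
          · rw [h0]
            exact hv.2 _) rfl
    have hP1 : ∑ i ∈ range (t + 1), w (φ i) = t + 2 + e - w (φ (t + 2)) ∧ w (φ (t + 2)) ≤ t + 2 + e := by
      rw [sum_range_succ, sum_range_succ, sum_range_succ, hlight.1, hlight.2] at hNφ
      omega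
    have hP2 : ∑ i ∈ range (t + 2), w (φ i) = t + 3 + e - w (φ (t + 2)) := by
      rw [sum_range_succ, hP1.1, hlight.1]
      omega
    rw [hNφ] at hle heq hnum
    rw [show t + 2 + 2 - t = 4 by omega, sum_Icc_succ_top (by omega),
      sum_Icc_succ_top (by omega), hP1.1, hP2] at hnum
    have hZ : Z ≤ ∑ s ∈ Icc 1 t, cutVal ((t + 2 + 2 + e : ℕ) : ℤ)
        ((∑ i ∈ range s, w (φ i) : ℕ) : ℤ) +
        2 * cutVal ((t + 2 + 2 + e : ℕ) : ℤ) ((w (φ (t + 2)) + 1 : ℕ) : ℤ) := by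
      refine hnum.trans (le_of_eq ?_)
      generalize ∑ s ∈ Icc 1 t, cutVal ((t + 2 + 2 + e : ℕ) : ℤ)
        ((∑ i ∈ range s, w (φ i) : ℕ) : ℤ) = Y
      unfold cutVal
      rw [Nat.cast_sub (by omega), Nat.cast_sub (by omega)]
      push_cast
      ring
    obtain ⟨s1, s2⟩ := squareMax_le_sparseMax (K := t + 2) (e := e) hK
    refine ⟨hZ.trans (hle.trans s1), fun h => ⟨φ, .inr ?_⟩⟩
    obtain ⟨e1, e2, e3⟩ := heq (le_antisymm hle (s1.trans (h ▸ hZ)))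
    refine ⟨?_, by rwa [show t + 2 + 2 - 4 = t by omega], e1, e2, e3⟩
    have := s2 (le_antisymm s1 ((h ▸ hZ).trans hle))
    omega
  · have hlt := long_cycle_numeric (w := fun i => w (φ i)) (K := K) (t := t) (e := e) (g := K + 2 - t)
      (by omega) (by omega) hpos hNφ hlight.2 hlight.1
      (by
        by_cases ht : 1 ≤ t
        · left
          refine ⟨ht, ?_⟩
          rcases hv with hv | hv
          · rw [h0]
            omega
          · have := ht0 hv.1
            omega
        · right
          refine ⟨by omega, fun i _ => ?_⟩
          rcases hv with hv | hv
          · have := ht1 hv.1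
            omega
          · rw [h0]
            exact hv.2 _) rfl
    have := (hnum.trans_lt hlt).trans_le (squareMax_le_sparseMax hK).1
    exact ⟨this.le, fun h => absurd h this.ne⟩

open scoped Classical in
/-- The Wiener index of weighted sparse unicyclic graphs. -/
theorem weightedWiener_sparse_le {K : ℕ} (hK : 2 ≤ K) : ∀ {V : Type u} [Fintype V]
    (G : SimpleGraph V) (w : V → ℕ) (e : ℕ), Fintype.card V = K + 2 → G.Connected →
    ∑ x, vdeg G x = 2 * (K + 2) → (∀ x, 1 ≤ w x) → ∑ x, w x = K + 2 + e → IsSparse G w →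
    weightedWiener G w ≤ 2 * sparseMax (K + 2) e ∧
      (weightedWiener G w = 2 * sparseMax (K + 2) e → IsExtremal G w (K + 2) e) := by
  induction K, hK using Nat.le_induction with
  | base =>
    intro V _ G w e hc hG hd hw hN hs
    have : Nontrivial V := Fintype.one_lt_card_iff_nontrivial.1 (by omega)
    have hdeg := fun x => one_le_vdeg hG x
    by_cases hleaf : ∃ v, vdeg G v = 1
    · obtain ⟨v, hv⟩ := hleaf
      refine weightedWiener_le_of_lollipop le_rfl hc hG hd hw hN hs v (fun x hxv => ?_)
        (.inl ⟨hv, .inr rfl⟩)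
      -- With two leaves on four vertices, removing one leaves three vertices of degree sum six, one
      -- of them of degree at most one.
      by_contra hx
      have hx1 : vdeg G x = 1 := by have := hdeg x; omega
      obtain ⟨r, hr⟩ := exists_isPendantRetraction_singleton hv
      have hsd := hr.sum_vdeg
      rw [Set.ncard_singleton, hd] at hsd
      have hcard : Fintype.card (({v}ᶜ : Set V)) = 3 := by
        rw [Fintype.card_compl_set, hc]
        simp
      have hle : ∀ z, vdeg (G.induce {v}ᶜ) z ≤ if z = ⟨x, hxv⟩ then 1 else 2 := by
        intro z
        split_ifs with hz
        · have := hr.vdeg_eq z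
          rw [hz] at this ⊢
          change vdeg G x = _ at this
          omega
        · have h1 : (G.induce {v}ᶜ).neighborSet z ⊆ {z}ᶜ := fun y hy => by
            rintro rfl
            exact (G.induce {v}ᶜ).loopless.irrefl _ hy
          have h2 := Set.ncard_le_ncard h1
          rw [Set.ncard_compl, Set.ncard_singleton, Nat.card_eq_fintype_card, hcard] at h2
          exact h2
      have hlt := sum_le_sum fun z (_ : z ∈ univ) => hle z
      rw [sum_ite, filter_eq' univ, if_pos (mem_univ _), filter_ne', sum_const, sum_const,
        card_singleton, card_erase_of_mem (mem_univ _), card_univ, hcard] at hlt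
      norm_num at hlt
      omega
    · push Not at hleaf
      obtain ⟨v, -, hv⟩ := exists_max_image univ w univ_nonempty
      exact weightedWiener_le_of_lollipop le_rfl hc hG hd hw hN hs v
        (fun x _ => by have := hdeg x; have := hleaf x; omega)
        (.inr ⟨by have := hdeg v; have := hleaf v; omega, fun x => hv x (mem_univ _)⟩)
  | succ K hK ih =>
    intro V _ G w e hc hG hd hw hN hs
    have : Nontrivial V := Fintype.one_lt_card_iff_nontrivial.1 (by omega)
    have hdeg := fun x => one_le_vdeg hG x
    -- Leaves above this threshold cannot occur twice: two of them would weigh at least `e + 3`,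
    -- leaving less than one for each other vertex.
    by_cases hA : ∃ v, vdeg G v = 1 ∧ w v ≤ (e + 2) / 2
    · obtain ⟨v, hv, hwv⟩ := hA
      obtain ⟨r, hr⟩ := exists_isPendantRetraction_singleton hv
      have hbound := hr.weightedWiener_le hG w {v} (by simp)
      have hcard : Fintype.card (({v}ᶜ : Set V)) = K + 2 := by
        rw [Fintype.card_compl_set, hc]
        simp
      have hsd := hr.sum_vdeg
      rw [Set.ncard_singleton, hd] at hsd
      have hsum := sum_pushWeight r w
      rw [hN] at hsum
      obtain ⟨i1, i2⟩ := ih (G.induce {v}ᶜ) (pushWeight r w) (e + 1) hcard (hr.connected hG)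
        (by omega) (fun z => (hw z).trans (hr.le_pushWeight w z)) (by omega) (hr.isSparse hs)
      obtain ⟨p1, p2⟩ := peel_numeric (K := K) hK (hw v) hwv
      rw [sum_singleton, ← Nat.cast_sum, hN, show K + 1 + 2 + e = K + 3 + e by omega] at hbound
      rw [show K + 1 + 2 = K + 3 by omega]
      refine ⟨by linarith, fun heq => ?_⟩
      obtain ⟨φ, hφ⟩ := i2 (by linarith)
      have hcase := p2 (by linarith)
      have hwv2 : (e = 0 ∧ w v = 1) ∨ (e % 2 = 0 ∧ w v = e / 2 + 1) :=
        hcase.imp id fun h => ⟨Nat.even_iff.1 h.2.1, h.2.2⟩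
      have hru := hr.pushWeight_of_adj w
      have hwr := hw (r v)
      have hwv1 := hw v
      -- The neighbour of `v` has weight at least two after the push. In the 4-cycle case the vertex
      -- opposite the tail is excluded: its weight `e / 2 + 1` is that of `v` alone.
      have h0 : r v = φ 0 := by
        rcases hφ with ⟨-, hl, -, h1⟩ | ⟨-, hl, -, h2, h1⟩
        · obtain ⟨i, hi, hi'⟩ := hl.surj (r v)
          rcases Nat.eq_zero_or_pos i with rfl | hi0
          · exact hi'.symm
          · have := h1 i hi0 hi
            rw [hi'] at this
            omega
        · obtain ⟨i, hi, hi'⟩ := hl.surj (r v)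
          by_cases hi0 : i = 0
          · subst hi0
            exact hi'.symm
          · by_cases hi2 : i = K + 2 - 2
            · rw [hi2] at hi'
              rw [hi'] at h2
              omega
            · have := h1 i hi hi0 hi2
              rw [hi'] at this
              omega
      have hne : ∀ i, 0 < i → i < K + 2 → (∃ t, IsLollipop (G.induce {v}ᶜ) (K + 2) t φ) →
          w (φ i) = pushWeight r w (φ i) := by
        rintro i hi hik ⟨t, hl⟩
        refine (hr.pushWeight_of_ne w _ fun h => ?_).symm
        have := hl.inj i hik 0 (by omega) (h.trans h0)
        omega
      refine ⟨fun i => Nat.casesOn i v fun j => (φ j : V), ?_⟩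
      rcases hφ with ⟨he, hl, hw0, h1⟩ | ⟨he, hl, hw0, h2, h1⟩
      · left
        have he0 : e = 0 ∧ w v = 1 := by
          rcases hcase with h | ⟨h, _⟩
          · exact h
          · omega
        refine ⟨by omega, ?_, ?_, ?_⟩
        · have := hl.cons hr h0
          rwa [show K + 2 - 3 + 1 = K + 3 - 3 by have := hl.le; omega] at this
        · change w v = e + 1
          omega
        · rintro (_ | i) hi hik
          · omega
          · change w (φ i) = 1
            rcases Nat.eq_zero_or_pos i with rfl | hi0
            · rw [← h0] at hw0 ⊢
              omega
            · rw [hne i hi0 (by omega) ⟨_, hl⟩]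
              exact h1 i hi0 (by omega)
      · right
        have hK4 : K + 2 - 4 + 1 = K + 3 - 4 := by have := hl.le; omega
        have hev : 4 ≤ e ∧ Even e ∧ w v = e / 2 + 1 := by
          rcases hcase with ⟨h, _⟩ | h
          · omega
          · exact h
        obtain ⟨he4, ⟨c, rfl⟩, hwc⟩ := hev
        refine ⟨.inl (by omega), ?_, ?_, ?_, ?_⟩
        · have := hl.cons hr h0
          rwa [hK4] at this
        · change w v = _
          omega
        · change w (φ K) = _
          rw [hne K (by omega) (by omega) ⟨_, hl⟩]
          rw [Nat.add_sub_cancel] at h2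
          omega
        · rintro (_ | i) hik hi0 hi2
          · omega
          · change w (φ i) = 1
            rcases Nat.eq_zero_or_pos i with rfl | hi0
            · rw [← h0] at hw0 ⊢
              omega
            · rw [hne i hi0 (by omega) ⟨_, hl⟩]
              exact h1 i (by omega) (by omega) (by omega)
    · push Not at hA
      have hlight : ∀ x y, x ≠ y → vdeg G x = 1 → vdeg G y = 1 → False := by
        intro x y hxy hx hy
        have := hA x hx
        have := hA y hy
        have := card_le_sum_of_one_le hw {x, y}
        rw [sum_pair hxy, card_pair hxy] at this
        omega
      by_cases hleaf : ∃ v, vdeg G v = 1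
      · obtain ⟨v, hv⟩ := hleaf
        refine weightedWiener_le_of_lollipop (by omega) hc hG hd hw hN hs v (fun x hxv => ?_)
          (.inl ⟨hv, .inl (by have := hA v hv; omega)⟩)
        by_contra hx
        exact hlight x v hxv (by have := hdeg x; omega) hv
      · push Not at hleaf
        obtain ⟨v, -, hv⟩ := exists_max_image univ w univ_nonempty
        exact weightedWiener_le_of_lollipop (by omega) hc hG hd hw hN hs v
          (fun x _ => by have := hdeg x; have := hleaf x; omega)
          (.inr ⟨by have := hdeg v; have := hleaf v; omega, fun x => hv x (mem_univ _)⟩)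

end sparse

/-! ### Matchings from rooted trees -/

section rooted

universe u

/-- A family of vertex-disjoint edges `x – f x`, `x ∈ A`, is at most as large as the matching
number. -/
theorem card_le_matchingNumber {V : Type*} [Finite V] {G : SimpleGraph V} (A : Finset V) (f : V → V)
    (hadj : ∀ x ∈ A, G.Adj x (f x)) (hinj : ∀ x ∈ A, ∀ y ∈ A, f x = f y → x = y)
    (hdisj : ∀ x ∈ A, f x ∉ A) : A.card ≤ matchingNumber G := by
  let M : G.Subgraph :=
    { verts := {x | x ∈ A ∨ ∃ y ∈ A, f y = x}
      Adj := fun x y => (x ∈ A ∧ f x = y) ∨ (y ∈ A ∧ f y = x)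
      adj_sub := by
        rintro x y (⟨hx, rfl⟩ | ⟨hy, rfl⟩)
        · exact hadj x hx
        · exact (hadj y hy).symm
      edge_vert := by
        rintro x y (⟨hx, rfl⟩ | ⟨hy, rfl⟩)
        · exact .inl hx
        · exact .inr ⟨y, hy, rfl⟩
      symm := ⟨fun _ _ h => h.symm⟩ }
  have hM : M.IsMatching := by
    rintro x (hx | ⟨y, hy, rfl⟩)
    · refine ⟨f x, .inl ⟨hx, rfl⟩, ?_⟩
      rintro z (⟨_, rfl⟩ | ⟨hz, rfl⟩)
      · rfl
      · exact absurd hx (hdisj z hz)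
    · refine ⟨y, .inr ⟨hy, rfl⟩, ?_⟩
      rintro z (⟨hz, rfl⟩ | ⟨hz, hz'⟩)
      · exact absurd hz (hdisj y hy)
      · exact hinj z hz y hy hz'
  have hcard : A.card ≤ M.edgeSet.ncard := by
    rw [← Set.ncard_coe_finset]
    refine Set.ncard_le_ncard_of_injOn (fun x => s(x, f x)) (fun x hx => .inl ⟨hx, rfl⟩) ?_
      (Set.toFinite _)
    intro x hx y hy hxy
    rcases Sym2.eq_iff.1 hxy with ⟨h, -⟩ | ⟨h, h'⟩
    · exact h
    · exact absurd (show f y ∈ A by rw [← h]; exact hx) (hdisj y hy)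
  refine hcard.trans (le_csSup ⟨Nat.card (Sym2 V), ?_⟩ ⟨M, hM, rfl⟩)
  rintro k ⟨M, -, rfl⟩
  exact Set.ncard_le_card _

/-- `G` consists of a graph on the set `C` of roots and rooted trees attached to it, with height
function `h`, parent function `π` and root function `ρ`. -/
structure IsRooted {V : Type*} (G : SimpleGraph V) (C : Set V) (h : V → ℕ) (π ρ : V → V) :
    Prop where
  adj_parent : ∀ x, x ∉ C → G.Adj x (π x)
  height_parent : ∀ x, x ∉ C → h x = h (π x) + 1
  root_parent : ∀ x, x ∉ C → ρ x = ρ (π x)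
  height_eq : ∀ x, x ∈ C → h x = 0
  root_eq : ∀ x, x ∈ C → ρ x = x
  root_mem : ∀ x, ρ x ∈ C
  adj_cases : ∀ x y, G.Adj x y → (x ∈ C ∧ y ∈ C) ∨ (x ∉ C ∧ y = π x) ∨ (y ∉ C ∧ x = π y)

namespace IsRooted

variable {V : Type*} {G : SimpleGraph V} {C : Set V} {h : V → ℕ} {π ρ : V → V}

theorem extend {v : V} {r : V → (({v} : Set V)ᶜ : Set V)} (hr : IsPendantRetraction G {v} r)
    {C : Set (({v} : Set V)ᶜ : Set V)} {h : (({v} : Set V)ᶜ : Set V) → ℕ}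
    {π ρ : (({v} : Set V)ᶜ : Set V) → (({v} : Set V)ᶜ : Set V)}
    (H : IsRooted (G.induce {v}ᶜ) C h π ρ) : ∃ h π ρ, IsRooted G (Subtype.val '' C) h π ρ := by
  classical
  have hval : ∀ x, x ≠ v → (r x : V) = x := fun x hx => congrArg Subtype.val (hr.fix ⟨x, hx⟩)
  have hmem : ∀ x, x ∈ Subtype.val '' C ↔ x ≠ v ∧ r x ∈ C := by
    intro x
    constructor
    · rintro ⟨z, hz, rfl⟩
      exact ⟨z.2, by rwa [hr.fix]⟩
    · rintro ⟨hx, hx'⟩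
      exact ⟨r x, hx', hval x hx⟩
  refine ⟨fun x => if x = v then h (r v) + 1 else h (r x),
    fun x => if x = v then r v else π (r x), fun x => ρ (r x), ?_, ?_, ?_, ?_, ?_, ?_, ?_⟩
  · intro x hx
    by_cases hxv : x = v
    · subst hxv
      rw [if_pos rfl]
      exact (hr.adj_iff x rfl _).2 rfl
    · rw [if_neg hxv]
      have h1 : r x ∉ C := fun h' => hx ((hmem x).2 ⟨hxv, h'⟩)
      have h2 : G.Adj (r x) (π (r x)) := H.adj_parent _ h1
      rwa [hval x hxv] at h2
  · intro x hx
    have h1 : ∀ z : (({v} : Set V)ᶜ : Set V), (z : V) ≠ v := fun z => z.2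
    by_cases hxv : x = v
    · subst hxv
      simp only [if_true, if_neg (h1 _), hr.fix]
    · simp only [if_neg hxv, if_neg (h1 _), hr.fix]
      exact H.height_parent _ fun h' => hx ((hmem x).2 ⟨hxv, h'⟩)
  · intro x hx
    by_cases hxv : x = v
    · subst hxv
      simp only [if_true, hr.fix]
    · simp only [if_neg hxv, hr.fix]
      rw [H.root_parent _ fun h' => hx ((hmem x).2 ⟨hxv, h'⟩)]
  · intro x hx
    obtain ⟨h1, h2⟩ := (hmem x).1 hx
    rw [if_neg h1]
    exact H.height_eq _ h2
  · intro x hx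
    obtain ⟨h1, h2⟩ := (hmem x).1 hx
    rw [H.root_eq _ h2, hval x h1]
  · exact fun x => ⟨_, H.root_mem _, rfl⟩
  · intro x y hxy
    by_cases hxv : x = v
    · subst hxv
      right; left
      refine ⟨fun h' => ((hmem x).1 h').1 rfl, ?_⟩
      rw [if_pos rfl]
      exact (hr.adj_iff x rfl y).1 hxy
    · by_cases hyv : y = v
      · subst hyv
        right; right
        refine ⟨fun h' => ((hmem y).1 h').1 rfl, ?_⟩
        rw [if_pos rfl]
        exact (hr.adj_iff y rfl x).1 hxy.symm
      · have h1 : (G.induce {v}ᶜ).Adj (r x) (r y) := by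
          change G.Adj (r x) (r y)
          rwa [hval x hxv, hval y hyv]
        rw [hmem, hmem, if_neg hxv, if_neg hyv]
        rcases H.adj_cases _ _ h1 with h2 | ⟨h2, h3⟩ | ⟨h2, h3⟩
        · exact .inl ⟨⟨hxv, h2.1⟩, hyv, h2.2⟩
        · exact .inr (.inl ⟨fun h' => h2 h'.2, by rw [← h3, hval y hyv]⟩)
        · exact .inr (.inr ⟨fun h' => h2 h'.2, by rw [← h3, hval x hxv]⟩)

theorem exists_child [Finite V] (H : IsRooted G C h π ρ) {x : V} (hx : x ∉ C) (hd : 2 ≤ vdeg G x) :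
    ∃ y, y ∉ C ∧ π y = x := by
  obtain ⟨y, hy, hne⟩ : ∃ y ∈ G.neighborSet x, y ≠ π x := by
    by_contra! hcon
    have := Set.ncard_le_ncard (show G.neighborSet x ⊆ {π x} from hcon)
    rw [Set.ncard_singleton] at this
    unfold vdeg at hd
    omega
  rcases H.adj_cases x y hy with h1 | h1 | h1
  · exact absurd h1.1 hx
  · exact absurd h1.2 hne
  · exact ⟨y, h1.1, h1.2.symm⟩

/-- Edges to chosen children form a matching if they start at heights of the same parity. -/
theorem card_le_matchingNumber_of_parity [Finite V] {G' : SimpleGraph V} (hle : G ≤ G')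
    (H : IsRooted G C h π ρ) (A : Finset V) (c : V → V) (hc : ∀ x ∈ A, c x ∉ C ∧ π (c x) = x)
    (hA : ∀ x ∈ A, ∀ y ∈ A, h x % 2 = h y % 2) : A.card ≤ matchingNumber G' := by
  refine card_le_matchingNumber A c (fun x hx => hle ?_) (fun x hx y hy hxy => ?_) fun x hx hcx => ?_
  · have := H.adj_parent _ (hc x hx).1
    rw [(hc x hx).2] at this
    exact this.symm
  · rw [← (hc x hx).2, ← (hc y hy).2, hxy]
  · have h1 := H.height_parent _ (hc x hx).1
    rw [(hc x hx).2] at h1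
    have := hA x hx _ hcx
    omega

end IsRooted

open scoped Classical in
theorem exists_leaf_ne {V : Type*} [Fintype V] [Nontrivial V] {G : SimpleGraph V}
    (hG : G.Connected) (hd : ∑ x, vdeg G x + 2 = 2 * Fintype.card V) (r : V) :
    ∃ v, v ≠ r ∧ vdeg G v = 1 := by
  by_contra! hcon
  have h1 := one_le_vdeg hG
  have h2 : ∑ x ∈ univ.erase r, 2 ≤ ∑ x ∈ univ.erase r, vdeg G x := by
    refine sum_le_sum fun x hx => ?_
    have := h1 x
    have := hcon x (ne_of_mem_erase hx)
    omega
  rw [sum_const, card_erase_of_mem (mem_univ _), card_univ, smul_eq_mul] at h2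
  have h3 := add_sum_erase univ (fun x => vdeg G x) (mem_univ r)
  have := h1 r
  have := Fintype.card_pos_iff.2 ⟨r⟩
  omega

open scoped Classical in
-- Remove a leaf other than the root, use induction, and reattach the leaf with `IsRooted.extend`.
theorem exists_isRooted_tree (n : ℕ) : ∀ {V : Type u} [Fintype V] (G : SimpleGraph V) (v : V),
    Fintype.card V = n → G.Connected → ∑ x, vdeg G x + 2 = 2 * Fintype.card V →
    ∃ h π ρ, IsRooted G {v} h π ρ := by
  induction n with
  | zero =>
    intro V _ G v hn _ _
    have := Fintype.card_pos_iff.2 ⟨v⟩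
    omega
  | succ n ih =>
    intro V _ G v hn hG hd
    rcases subsingleton_or_nontrivial V with hV | hV
    · refine ⟨0, id, id, ?_, ?_, ?_, fun _ _ => rfl, fun _ _ => rfl, fun x => hV.elim _ _,
        fun x y hxy => absurd (hV.elim x y) hxy.ne⟩
      all_goals exact fun x hx => absurd (hV.elim x v) hx
    · obtain ⟨l, hlv, hl⟩ := exists_leaf_ne hG hd v
      obtain ⟨r, hr⟩ := exists_isPendantRetraction_singleton hl
      have hcard : Fintype.card (({l}ᶜ : Set V)) = n := by
        rw [Fintype.card_compl_set, hn]
        simp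
      have hsd := hr.sum_vdeg
      rw [Set.ncard_singleton] at hsd
      obtain ⟨h, π, ρ, H⟩ := ih (G.induce {l}ᶜ) ⟨v, fun e => hlv e.symm⟩ hcard (hr.connected hG)
        (by omega)
      have := H.extend hr
      rwa [Set.image_singleton] at this

open scoped Classical in
/-- A spanning tree of `G` has many leaves. -/
theorem card_le_leaves_add_matchingNumber {V : Type u} [Fintype V] [Nontrivial V]
    {G T : SimpleGraph V} (hle : T ≤ G) (hT : T.Connected)
    (hd : ∑ x, vdeg T x + 2 = 2 * Fintype.card V) :
    Fintype.card V + 1 ≤ #{x | vdeg T x = 1} + 2 * matchingNumber G := by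
  obtain ⟨r, -, hr⟩ := exists_leaf_ne hT hd (Classical.arbitrary V)
  obtain ⟨h, π, ρ, H⟩ := exists_isRooted_tree _ T r rfl hT hd
  have hdeg := one_le_vdeg hT
  -- The root is a leaf of `T` that nevertheless has a child, so `A` has one element more than there
  -- are non-leaves. This is the `+ 1` of the conclusion.
  let A : Finset V := {x | x = r ∨ vdeg T x ≠ 1}
  have hchild : ∀ x ∈ A, ∃ y, y ∉ ({r} : Set V) ∧ π y = x := by
    intro x hx
    by_cases hxr : x = r
    · obtain ⟨y, hy⟩ := hT.preconnected.exists_adj_of_nontrivial r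
      rcases H.adj_cases r y hy with h1 | h1 | h1
      · exact absurd h1.2.symm hy.ne
      · exact absurd rfl h1.1
      · exact ⟨y, h1.1, h1.2.symm.trans hxr.symm⟩
    · refine H.exists_child hxr ?_
      have := hdeg x
      have := ((mem_filter.1 hx).2.resolve_left hxr)
      omega
  choose! c hc using hchild
  have h0 := H.card_le_matchingNumber_of_parity hle {x ∈ A | Even (h x)} c
    (fun x hx => hc x (mem_filter.1 hx).1) fun x hx y hy => by
      rw [Nat.even_iff.1 (mem_filter.1 hx).2, Nat.even_iff.1 (mem_filter.1 hy).2]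
  have h1 := H.card_le_matchingNumber_of_parity hle {x ∈ A | ¬ Even (h x)} c
    (fun x hx => hc x (mem_filter.1 hx).1) fun x hx y hy => by
      rw [Nat.not_even_iff.1 (mem_filter.1 hx).2, Nat.not_even_iff.1 (mem_filter.1 hy).2]
  have h2 := card_filter_add_card_filter_not (s := A) (fun x => Even (h x))
  have h3 : A.card = #{x | ¬ vdeg T x = 1} + 1 := by
    have : A = insert r (univ.filter fun x => ¬ vdeg T x = 1) := by
      ext x
      simp [A]
    rw [this, card_insert_of_notMem (by simpa using hr)]
  have h4 := card_filter_add_card_filter_not (s := (univ : Finset V)) (fun x => vdeg T x = 1)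
  rw [card_univ] at h4
  omega

/-! ### Cycles with trees attached -/

/-- The cyclic successor on `{0, …, g - 1}`. -/
def cyclicSucc (g i : ℕ) : ℕ := if i + 1 < g then i + 1 else 0

/-- The sequence `φ 0, …, φ (g - 1)` is an induced cycle. -/
structure IsCycleSeq {V : Type*} (G : SimpleGraph V) (g : ℕ) (φ : ℕ → V) : Prop where
  three_le : 3 ≤ g
  inj : ∀ i < g, ∀ j < g, φ i = φ j → i = j
  adj : ∀ i < g, G.Adj (φ i) (φ (cyclicSucc g i))
  chordless : ∀ i < g, ∀ j < g, G.Adj (φ i) (φ j) → j = cyclicSucc g i ∨ i = cyclicSucc g j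

theorem cyclicSucc_lt {g i : ℕ} (hg : 3 ≤ g) : cyclicSucc g i < g := by
  unfold cyclicSucc
  split_ifs <;> omega

namespace IsCycleSeq

variable {V : Type*} {G : SimpleGraph V} {g : ℕ} {φ : ℕ → V}

theorem exists_pred (hφ : IsCycleSeq G g φ) {i : ℕ} (hi : i < g) :
    ∃ j < g, cyclicSucc g j = i ∧ ∀ l < g, cyclicSucc g l = i → l = j := by
  have := hφ.three_le
  unfold cyclicSucc
  by_cases h0 : i = 0
  · refine ⟨g - 1, by omega, by rw [if_neg (by omega), h0], fun l hl => ?_⟩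
    split_ifs <;> omega
  · refine ⟨i - 1, by omega, by rw [if_pos (by omega)]; omega, fun l hl => ?_⟩
    split_ifs <;> omega

theorem exists_adj_notMem [Finite V] (hφ : IsCycleSeq G g φ) {i : ℕ} (hi : i < g)
    (hd : 3 ≤ vdeg G (φ i)) : ∃ y, G.Adj (φ i) y ∧ y ∉ φ '' Set.Iio g := by
  obtain ⟨j, hj, hji, hj'⟩ := hφ.exists_pred hi
  by_contra! hcon
  have h1 : G.neighborSet (φ i) ⊆ {φ (cyclicSucc g i), φ j} := by
    intro y hy
    obtain ⟨l, hl, rfl⟩ := hcon y hy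
    rcases hφ.chordless i hi l hl hy with h | h
    · exact .inl (by rw [h])
    · exact .inr (by rw [Set.mem_singleton_iff, hj' l hl h.symm])
  have := (Set.ncard_le_ncard h1).trans (Set.ncard_insert_le _ _)
  rw [Set.ncard_singleton] at this
  unfold vdeg at hd
  omega

theorem mem_of_adj [Finite V] (hφ : IsCycleSeq G g φ) {i : ℕ} (hi : i < g)
    (hd : vdeg G (φ i) ≤ 2) {y : V} (hy : G.Adj (φ i) y) : y ∈ φ '' Set.Iio g := by
  classical
  by_contra hcon
  obtain ⟨j, hj, hji, -⟩ := hφ.exists_pred hi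
  have h3 := hφ.three_le
  have hs : cyclicSucc g i < g := cyclicSucc_lt h3
  have hne : cyclicSucc g i ≠ j := by
    intro h
    unfold cyclicSucc at h hji
    split_ifs at h hji <;> omega
  have h1 : ({y, φ (cyclicSucc g i), φ j} : Finset V).card = 3 := by
    refine card_eq_three.2 ⟨_, _, _, ?_, ?_, ?_, rfl⟩
    · rintro rfl
      exact hcon ⟨_, hs, rfl⟩
    · rintro rfl
      exact hcon ⟨_, hj, rfl⟩
    · exact fun h => hne (hφ.inj _ hs _ hj h)
  have h2 := card_le_vdeg (G := G) (x := φ i) {y, φ (cyclicSucc g i), φ j} (by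
    intro z hz
    simp only [mem_insert, mem_singleton] at hz
    rcases hz with rfl | rfl | rfl
    · exact hy
    · exact hφ.adj i hi
    · have := hφ.adj j hj
      rw [hji] at this
      exact this.symm)
  omega

theorem not_isBridge (hφ : IsCycleSeq G g φ) {i : ℕ} (hi : i < g) :
    ¬ G.IsBridge s(φ i, φ (cyclicSucc g i)) := by
  have h3 := hφ.three_le
  rw [SimpleGraph.isBridge_iff, not_not]
  set H := G.deleteEdges {s(φ i, φ (cyclicSucc g i))}
  have hadj : ∀ j < g, j ≠ i → H.Adj (φ j) (φ (cyclicSucc g j)) := by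
    intro j hj hji
    rw [SimpleGraph.deleteEdges_adj]
    refine ⟨hφ.adj j hj, fun h => ?_⟩
    rw [Set.mem_singleton_iff, Sym2.eq_iff] at h
    rcases h with ⟨h, -⟩ | ⟨h, h'⟩
    · exact hji (hφ.inj _ hj _ hi h)
    · have e1 := hφ.inj _ hj _ (cyclicSucc_lt h3) h
      have e2 := hφ.inj _ (cyclicSucc_lt h3) _ hi h'
      unfold cyclicSucc at e1 e2
      split_ifs at e1 e2 <;> omega
  have key : ∀ a b, a ≤ b → b < g → (∀ j, a ≤ j → j < b → j ≠ i) → H.Reachable (φ a) (φ b) := by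
    intro a b hab
    induction b, hab using Nat.le_induction with
    | base => exact fun _ _ => .refl _
    | succ b hab ih =>
      intro hb hne
      have h1 := hadj b (by omega) (hne b hab (by omega))
      rw [cyclicSucc, if_pos hb] at h1
      exact (ih (by omega) fun j hj hj' => hne j hj (by omega)).trans h1.reachable
  by_cases hi1 : i + 1 < g
  · rw [cyclicSucc, if_pos hi1]
    have h1 := hadj (g - 1) (by omega) (by omega)
    rw [cyclicSucc, if_neg (by omega)] at h1
    exact (((key (i + 1) (g - 1) (by omega) (by omega) fun j _ _ => by omega).trans
      h1.reachable).trans (key 0 i (by omega) hi fun j _ _ => by omega)).symm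
  · rw [cyclicSucc, if_neg hi1]
    exact (key 0 i (by omega) hi fun j _ _ => by omega).symm

end IsCycleSeq

open scoped Classical in
-- Strip leaves one at a time. When none is left, the degree sum forces all degrees to be two, and
-- the path with a chord has `t = 0`, so it is a cycle; a chord would create degree three.
theorem exists_isRooted_cycle (n : ℕ) : ∀ {V : Type u} [Fintype V] (G : SimpleGraph V),
    Fintype.card V = n → G.Connected → ∑ x, vdeg G x = 2 * Fintype.card V →
    ∃ g φ h π ρ, IsCycleSeq G g φ ∧ IsRooted G (φ '' Set.Iio g) h π ρ := by
  induction n with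
  | zero =>
    intro V _ G hn hG _
    have := hG.nonempty
    have := Fintype.card_pos (α := V)
    omega
  | succ n ih =>
    intro V _ G hn hG hd
    rcases subsingleton_or_nontrivial V with hV | hV
    · have h0 : ∀ x, vdeg G x = 0 := fun x => by
        unfold vdeg
        rw [Set.ncard_eq_zero, Set.eq_empty_iff_forall_notMem]
        exact fun y hy => hy.ne (hV.elim _ _)
      simp [h0, hn] at hd
    by_cases hleaf : ∃ l, vdeg G l = 1
    · obtain ⟨l, hl⟩ := hleaf
      obtain ⟨r, hr⟩ := exists_isPendantRetraction_singleton hl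
      have hcard : Fintype.card (({l}ᶜ : Set V)) = n := by
        rw [Fintype.card_compl_set, hn]
        simp
      have hsd := hr.sum_vdeg
      rw [Set.ncard_singleton] at hsd
      obtain ⟨g, φ, h, π, ρ, hφ, H⟩ := ih (G.induce {l}ᶜ) hcard (hr.connected hG) (by omega)
      obtain ⟨h', π', ρ', H'⟩ := H.extend hr
      refine ⟨g, fun i => φ i, h', π', ρ', ⟨hφ.three_le, fun i hi j hj hij => hφ.inj i hi j hj
        (Subtype.ext hij), fun i hi => hφ.adj i hi, fun i hi j hj hij => hφ.chordless i hi j hj hij⟩,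
        ?_⟩
      rwa [← Set.image_image (fun x : ({l}ᶜ : Set V) => (x : V))]
    · push Not at hleaf
      have h1 := one_le_vdeg hG
      have h2 : ∀ x ∈ univ, 2 ≤ vdeg G x := fun x _ => by
        have := h1 x
        have := hleaf x
        omega
      have h2' : ∀ x, vdeg G x = 2 := by
        intro x
        refine ((sum_eq_sum_iff_of_le h2).1 ?_ x (mem_univ _)).symm
        rw [sum_const, card_univ, hd]
        simp [mul_comm]
      obtain ⟨t, φ, hl, -, -, -, ht⟩ := exists_isLollipop hG (Classical.arbitrary V) hd
        (fun x _ => h2 x (mem_univ _)) Fintype.one_lt_card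
      obtain rfl := ht (h2 _ (mem_univ _))
      have hle := hl.le
      set k := Fintype.card V
      have huniv : φ '' Set.Iio k = Set.univ := by
        rw [Set.eq_univ_iff_forall]
        exact fun x => hl.surj x
      have hadj : ∀ i < k, G.Adj (φ i) (φ (cyclicSucc k i)) := by
        intro i hi
        unfold cyclicSucc
        split_ifs with h
        · exact hl.adj i h
        · obtain rfl : i = k - 1 := by omega
          exact hl.chord
      refine ⟨k, φ, 0, id, id, ⟨by omega, hl.inj, hadj, ?_⟩, ?_⟩
      · intro i hi j hj hij
        by_contra! hcon
        obtain ⟨l, hlk, hli⟩ : ∃ l < k, cyclicSucc k l = i := by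
          unfold cyclicSucc
          by_cases h0 : i = 0
          · exact ⟨k - 1, by omega, by rw [if_neg (by omega), h0]⟩
          · exact ⟨i - 1, by omega, by rw [if_pos (by omega)]; omega⟩
        have hne : cyclicSucc k i ≠ l := by
          intro h
          unfold cyclicSucc at h hli
          split_ifs at h hli <;> omega
        have hs : cyclicSucc k i < k := cyclicSucc_lt (by omega)
        have h1 : ({φ j, φ (cyclicSucc k i), φ l} : Finset V).card = 3 := by
          refine card_eq_three.2 ⟨_, _, _, ?_, ?_, ?_, rfl⟩
          · exact fun h => hcon.1 (hl.inj _ hj _ hs h)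
          · intro h
            obtain rfl := hl.inj _ hj _ hlk h
            exact hcon.2 hli.symm
          · exact fun h => hne (hl.inj _ hs _ hlk h)
        have h2 := card_le_vdeg (G := G) (x := φ i) {φ j, φ (cyclicSucc k i), φ l} (by
          intro z hz
          simp only [mem_insert, mem_singleton] at hz
          rcases hz with rfl | rfl | rfl
          · exact hij
          · exact hadj i hi
          · have := hadj l hlk
            rw [hli] at this
            exact this.symm)
        have := h2' (φ i)
        omega
      · rw [huniv]
        refine ⟨?_, ?_, ?_, fun _ _ => rfl, fun _ _ => rfl, fun x => trivial,
          fun x y _ => .inl ⟨trivial, trivial⟩⟩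
        all_goals exact fun x hx => absurd trivial hx

namespace IsRooted

/-- In a graph with trees attached to a cycle, all edges outside the cycle are bridges. -/
theorem mem_of_not_isBridge {V : Type*} {G : SimpleGraph V} {C : Set V} {h : V → ℕ} {π ρ : V → V}
    (H : IsRooted G C h π ρ) {x y : V} (hxy : G.Adj x y) (hb : ¬ G.IsBridge s(x, y)) : x ∈ C := by
  have key : ∀ x, x ∉ C → G.IsBridge s(x, π x) := by
    intro x hx
    rw [SimpleGraph.isBridge_iff]
    -- `D` is the set of descendants of `x`, given by chains of parents leading to `x`. Without the
    -- edge to `π x` it is closed under adjacency, but its members have height at least `h x`, so it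
    -- omits `π x`.
    let D : V → Prop := fun y => ∃ s : ℕ → V, ∃ n, s 0 = y ∧ s n = x ∧
      ∀ i < n, s i ∉ C ∧ s (i + 1) = π (s i)
    have hstep : ∀ a b, (G.deleteEdges {s(x, π x)}).Adj a b → D a → D b := by
      rintro a b hab ⟨s, n, rfl, hn, hs⟩
      rw [SimpleGraph.deleteEdges_adj] at hab
      have hC : s 0 ∉ C := by
        rcases Nat.eq_zero_or_pos n with rfl | hn0
        · rwa [hn]
        · exact (hs 0 hn0).1
      rcases H.adj_cases _ _ hab.1 with h1 | ⟨-, h1⟩ | ⟨h1, h2⟩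
      · exact absurd h1.1 hC
      · rcases Nat.eq_zero_or_pos n with rfl | hn0
        · exact absurd (by rw [h1, hn]; rfl) hab.2
        · refine ⟨fun i => s (i + 1), n - 1, ?_, ?_, fun i hi => hs (i + 1) (by omega)⟩
          · rw [h1]
            exact (hs 0 hn0).2
          · simp only
            rw [Nat.sub_add_cancel hn0, hn]
      · refine ⟨fun i => Nat.casesOn i b s, n + 1, rfl, hn, ?_⟩
        rintro (_ | i) hi
        · exact ⟨h1, h2⟩
        · exact hs i (by omega)
    have hheight : ∀ a, D a → h x ≤ h a := by
      rintro a ⟨s, n, rfl, rfl, hs⟩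
      have : ∀ i ≤ n, h (s i) ≤ h (s 0) := by
        intro i
        induction i with
        | zero => simp
        | succ i ih =>
          intro hi
          have h1 := ih (by omega)
          have h2 := H.height_parent _ (hs i (by omega)).1
          rw [← (hs i (by omega)).2] at h2
          omega
      exact this n le_rfl
    rintro ⟨p⟩
    have hwalk : ∀ {a b} (q : (G.deleteEdges {s(x, π x)}).Walk a b), D a → D b := by
      intro a b q
      induction q with
      | nil => exact id
      | cons hab _ ih => exact fun ha => ih (hstep _ _ hab ha)
    have h1 := hheight _ (hwalk p ⟨fun _ => x, 0, rfl, rfl, by simp⟩)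
    have := H.height_parent x hx
    omega
  rcases H.adj_cases x y hxy with h1 | ⟨h1, h2⟩ | ⟨h1, h2⟩
  · exact h1.1
  · subst h2
    exact absurd (key x h1) hb
  · subst h2
    rw [Sym2.eq_swap] at hb
    exact absurd (key y h1) hb

open scoped Classical in
/-- If all vertices of the cycle have trees attached, the graph has many leaves. -/
theorem card_add_two_le_leaves_add_matchingNumber {V : Type*} [Fintype V] [Nontrivial V]
    {G : SimpleGraph V} {g : ℕ} {φ : ℕ → V} {h : V → ℕ} {π ρ : V → V} (hG : G.Connected)
    (hφ : IsCycleSeq G g φ) (H : IsRooted G (φ '' Set.Iio g) h π ρ)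
    (hd : ∀ i < g, 3 ≤ vdeg G (φ i)) :
    Fintype.card V + 2 ≤ #{x | vdeg G x = 1} + 2 * matchingNumber G := by
  have hdeg := one_le_vdeg hG
  have h3 := hφ.three_le
  let A : Finset V := {x | vdeg G x ≠ 1}
  have hchild : ∀ x ∈ A, ∃ y, y ∉ φ '' Set.Iio g ∧ π y = x := by
    intro x hx
    by_cases hxC : x ∈ φ '' Set.Iio g
    · obtain ⟨i, hi, rfl⟩ := hxC
      obtain ⟨y, hy, hyC⟩ := hφ.exists_adj_notMem hi (hd i hi)
      rcases H.adj_cases _ y hy with h1 | h1 | h1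
      · exact absurd h1.2 hyC
      · exact absurd ⟨i, hi, rfl⟩ h1.1
      · exact ⟨y, h1.1, h1.2.symm⟩
    · refine H.exists_child hxC ?_
      have := hdeg x
      have := (mem_filter.1 hx).2
      omega
  choose! c hc using hchild
  choose ι hι hιρ using H.root_mem
  have hιφ : ∀ i < g, ι (φ i) = i := fun i hi => by
    refine hφ.inj _ (hι _) _ hi ?_
    rw [hιρ, H.root_eq _ ⟨i, hi, rfl⟩]
  have hιc : ∀ x ∈ A, ι (c x) = ι x := fun x hx => by
    refine hφ.inj _ (hι _) _ (hι _) ?_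
    rw [hιρ, hιρ, H.root_parent _ (hc x hx).1, (hc x hx).2]
  have hhc : ∀ x ∈ A, h (c x) = h x + 1 := fun x hx => by
    rw [H.height_parent _ (hc x hx).1, (hc x hx).2]
  have hh0 : ∀ i < g, h (φ i) = 0 := fun i hi => H.height_eq _ ⟨i, hi, rfl⟩
  have hE := H.card_le_matchingNumber_of_parity le_rfl {x ∈ A | Even (h x)} c
    (fun x hx => hc x (mem_filter.1 hx).1) fun x hx y hy => by
      rw [Nat.even_iff.1 (mem_filter.1 hx).2, Nat.even_iff.1 (mem_filter.1 hy).2]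
  have hcard := card_filter_add_card_filter_not (s := A) (fun x => Even (h x))
  have hAcard := card_filter_add_card_filter_not (s := (univ : Finset V)) (fun x => vdeg G x = 1)
  rw [card_univ] at hAcard
  change _ + #A = _ at hAcard
  have hsE := card_eq_sum_card_fiberwise (s := {x ∈ A | Even (h x)}) (t := range g) (f := ι)
    fun x _ => by simpa using hι x
  have hsO := card_eq_sum_card_fiberwise (s := {x ∈ A | ¬ Even (h x)}) (t := range g) (f := ι)
    fun x _ => by simpa using hι x
  clear_value A
  set E := #{x ∈ A | Even (h x)}
  set O := #{x ∈ A | ¬ Even (h x)}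
  set m := matchingNumber G
  -- Use even starting heights in the tree at `φ i` and odd ones in all other trees. The latter
  -- edges avoid the cycle, so the next two cycle vertices are free and their edge can be added to
  -- the matching.
  have key : ∀ i ∈ range g, #{x ∈ {x ∈ A | Even (h x)} | ι x = i} + O + 1 ≤
      m + #{x ∈ {x ∈ A | ¬ Even (h x)} | ι x = i} := by
    intro i hi
    rw [mem_range] at hi
    have ha := cyclicSucc_lt (i := i) h3
    have hb := cyclicSucc_lt (i := cyclicSucc g i) h3
    have hai : cyclicSucc g i ≠ i := by unfold cyclicSucc; split_ifs <;> omega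
    have hba : cyclicSucc g (cyclicSucc g i) ≠ cyclicSucc g i := by
      unfold cyclicSucc; split_ifs <;> omega
    have hbi : cyclicSucc g (cyclicSucc g i) ≠ i := by unfold cyclicSucc; split_ifs <;> omega
    have hadj := hφ.adj _ ha
    generalize cyclicSucc g (cyclicSucc g i) = b at *
    generalize cyclicSucc g i = a at *
    let F : Finset V := {x ∈ A | (Even (h x) ∧ ι x = i) ∨ (¬ Even (h x) ∧ ι x ≠ i)}
    have hF : ∀ {x}, x ∈ F → x ∈ A ∧ ((Even (h x) ∧ ι x = i) ∨ (¬ Even (h x) ∧ ι x ≠ i)) :=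
      fun hx => mem_filter.1 hx
    have haF : φ a ∉ F := fun h' => by
      rcases (hF h').2 with h1 | h1
      · exact hai (by rw [← h1.2, hιφ a ha])
      · exact h1.1 (by rw [hh0 a ha]; exact Even.zero)
    have hbF : φ b ∉ F := fun h' => by
      rcases (hF h').2 with h1 | h1
      · exact hbi (by rw [← h1.2, hιφ b hb])
      · exact h1.1 (by rw [hh0 b hb]; exact Even.zero)
    have hcne : ∀ x ∈ F, ∀ j < g, c x ≠ φ j := fun x hx j hj h' =>
      (hc x (hF hx).1).1 ⟨j, hj, h'.symm⟩
    have hxne : ∀ x ∈ F, x ≠ φ a := fun x hx h' => haF (by rwa [← h'])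
    have hcF : ∀ x ∈ F, c x ∉ F := by
      intro x hx hcx
      have h1 := (hF hx).2
      have h2 := (hF hcx).2
      rw [hhc x (hF hx).1, hιc x (hF hx).1, Nat.even_add_one] at h2
      tauto
    have hle := card_le_matchingNumber (G := G) (insert (φ a) F)
      (fun x => if x = φ a then φ b else c x) (by
        intro x hx
        rcases mem_insert.1 hx with rfl | hx
        · rw [if_pos rfl]
          exact hadj
        · rw [if_neg (hxne x hx)]
          have := H.adj_parent _ (hc x (hF hx).1).1
          rw [(hc x (hF hx).1).2] at this
          exact this.symm) (by
        intro x hx y hy hxy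
        rcases mem_insert.1 hx with rfl | hx
        · rcases mem_insert.1 hy with rfl | hy
          · rfl
          · rw [if_pos rfl, if_neg (hxne y hy)] at hxy
            exact absurd hxy.symm (hcne y hy b hb)
        · rcases mem_insert.1 hy with rfl | hy
          · rw [if_pos rfl, if_neg (hxne x hx)] at hxy
            exact absurd hxy (hcne x hx b hb)
          · rw [if_neg (hxne x hx), if_neg (hxne y hy)] at hxy
            rw [← (hc x (hF hx).1).2, ← (hc y (hF hy).1).2, hxy]) (by
        intro x hx
        rcases mem_insert.1 hx with rfl | hx
        · rw [if_pos rfl, mem_insert, not_or]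
          exact ⟨fun h' => hba (hφ.inj _ hb _ ha h'), hbF⟩
        · rw [if_neg (hxne x hx), mem_insert, not_or]
          exact ⟨hcne x hx a ha, hcF x hx⟩)
    rw [card_insert_of_notMem haF] at hle
    have hFc : #F = #{x ∈ {x ∈ A | Even (h x)} | ι x = i} +
        #{x ∈ {x ∈ A | ¬ Even (h x)} | ¬ ι x = i} := by
      rw [filter_filter, filter_filter, ← card_union_of_disjoint, ← filter_or]
      exact disjoint_filter.2 fun x _ h1 h2 => h2.1 h1.1
    have := card_filter_add_card_filter_not (s := {x ∈ A | ¬ Even (h x)}) (fun x => ι x = i)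
    change _ = O at this
    omega
  -- Summing over the cycle gives `E + g * O + g ≤ g * m + O`. With `E ≤ m` this is incompatible
  -- with `E + O ≥ 2 * m - 1`.
  have hsum := sum_le_sum key
  rw [sum_add_distrib, sum_add_distrib, sum_add_distrib, ← hsE, ← hsO] at hsum
  simp only [sum_const, card_range, smul_eq_mul, mul_one] at hsum
  by_contra hcon
  have h1 : 2 * m ≤ E + O + 1 := by omega
  obtain ⟨g, rfl⟩ : ∃ g', g = g' + 2 := ⟨g - 2, by omega⟩
  nlinarith

end IsRooted

end rooted

/-! ### The upper bound for unicyclic graphs -/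

section unicyclic

universe u

open scoped Classical in
theorem sum_vdeg_eq_twice_card_edges {V : Type*} [Fintype V] (G : SimpleGraph V) :
    ∑ x, vdeg G x = 2 * Nat.card G.edgeSet := by
  rw [Nat.card_eq_fintype_card, ← SimpleGraph.edgeFinset_card, ← G.sum_degrees_eq_twice_card_edges]
  refine sum_congr rfl fun x _ => ?_
  rw [vdeg, Set.ncard_eq_toFinset_card', ← SimpleGraph.card_neighborFinset_eq_degree]
  rfl

theorem isTree_iff_connected_and_sum_vdeg {V : Type*} [Fintype V] {G : SimpleGraph V} :
    G.IsTree ↔ G.Connected ∧ ∑ x, vdeg G x + 2 = 2 * Fintype.card V := by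
  rw [SimpleGraph.isTree_iff_connected_and_card, sum_vdeg_eq_twice_card_edges,
    ← Nat.card_eq_fintype_card]
  refine and_congr_right fun _ => ?_
  omega

section deleteEdge

variable {V : Type*} {G : SimpleGraph V} {u v : V}

theorem vdeg_deleteEdges_left [Finite V] (h : G.Adj u v) :
    vdeg (G.deleteEdges {s(u, v)}) u + 1 = vdeg G u := by
  unfold vdeg
  rw [← Set.ncard_insert_of_notMem (a := v) (s := (G.deleteEdges {s(u, v)}).neighborSet u)
    (by simp [SimpleGraph.deleteEdges_adj])]
  congr 1
  ext y
  rw [Set.mem_insert_iff, SimpleGraph.mem_neighborSet, SimpleGraph.mem_neighborSet,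
    SimpleGraph.deleteEdges_adj]
  constructor
  · rintro (rfl | h')
    · exact h
    · exact h'.1
  · intro hy
    by_cases hyv : y = v
    · exact .inl hyv
    · refine .inr ⟨hy, fun h' => ?_⟩
      rw [Set.mem_singleton_iff, Sym2.congr_right] at h'
      exact hyv h'

theorem vdeg_deleteEdges_right [Finite V] (h : G.Adj u v) :
    vdeg (G.deleteEdges {s(u, v)}) v + 1 = vdeg G v := by
  rw [Sym2.eq_swap]
  exact vdeg_deleteEdges_left h.symm

theorem vdeg_deleteEdges_of_ne {x : V} (hu : x ≠ u) (hv : x ≠ v) :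
    vdeg (G.deleteEdges {s(u, v)}) x = vdeg G x := by
  unfold vdeg
  congr 1
  ext y
  rw [SimpleGraph.mem_neighborSet, SimpleGraph.mem_neighborSet, SimpleGraph.deleteEdges_adj]
  refine and_iff_left fun h => ?_
  rw [Set.mem_singleton_iff, Sym2.eq_iff] at h
  rcases h with h | h
  · exact hu h.1
  · exact hv h.1

end deleteEdge

open scoped Classical in
theorem sum_vdeg_deleteEdges {V : Type*} [Fintype V] {G : SimpleGraph V} {u v : V}
    (h : G.Adj u v) : ∑ x, vdeg (G.deleteEdges {s(u, v)}) x + 2 = ∑ x, vdeg G x := by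
  have hvu : v ∈ univ.erase u := mem_erase.2 ⟨h.ne', mem_univ _⟩
  rw [← add_sum_erase univ _ (mem_univ u), ← add_sum_erase _ _ hvu,
    ← add_sum_erase univ (fun x => vdeg G x) (mem_univ u), ← add_sum_erase _ _ hvu,
    sum_congr rfl fun x hx => vdeg_deleteEdges_of_ne (ne_of_mem_erase (mem_of_mem_erase hx))
      (ne_of_mem_erase hx)]
  have := vdeg_deleteEdges_left h
  have := vdeg_deleteEdges_right h
  omega

theorem isTree_deleteEdges {V : Type*} [Fintype V] {G : SimpleGraph V} (hG : G.Connected)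
    (hd : ∑ x, vdeg G x = 2 * Fintype.card V) {u v : V} (h : G.Adj u v)
    (hb : ¬ G.IsBridge s(u, v)) : (G.deleteEdges {s(u, v)}).IsTree := by
  rw [isTree_iff_connected_and_sum_vdeg, sum_vdeg_deleteEdges h, hd]
  exact ⟨hG.connected_delete_edge_of_not_isBridge hb, rfl⟩

/-- Two adjacent leaves would be a whole component, so with three vertices the neighbour of a leaf
is never a leaf. -/
theorem exists_isPendantRetraction_leaves {V : Type*} [Fintype V] {G : SimpleGraph V}
    (hG : G.Connected) (hc : 3 ≤ Fintype.card V) (S : Set V) (hS : ∀ x ∈ S, vdeg G x = 1) :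
    ∃ r : V → (Sᶜ : Set V), IsPendantRetraction G S r := by
  classical
  refine exists_isPendantRetraction fun x hx => ?_
  obtain ⟨u, hu⟩ := exists_unique_adj_of_vdeg_eq_one (hS x hx)
  refine ⟨u, fun huS => ?_, hu⟩
  obtain ⟨u', hu'⟩ := exists_unique_adj_of_vdeg_eq_one (hS u huS)
  have hxu : x = u' := (hu' x).1 ((hu u).2 rfl).symm
  have hstep : ∀ {a b} (p : G.Walk a b), (a = x ∨ a = u) → (b = x ∨ b = u) := by
    intro a b p
    induction p with
    | nil => exact id
    | cons hab _ ih =>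
      rintro (rfl | rfl)
      · exact ih (.inr ((hu _).1 hab))
      · exact ih (.inl (((hu' _).1 hab).trans hxu.symm))
  have hle : (univ : Finset V) ⊆ {x, u} := fun y _ => by
    obtain ⟨p⟩ := hG x y
    simpa using hstep p (.inl rfl)
  have := (card_le_card hle).trans card_le_two
  rw [card_univ] at this
  omega

open scoped Classical in
-- Removing `L` leaves of weight one costs the cut `1 * (n - 1)` for each; the weighted tree bound
-- handles the other `q + 1` vertices.
theorem weightedWiener_tree_le_of_leaves {V : Type u} [Fintype V] {T : SimpleGraph V}
    (hT : T.IsTree) {L q : ℕ} (hc : Fintype.card V = L + q + 1) (h3 : 3 ≤ Fintype.card V)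
    (hL : L ≤ #{x | vdeg T x = 1}) :
    weightedWiener T (fun _ => 1) ≤
      2 * (L * ((Fintype.card V : ℤ) - 1) + cutSum q (Fintype.card V)) := by
  obtain ⟨A, hA, hAL⟩ := exists_subset_card_eq hL
  obtain ⟨hconn, hd⟩ := isTree_iff_connected_and_sum_vdeg.1 hT
  obtain ⟨r, hr⟩ := exists_isPendantRetraction_leaves hconn h3 (A : Set V)
    fun x hx => (mem_filter.1 (hA hx)).2
  have h1 := hr.weightedWiener_le hconn (fun _ => 1) A (by simp)
  have h2 := hr.sum_vdeg
  rw [Set.ncard_coe_finset, hAL] at h2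
  have hcard : Fintype.card ((A : Set V)ᶜ : Set V) = q + 1 := by
    rw [Fintype.card_compl_set]
    simp [hAL, hc]
    omega
  have h4 := weightedWiener_tree_le q (T.induce (A : Set V)ᶜ) (pushWeight r fun _ => 1) hcard
    (hr.connected hconn) (by omega) fun z => hr.le_pushWeight (fun _ => 1) z
  rw [sum_pushWeight] at h4
  simp only [Nat.cast_one, sum_const, card_univ, smul_eq_mul, mul_one, nsmul_eq_mul, hAL,
    cutVal, one_mul] at h1 h4
  linarith

/-- Deleting an edge of the cycle with an endpoint of degree at least three increases the Wiener
index by at least two. -/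
theorem weightedWiener_add_four_le {V : Type*} [Fintype V] {G : SimpleGraph V} {u v : V}
    (hG : G.Connected) (h : G.Adj u v) (hT : (G.deleteEdges {s(u, v)}).IsTree)
    (hv : 3 ≤ vdeg G v) :
    weightedWiener G (fun _ => 1) + 4 ≤ weightedWiener (G.deleteEdges {s(u, v)}) (fun _ => 1) := by
  classical
  set T := G.deleteEdges {s(u, v)}
  have hle : T ≤ G := SimpleGraph.deleteEdges_le _
  have hdist : ∀ x y, G.dist x y ≤ T.dist x y := fun x y =>
    SimpleGraph.Reachable.dist_anti hle (hT.connected x y)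
  have huv : G.dist u v = 1 := SimpleGraph.dist_eq_one_iff_adj.2 h
  have hnadj : ¬ T.Adj u v := by simp [T, SimpleGraph.deleteEdges_adj]
  have h2 := hT.connected.one_lt_dist_of_ne_of_not_adj h.ne hnadj
  suffices hS : ∃ S : Finset (V × V), (4 : ℤ) ≤ ∑ p ∈ S, ((T.dist p.1 p.2 : ℤ) - G.dist p.1 p.2) by
    obtain ⟨S, hS⟩ := hS
    have h1 : ∑ p ∈ S, ((T.dist p.1 p.2 : ℤ) - G.dist p.1 p.2) ≤
        ∑ p : V × V, ((T.dist p.1 p.2 : ℤ) - G.dist p.1 p.2) :=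
      sum_le_sum_of_subset_of_nonneg (subset_univ _) fun p _ _ => by
        have := hdist p.1 p.2
        omega
    rw [Fintype.sum_prod_type] at h1
    simp only [sum_sub_distrib] at h1
    simp only [weightedWiener, Nat.cast_one, one_mul]
    simp only [sum_sub_distrib] at hS
    linarith
  -- At distance three or more the pair `u, v` alone gains two.
  by_cases h3 : 3 ≤ T.dist u v
  · refine ⟨{(u, v), (v, u)}, ?_⟩
    rw [sum_pair (fun e => h.ne (Prod.ext_iff.1 e).1)]
    simp only [T.dist_comm (u := v), G.dist_comm (u := v), huv]
    omega
  · have htwo : T.dist u v = 2 := by omega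
    obtain ⟨p, hp⟩ := hT.connected.exists_walk_length_eq_dist u v
    obtain ⟨z, huz, hzv⟩ : ∃ z, T.Adj u z ∧ T.Adj z v := by
      rw [htwo] at hp
      match p, hp with
      | .cons (v := z) h1 (.cons h2 .nil), _ => exact ⟨z, h1, h2⟩
    -- Here the cycle is a triangle `u z v`, and the pair `u, v` gains only one. A third neighbour
    -- `y` of `v` gives the other unit: its distance from `u` grows from at most two to three.
    obtain ⟨y, hy, hyz⟩ : ∃ y, T.Adj v y ∧ y ≠ z := by
      by_contra! hcon
      have h4 := Set.ncard_le_ncard (show T.neighborSet v ⊆ {z} from hcon)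
      rw [Set.ncard_singleton] at h4
      have h5 : vdeg T v + 1 = vdeg G v := vdeg_deleteEdges_right h
      unfold vdeg at h5 hv
      omega
    have hyu : y ≠ u := fun e => hnadj (e ▸ hy.symm)
    have hy3 : T.dist u y = 3 := by
      have h4 := hT.dist_eq_dist_add_one_of_adj u hy
      rcases h4 with h4 | h4
      · have h5 : T.dist u y = 1 := by omega
        rw [SimpleGraph.dist_eq_one_iff_adj] at h5
        have h6 := (hT.existsUnique_path u v).unique
          (y₁ := .cons huz (.cons hzv .nil)) (y₂ := .cons h5 (.cons hy.symm .nil))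
          (by simp [huz.ne, h.ne, hzv.ne]) (by simp [h5.ne, h.ne, hy.ne'])
        have h7 := congrArg SimpleGraph.Walk.support h6
        simp at h7
        exact absurd h7.symm hyz
      · omega
    have hG2 : G.dist u y ≤ 2 := by
      have h4 := hG.dist_triangle (u := u) (v := v) (w := y)
      rw [huv, SimpleGraph.dist_eq_one_iff_adj.2 (hle hy)] at h4
      exact h4
    refine ⟨{(u, v), (v, u), (u, y), (y, u)}, ?_⟩
    have hvy := hy.ne
    have huvne := h.ne
    rw [sum_insert (by simp [huvne, hvy, hyu.symm]), sum_insert (by simp [huvne.symm, hvy]),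
      sum_pair (by simp [hyu.symm])]
    simp only [T.dist_comm (u := v), G.dist_comm (u := v), T.dist_comm (u := y),
      G.dist_comm (u := y), huv]
    omega

open scoped Classical in
-- The average degree is two, so every degree above two must be compensated by a leaf.
theorem card_heavy_le_card_leaves {V : Type*} [Fintype V] [Nontrivial V] {G : SimpleGraph V}
    (hG : G.Connected) (hd : ∑ x, vdeg G x = 2 * Fintype.card V) :
    #{x | 3 ≤ vdeg G x} ≤ #{x | vdeg G x = 1} := by
  have h1 := one_le_vdeg hG
  have h2 : ∑ x : V, (2 + if 3 ≤ vdeg G x then 1 else 0) ≤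
      ∑ x, (vdeg G x + if vdeg G x = 1 then 1 else 0) := by
    refine sum_le_sum fun x _ => ?_
    have := h1 x
    split_ifs <;> omega
  rw [sum_add_distrib, sum_add_distrib, hd, ← card_filter, ← card_filter, sum_const, card_univ,
    smul_eq_mul] at h2
  omega

theorem cutVal_one (N : ℤ) : cutVal N 1 = N - 1 := by
  unfold cutVal
  ring

/-- The `- 2` is the gain from deleting a cycle edge. For `e ≤ 2` the margin is exactly one, so the
full gain is needed, and for `e = 0` so is a third leaf. -/
theorem nonsparse_numeric {p e L q : ℕ} (hL : L = if e = 0 then 3 else e + 2)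
    (hq : 2 * p + 4 + e = L + q + 1) :
    (L : ℤ) * ((2 * p + 4 + e : ℕ) - 1) + cutSum q (2 * p + 4 + e) - 2 <
      e * ((2 * p + 4 + e : ℕ) - 1) + sparseMax (2 * p + 4) e := by
  unfold sparseMax
  rw [show 2 * p + 4 - 2 = 2 * p + 1 + 1 by omega, cutSum_succ]
  rw [show (2 * p + 4 + e - (2 * p + 1)) / 2 = (e + 3) / 2 by omega]
  by_cases h0 : e = 0
  · subst h0
    obtain rfl : L = 3 := by simpa using hL
    obtain rfl : q = 2 * p := by omega
    rw [cutSum_succ, show (2 * p + 4 + 0 - 2 * p) / 2 = 2 by omega]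
    simp [cutVal]
    linarith
  · rw [if_neg h0] at hL
    subst hL
    obtain rfl : q = 2 * p + 1 := by omega
    generalize cutSum (2 * p + 1) (2 * p + 4 + e) = X
    split_ifs with h1 h2
    · rw [show (e + 3) / 2 = 2 by omega]
      simp only [cutVal]
      push_cast
      linarith
    all_goals
      have := cutVal_le_cutVal (N := ((2 * p + 4 + e : ℕ) : ℤ)) (p := ((3 : ℕ) : ℤ))
        (r := (((e + 3) / 2 : ℕ) : ℤ)) (by omega) (by omega)
      generalize cutVal ((2 * p + 4 + e : ℕ) : ℤ) (((e + 3) / 2 : ℕ) : ℤ) = Y at *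
      simp only [cutVal] at this
      push_cast at *
      have : (3 : ℤ) ≤ e := by omega
      linarith

open scoped Classical in
-- If all cycle vertices carry trees, `G` itself has at least `max (e + 2) 3` leaves and any cycle
-- edge may be deleted. Otherwise delete a cycle edge from a vertex of degree two to one of larger
-- degree, which creates an extra leaf.
theorem weightedWiener_lt_of_not_isSparse {V : Type u} [Fintype V] {G : SimpleGraph V} {m e : ℕ}
    (hG : G.Connected) (hd : ∑ x, vdeg G x = 2 * Fintype.card V) (hm : 2 ≤ m)
    (hν : matchingNumber G = m) (hc : Fintype.card V = 2 * m + e)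
    (hs : ¬ IsSparse G fun _ => 1) :
    weightedWiener G (fun _ => 1) < 2 * (e * ((2 * m + e : ℕ) - 1) + sparseMax (2 * m) e) := by
  have : Nontrivial V := Fintype.one_lt_card_iff_nontrivial.1 (by omega)
  obtain ⟨g, φ, h, π, ρ, hφ, H⟩ := exists_isRooted_cycle _ G rfl hG hd
  have h3 := hφ.three_le
  have hheavy := card_heavy_le_card_leaves hG hd
  suffices key : ∃ u v, G.Adj u v ∧ ¬ G.IsBridge s(u, v) ∧ 3 ≤ vdeg G v ∧
      max (e + 2) 3 ≤ #{x | vdeg (G.deleteEdges {s(u, v)}) x = 1} by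
    obtain ⟨u, v, huv, hb, hv, hleaves⟩ := key
    have hT := isTree_deleteEdges hG hd huv hb
    have h4 := weightedWiener_add_four_le hG huv hT hv
    obtain ⟨p, rfl⟩ : ∃ p, m = p + 2 := ⟨m - 2, by omega⟩
    obtain ⟨L, hL⟩ : ∃ L, L = if e = 0 then 3 else e + 2 := ⟨_, rfl⟩
    obtain ⟨q, hq⟩ : ∃ q, 2 * p + 4 + e = L + q + 1 := ⟨2 * p + 4 + e - L - 1, by
      rw [hL]
      split_ifs <;> omega⟩
    have h5 := weightedWiener_tree_le_of_leaves hT (L := L) (q := q) (by omega) (by omega) (by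
      rw [hL]
      split_ifs <;> omega)
    have h6 := nonsparse_numeric hL hq
    rw [hc, show 2 * (p + 2) + e = 2 * p + 4 + e by omega] at h5
    rw [show 2 * (p + 2) = 2 * p + 4 by omega]
    linarith
  obtain ⟨x, y, hxy, hbr, hx3, hy3⟩ : ∃ x y, G.Adj x y ∧ ¬ G.IsBridge s(x, y) ∧ 3 ≤ vdeg G x ∧
      3 ≤ vdeg G y := by
    unfold IsSparse at hs
    push Not at hs
    obtain ⟨x, y, hxy, hbr, h1, h2⟩ := hs
    have a1 := two_le_vdeg_of_not_isBridge hxy hbr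
    have a2 := two_le_vdeg_of_not_isBridge hxy.symm (by rwa [Sym2.eq_swap])
    refine ⟨x, y, hxy, hbr, ?_, ?_⟩
    · by_contra hcon
      exact h1 (by omega) rfl
    · by_contra hcon
      exact h2 (by omega) rfl
  by_cases hall : ∀ i < g, 3 ≤ vdeg G (φ i)
  · have hM := H.card_add_two_le_leaves_add_matchingNumber hG hφ hall
    have h0 := hall 0 (by omega)
    have h1 := hall _ (cyclicSucc_lt (i := 0) h3)
    refine ⟨φ 0, φ (cyclicSucc g 0), hφ.adj 0 (by omega), hφ.not_isBridge (by omega), h1, ?_⟩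
    have h2 : g ≤ #{x | 3 ≤ vdeg G x} := by
      have : ((range g).image φ).card = g := by
        rw [card_image_of_injOn, card_range]
        intro i hi j hj hij
        exact hφ.inj i (by simpa using hi) j (by simpa using hj) hij
      rw [← this]
      refine card_le_card fun z hz => ?_
      obtain ⟨i, hi, rfl⟩ := mem_image.1 hz
      exact mem_filter.2 ⟨mem_univ _, hall i (mem_range.1 hi)⟩
    have h4 : #{x | vdeg G x = 1} ≤
        #{x | vdeg (G.deleteEdges {s(φ 0, φ (cyclicSucc g 0))}) x = 1} := by
      refine card_le_card fun z hz => ?_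
      have hz := (mem_filter.1 hz).2
      refine mem_filter.2 ⟨mem_univ _, ?_⟩
      rw [vdeg_deleteEdges_of_ne, hz]
      · rintro rfl
        omega
      · rintro rfl
        omega
    omega
  -- Deleting an edge between two vertices of degree at least three creates no leaf, so all leaves
  -- of this spanning tree are leaves of `G`.
  · have hP : e + 1 ≤ #{x | vdeg G x = 1} := by
      have hT := isTree_deleteEdges hG hd hxy hbr
      obtain ⟨t1, t2⟩ := isTree_iff_connected_and_sum_vdeg.1 hT
      have hM := card_le_leaves_add_matchingNumber (SimpleGraph.deleteEdges_le _) t1 t2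
      have h4 : #{z | vdeg (G.deleteEdges {s(x, y)}) z = 1} ≤ #{x | vdeg G x = 1} := by
        refine card_le_card fun z hz => ?_
        have hz := (mem_filter.1 hz).2
        refine mem_filter.2 ⟨mem_univ _, ?_⟩
        rwa [vdeg_deleteEdges_of_ne] at hz
        · rintro rfl
          have := vdeg_deleteEdges_left hxy
          omega
        · rintro rfl
          have := vdeg_deleteEdges_right hxy
          omega
      omega
    have hP2 : 2 ≤ #{x | vdeg G x = 1} := by
      refine le_trans ?_ hheavy
      rw [← card_pair hxy.ne]
      refine card_le_card fun z hz => ?_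
      rw [mem_insert, mem_singleton] at hz
      rcases hz with rfl | rfl
      · simpa using hx3
      · simpa using hy3
    obtain ⟨i, hi, rfl⟩ := H.mem_of_not_isBridge hxy hbr
    rw [Set.mem_Iio] at hi
    -- Vertices of degree two and of degree at least three both occur on the cycle, so they occur
    -- next to each other.
    obtain ⟨l, hl, hne⟩ : ∃ l, l + 1 < g ∧ ¬ (3 ≤ vdeg G (φ l) ↔ 3 ≤ vdeg G (φ (l + 1))) := by
      by_contra! hcon
      have : ∀ l < g, (3 ≤ vdeg G (φ l) ↔ 3 ≤ vdeg G (φ 0)) := by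
        intro l
        induction l with
        | zero => exact fun _ => Iff.rfl
        | succ l ih => exact fun hl => ((hcon l hl).symm.trans (ih (by omega)))
      exact hall fun l hl => (this l hl).2 ((this i hi).1 hx3)
    have hadj := hφ.adj l (by omega)
    have hbl := hφ.not_isBridge (i := l) (by omega)
    rw [cyclicSucc, if_pos hl] at hadj hbl
    have hgen : ∀ u v, G.Adj u v → ¬ G.IsBridge s(u, v) → ¬ 3 ≤ vdeg G u → 3 ≤ vdeg G v →
        max (e + 2) 3 ≤ #{x | vdeg (G.deleteEdges {s(u, v)}) x = 1} := by
      intro u v huv hb hu hv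
      have hu2 := two_le_vdeg_of_not_isBridge huv hb
      have h4 : insert u ({x | vdeg G x = 1} : Finset V) ⊆
          ({x | vdeg (G.deleteEdges {s(u, v)}) x = 1} : Finset V) := by
        intro z hz
        refine mem_filter.2 ⟨mem_univ _, ?_⟩
        rcases mem_insert.1 hz with rfl | hz
        · have := vdeg_deleteEdges_left huv
          omega
        · have hz := (mem_filter.1 hz).2
          rw [vdeg_deleteEdges_of_ne, hz]
          · rintro rfl
            omega
          · rintro rfl
            omega
      have h5 := card_le_card h4
      rw [card_insert_of_notMem (by simp; omega)] at h5
      omega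
    by_cases hl3 : 3 ≤ vdeg G (φ l)
    · have hl' : ¬ 3 ≤ vdeg G (φ (l + 1)) := fun h' => hne (iff_of_true hl3 h')
      have hbl' : ¬ G.IsBridge s(φ (l + 1), φ l) := by rwa [Sym2.eq_swap]
      exact ⟨_, _, hadj.symm, hbl', hl3, hgen _ _ hadj.symm hbl' hl' hl3⟩
    · have hl' : 3 ≤ vdeg G (φ (l + 1)) := by
        by_contra h'
        exact hne (iff_of_false hl3 h')
      exact ⟨_, _, hadj, hbl, hl', hgen _ _ hadj hbl hl3 hl'⟩

theorem IsLollipop.three_le_vdeg {V : Type*} [Finite V] {G : SimpleGraph V} {k t : ℕ} {φ : ℕ → V}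
    (hl : IsLollipop G k t φ) (ht : 1 ≤ t) : 3 ≤ vdeg G (φ t) := by
  classical
  have := hl.le
  have h1 : ({φ (t - 1), φ (t + 1), φ (k - 1)} : Finset V).card = 3 := by
    refine card_eq_three.2 ⟨_, _, _, ?_, ?_, ?_, rfl⟩ <;> intro h
    · have := hl.inj _ (by omega) _ (by omega) h
      omega
    · have := hl.inj _ (by omega) _ (by omega) h
      omega
    · have := hl.inj _ (by omega) _ (by omega) h
      omega
  rw [← h1]
  refine card_le_vdeg _ fun z hz => ?_
  simp only [mem_insert, mem_singleton] at hz
  rcases hz with rfl | rfl | rfl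
  · have := hl.adj (t - 1) (by omega)
    rw [Nat.sub_add_cancel ht] at this
    exact this.symm
  · exact hl.adj t (by omega)
  · exact hl.chord.symm

open scoped Classical in
/-- The upper bound for the Wiener index of unicyclic graphs with given matching number, and the
structure of the extremal graphs. -/
theorem weightedWiener_unicyclic_le {V : Type u} [Fintype V] {G : SimpleGraph V} {m e : ℕ}
    (hG : G.Connected) (hd : ∑ x, vdeg G x = 2 * Fintype.card V) (hm : 2 ≤ m)
    (hν : matchingNumber G = m) (hc : Fintype.card V = 2 * m + e) :
    weightedWiener G (fun _ => 1) ≤ 2 * (e * ((2 * m + e : ℕ) - 1) + sparseMax (2 * m) e) ∧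
    (weightedWiener G (fun _ => 1) = 2 * (e * ((2 * m + e : ℕ) - 1) + sparseMax (2 * m) e) →
      ∃ (S : Set V) (r : V → (Sᶜ : Set V)), IsPendantRetraction G S r ∧ S.ncard = e ∧
        IsExtremal (G.induce Sᶜ) (pushWeight r fun _ => 1) (2 * m) e) := by
  have : Nontrivial V := Fintype.one_lt_card_iff_nontrivial.1 (by omega)
  by_cases hs : IsSparse G fun _ => 1
  swap
  · have := weightedWiener_lt_of_not_isSparse hG hd hm hν hc hs
    exact ⟨this.le, fun h => absurd h this.ne⟩
  by_cases hP : e ≤ #{x | vdeg G x = 1}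
  · obtain ⟨A, hA, hAL⟩ := exists_subset_card_eq hP
    obtain ⟨r, hr⟩ := exists_isPendantRetraction_leaves hG (by omega) (A : Set V)
      fun x hx => (mem_filter.1 (hA hx)).2
    have h1 := hr.weightedWiener_le hG (fun _ => 1) A (by simp)
    have h2 := hr.sum_vdeg
    rw [Set.ncard_coe_finset, hAL] at h2
    have hcard : Fintype.card ((A : Set V)ᶜ : Set V) = 2 * m - 2 + 2 := by
      rw [Fintype.card_compl_set]
      simp [hAL, hc]
      omega
    obtain ⟨h4, h5⟩ := weightedWiener_sparse_le (K := 2 * m - 2) (by omega) (G.induce (A : Set V)ᶜ)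
      (pushWeight r fun _ => 1) e hcard (hr.connected hG) (by omega)
      (fun z => hr.le_pushWeight (fun _ => 1) z)
      (by rw [sum_pushWeight, sum_const, card_univ, smul_eq_mul, hc]; omega) (hr.isSparse hs)
    rw [show 2 * m - 2 + 2 = 2 * m by omega] at h4 h5
    simp only [Nat.cast_one, sum_const, card_univ, mul_one, nsmul_eq_mul, hAL, hc,
      cutVal_one] at h1
    refine ⟨by linarith, fun heq => ⟨A, r, hr, by rw [Set.ncard_coe_finset, hAL], h5 ?_⟩⟩
    linarith
  · obtain ⟨g, φ, h, π, ρ, hφ, H⟩ := exists_isRooted_cycle _ G rfl hG hd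
    have h3 := hφ.three_le
    have hleaves : ∀ u v, G.Adj u v → ¬ G.IsBridge s(u, v) →
        e + 1 ≤ #{z | vdeg (G.deleteEdges {s(u, v)}) z = 1} := by
      intro u v huv hb
      obtain ⟨t1, t2⟩ := isTree_iff_connected_and_sum_vdeg.1 (isTree_deleteEdges hG hd huv hb)
      have hM := card_le_leaves_add_matchingNumber (SimpleGraph.deleteEdges_le _) t1 t2
      omega
    have hsub : ∀ u v, ({z | vdeg (G.deleteEdges {s(u, v)}) z = 1} : Finset V) ⊆
        insert u (insert v ({x | vdeg G x = 1} : Finset V)) := by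
      intro u v z hz
      by_cases hzu : z = u
      · simp [hzu]
      by_cases hzv : z = v
      · simp [hzv]
      have hz := (mem_filter.1 hz).2
      rw [vdeg_deleteEdges_of_ne hzu hzv] at hz
      simp [hz]
    -- Deleting a cycle edge must create at least two leaves, since `G` has fewer than `e` and the
    -- tree at least `e + 1`. Hence every cycle vertex has degree two.
    have hlight : ∀ i < g, vdeg G (φ i) ≤ 2 := by
      intro i hi
      by_contra hcon
      have huv := hφ.adj i hi
      have h4 := hleaves _ _ huv (hφ.not_isBridge hi)
      have h5 : ({z | vdeg (G.deleteEdges {s(φ i, φ (cyclicSucc g i))}) z = 1} : Finset V) ⊆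
          insert (φ (cyclicSucc g i)) ({x | vdeg G x = 1} : Finset V) := by
        intro z hz
        rcases mem_insert.1 (hsub _ _ hz) with rfl | h'
        · have := (mem_filter.1 hz).2
          have := vdeg_deleteEdges_left huv
          omega
        · exact h'
      have := (card_le_card h5).trans (card_insert_le _ _)
      omega
    -- Following parents from a vertex off the cycle would reach a cycle vertex with a third
    -- neighbour, so `G` is the cycle alone.
    have huniv : ∀ n, ∀ x, h x = n → x ∈ φ '' Set.Iio g := by
      intro n
      induction n with
      | zero =>
        intro x hx
        by_contra hcon
        have := H.height_parent x hcon
        omega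
      | succ n ih =>
        intro x hx
        by_contra hcon
        have h4 := H.height_parent x hcon
        obtain ⟨i, hi, hi'⟩ := ih (π x) (by omega)
        have h5 := H.adj_parent x hcon
        rw [← hi'] at h5
        exact hcon (hφ.mem_of_adj hi (hlight i hi) h5.symm)
    have hle2 : ∀ x, vdeg G x ≤ 2 := by
      intro x
      obtain ⟨i, hi, rfl⟩ := huniv _ x rfl
      exact hlight i hi
    have hno : #{x | vdeg G x = 1} = 0 := by
      rw [card_eq_zero, filter_eq_empty_iff]
      intro x _ hx
      have h4 := (sum_eq_sum_iff_of_le fun x (_ : x ∈ univ) => hle2 x).1 (by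
        rw [hd, sum_const, card_univ, smul_eq_mul, mul_comm]) x (mem_univ _)
      omega
    have he : e = 1 := by
      have h4 := hleaves _ _ (hφ.adj 0 (by omega)) (hφ.not_isBridge (by omega))
      have h5 := (card_le_card (hsub (φ 0) (φ (cyclicSucc g 0)))).trans
        ((card_insert_le _ _).trans (Nat.succ_le_succ (card_insert_le _ _)))
      omega
    subst he
    -- No leaf is removed from this odd cycle: the weighted bound is used with all `2 * m + 1`
    -- vertices and excess zero, and its value coincides with the one claimed.
    obtain ⟨h4, h5⟩ := weightedWiener_sparse_le (K := 2 * m - 1) (by omega) G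
      (fun _ => 1) 0 (by omega) hG (by omega) (fun _ => le_rfl)
      (by rw [sum_const, card_univ, smul_eq_mul, hc]; omega) hs
    have hval : sparseMax (2 * m - 1 + 2) 0 =
        (1 : ℕ) * ((2 * m + 1 : ℕ) - 1) + sparseMax (2 * m) 1 := by
      unfold sparseMax
      obtain ⟨p, rfl⟩ : ∃ p, m = p + 1 := ⟨m - 1, by omega⟩
      rw [if_pos (by omega), if_pos (by omega), show 2 * (p + 1) - 1 + 2 - 2 = 2 * p + 1 by omega,
        show 2 * (p + 1) - 2 = 2 * p by omega, show 2 * (p + 1) - 1 + 2 + 0 = 2 * p + 3 by omega,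
        show 2 * (p + 1) + 1 = 2 * p + 3 by omega, cutSum_succ,
        show (2 * p + 3 - 2 * p) / 2 = 1 by omega, Nat.cast_one, cutVal_one]
      ring
    rw [hval] at h4 h5
    -- On at least five vertices with excess zero, the extremal graph is a triangle with a tail and
    -- has a vertex of degree three, unlike a cycle.
    have hne : weightedWiener G (fun _ => 1) ≠
        2 * ((1 : ℕ) * ((2 * m + 1 : ℕ) - 1) + sparseMax (2 * m) 1) := by
      intro heq
      obtain ⟨ψ, ⟨-, hl, -⟩ | ⟨h6, -⟩⟩ := h5 heq
      · have h6 := hl.three_le_vdeg (by omega)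
        have := hle2 (ψ (2 * m - 1 + 2 - 3))
        omega
      · omega
    exact ⟨h4, fun heq => absurd heq hne⟩

end unicyclic

/-! ### Unicyclic graphs by degree sum; isomorphisms -/

section isomorphism

/-- Deleting an edge of the cycle leaves a tree, which has one edge fewer than vertices. Conversely,
with the degree sum of a unicyclic graph, deleting an edge of one cycle destroys all cycles, so
every cycle contains every edge of every other. -/
theorem isUnicyclic_iff {V : Type*} [Fintype V] {G : SimpleGraph V} :
    IsUnicyclic G ↔ G.Connected ∧ ∑ x, vdeg G x = 2 * Fintype.card V := by
  classical
  constructor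
  · rintro ⟨hG, C, ⟨v, p, hp, rfl⟩, huniq⟩
    refine ⟨hG, ?_⟩
    obtain ⟨e, he⟩ : ∃ e, e ∈ p.edges := List.exists_mem_of_ne_nil _ fun h0 =>
      hp.ne_nil (SimpleGraph.Walk.edges_eq_nil.1 h0).eq_nil
    induction e with | h x y
    have hxy : G.Adj x y := p.edges_subset_edgeSet he
    have hb : ¬ G.IsBridge s(x, y) := fun hb => hb.notMem_edges_of_isCycle hp he
    have hT : (G.deleteEdges {s(x, y)}).IsTree := by
      refine ⟨hG.connected_delete_edge_of_not_isBridge hb, fun w q hq => ?_⟩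
      have h1 := huniq _ ⟨w, _, hq.mapLe (SimpleGraph.deleteEdges_le {s(x, y)}), rfl⟩
      rw [SimpleGraph.Walk.edgeSet_mapLe_eq_edgeSet] at h1
      have h2 : s(x, y) ∈ q.edgeSet := by rwa [h1]
      have h3 := q.edges_subset_edgeSet h2
      simp at h3
    have h1 := (isTree_iff_connected_and_sum_vdeg.1 hT).2
    rwa [sum_vdeg_deleteEdges hxy] at h1
  · rintro ⟨hG, hd⟩
    refine ⟨hG, ?_⟩
    have hcyc : ¬ G.IsAcyclic := fun h => by
      have := (isTree_iff_connected_and_sum_vdeg.1 ⟨hG, h⟩).2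
      omega
    have hsub : ∀ {v w : V} (p : G.Walk v v) (q : G.Walk w w), p.IsCycle → q.IsCycle →
        p.edgeSet ⊆ q.edgeSet := by
      intro v w p q hp hq e he
      by_contra hcon
      induction e with | h x y
      have hxy : G.Adj x y := p.edges_subset_edgeSet he
      have hb : ¬ G.IsBridge s(x, y) := fun hb => hb.notMem_edges_of_isCycle hp he
      have hne : ∀ e ∈ q.edges, e ∉ ({s(x, y)} : Set (Sym2 V)) := by
        rintro e he rfl
        exact hcon he
      exact (isTree_deleteEdges hG hd hxy hb).isAcyclic _
        (SimpleGraph.Walk.IsCycle.toDeleteEdges _ _ hq hne)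
    unfold SimpleGraph.IsAcyclic at hcyc
    push Not at hcyc
    obtain ⟨v, p, hp⟩ := hcyc
    refine ⟨p.edgeSet, ⟨v, p, hp, rfl⟩, ?_⟩
    rintro _ ⟨w, q, hq, rfl⟩
    exact Set.Subset.antisymm (hsub q p hq hp) (hsub p q hp hq)

theorem weightedWiener_one_eq {V : Type*} [Fintype V] (G : SimpleGraph V) :
    weightedWiener G (fun _ => 1) = 2 * wienerIndex G := by
  classical
  set f : Sym2 V → ℕ := Sym2.lift ⟨fun u v => G.dist u v, fun _ _ => G.dist_comm⟩
  have h1 : weightedWiener G (fun _ => 1) = ((∑ p : V × V, f s(p.1, p.2) : ℕ) : ℤ) := by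
    rw [Fintype.sum_prod_type]
    simp [weightedWiener, f]
  have h2 : ∑ p : V × V, f s(p.1, p.2) = 2 * ∑ e, f e := by
    rw [← sum_fiberwise univ (fun p : V × V => s(p.1, p.2)), mul_sum]
    refine sum_congr rfl fun e _ => ?_
    induction e with | h x y
    by_cases hxy : x = y
    · subst hxy
      have h0 : f s(x, x) = 0 := by simp [f]
      rw [h0, mul_zero]
      refine sum_eq_zero fun p hp => ?_
      rw [(mem_filter.1 hp).2, h0]
    · have : (univ.filter fun p : V × V => s(p.1, p.2) = s(x, y)) = {(x, y), (y, x)} := by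
        ext ⟨a, b⟩
        simp
      rw [this, sum_pair (fun h => hxy (Prod.ext_iff.1 h).1), Sym2.eq_swap (a := y)]
      ring
  rw [h1, h2, Nat.cast_mul]
  rfl

theorem vdeg_iso {V W : Type*} {G : SimpleGraph V} {H : SimpleGraph W} (f : G ≃g H) (x : V) :
    vdeg H (f x) = vdeg G x := by
  unfold vdeg
  rw [← Set.ncard_image_of_injective (G.neighborSet x) f.injective]
  congr 1
  ext y
  constructor
  · intro hy
    refine ⟨f.symm y, ?_, f.apply_symm_apply y⟩
    rw [SimpleGraph.mem_neighborSet, ← f.map_adj_iff, f.apply_symm_apply]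
    exact hy
  · rintro ⟨z, hz, rfl⟩
    exact f.map_adj_iff.2 hz

theorem dist_iso {V W : Type*} {G : SimpleGraph V} {H : SimpleGraph W} (f : G ≃g H)
    (hG : G.Connected) (x y : V) : H.dist (f x) (f y) = G.dist x y := by
  refine le_antisymm ?_ ?_
  · obtain ⟨p, hp⟩ := hG.exists_walk_length_eq_dist x y
    rw [← hp, ← SimpleGraph.Walk.length_map f.toHom p]
    exact SimpleGraph.dist_le _
  · obtain ⟨p, hp⟩ := (f.connected_iff.1 hG).exists_walk_length_eq_dist (f x) (f y)
    have h1 := SimpleGraph.dist_le (p.map f.symm.toHom)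
    rw [SimpleGraph.Walk.length_map, hp] at h1
    simpa using h1

theorem wienerIndex_iso {V W : Type*} [Fintype V] [Fintype W] {G : SimpleGraph V}
    {H : SimpleGraph W} (f : G ≃g H) (hG : G.Connected) : wienerIndex H = wienerIndex G := by
  have h1 : weightedWiener H (fun _ => 1) = weightedWiener G (fun _ => 1) := by
    simp only [weightedWiener, Nat.cast_one, one_mul]
    rw [← f.toEquiv.sum_comp]
    refine sum_congr rfl fun x _ => ?_
    rw [← f.toEquiv.sum_comp]
    refine sum_congr rfl fun y _ => ?_
    exact congrArg _ (dist_iso f hG x y)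
  rw [weightedWiener_one_eq, weightedWiener_one_eq] at h1
  omega

theorem matchingNumber_le_of_iso {V W : Type*} [Finite W] {G : SimpleGraph V}
    {H : SimpleGraph W} (f : G ≃g H) : matchingNumber G ≤ matchingNumber H := by
  refine csSup_le ⟨0, ⊥, fun v hv => hv.elim, by simp⟩ ?_
  rintro k ⟨M, hM, rfl⟩
  refine le_csSup ⟨Nat.card (Sym2 W), ?_⟩ ⟨M.map f.toHom, hM.map f.toHom f.injective, ?_⟩
  · rintro k ⟨M, -, rfl⟩
    exact Set.ncard_le_card _
  · rw [SimpleGraph.Subgraph.edgeSet_map]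
    exact Set.ncard_image_of_injective _ (Sym2.map.injective f.injective)

theorem memU_iff {n m : ℕ} {V : Type*} [Fintype V] {G : SimpleGraph V} :
    MemU n m G ↔ G.Connected ∧ ∑ x, vdeg G x = 2 * Fintype.card V ∧ Fintype.card V = n ∧
      matchingNumber G = m := by
  rw [MemU, isUnicyclic_iff, and_assoc]

theorem MemU.of_iso {n m : ℕ} {V W : Type*} [Fintype V] [Fintype W] {G : SimpleGraph V}
    {H : SimpleGraph W} (h : MemU n m G) (f : G ≃g H) : MemU n m H := by
  rw [memU_iff] at h ⊢
  obtain ⟨h1, h2, h3, h4⟩ := h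
  have hcard := Fintype.card_congr f.toEquiv
  refine ⟨f.connected_iff.1 h1, ?_, by omega, ?_⟩
  · rw [← hcard, ← h2, ← f.toEquiv.sum_comp]
    exact sum_congr rfl fun x _ => vdeg_iso f x
  · exact h4 ▸ le_antisymm (matchingNumber_le_of_iso f.symm) (matchingNumber_le_of_iso f)

/-- A bijective homomorphism onto a graph that does not have more edges is an isomorphism. -/
theorem graphIso_of_bijective {V W : Type*} [Fintype V] [Fintype W] {G : SimpleGraph V}
    {H : SimpleGraph W} (f : W → V) (hf : f.Bijective) (hadj : ∀ x y, H.Adj x y → G.Adj (f x) (f y))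
    (hd : ∑ x, vdeg G x ≤ ∑ x, vdeg H x) : GraphIso G H := by
  have himg : ∀ x, f '' H.neighborSet x ⊆ G.neighborSet (f x) := by
    rintro x _ ⟨y, hy, rfl⟩
    exact hadj x y hy
  have hle : ∀ x ∈ univ, vdeg H x ≤ vdeg G (f x) := by
    intro x _
    unfold vdeg
    rw [← Set.ncard_image_of_injective _ hf.1]
    exact Set.ncard_le_ncard (himg x) (Set.toFinite _)
  have heq := (sum_eq_sum_iff_of_le hle).1
    (le_antisymm (sum_le_sum hle) (by rwa [hf.sum_comp fun x => vdeg G x]))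
  refine ⟨SimpleGraph.Iso.symm ⟨Equiv.ofBijective f hf, ?_⟩⟩
  intro x y
  refine ⟨fun h => ?_, hadj x y⟩
  have h1 : f '' H.neighborSet x = G.neighborSet (f x) := by
    refine Set.eq_of_subset_of_ncard_le (himg x) ?_ (Set.toFinite _)
    rw [Set.ncard_image_of_injective _ hf.1]
    exact (heq x (mem_univ _)).ge
  have h2 : f y ∈ f '' H.neighborSet x := by
    rw [h1]
    exact h
  obtain ⟨z, hz, hzy⟩ := h2
  rwa [← hf.1 hzy]

/-- A connected graph that has a cycle, and at most as many edges as vertices. -/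
theorem sum_vdeg_eq_of_edgeSet_subset_range {V : Type*} [Fintype V] {G : SimpleGraph V}
    (hG : G.Connected) {u v : V} (huv : G.Adj u v) (hb : ¬ G.IsBridge s(u, v)) (F : V → Sym2 V)
    (hF : G.edgeSet ⊆ Set.range F) : ∑ x, vdeg G x = 2 * Fintype.card V := by
  refine le_antisymm ?_ ?_
  · rw [sum_vdeg_eq_twice_card_edges]
    refine Nat.mul_le_mul_left 2 ?_
    have h1 : Nat.card G.edgeSet ≤ (Set.range F).ncard := Set.ncard_le_ncard hF (Set.toFinite _)
    rw [← Set.image_univ] at h1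
    refine h1.trans ((Set.ncard_image_le (Set.toFinite _)).trans ?_)
    rw [Set.ncard_univ, Nat.card_eq_fintype_card]
  · have h1 := (hG.connected_delete_edge_of_not_isBridge hb).card_vert_le_card_edgeSet_add_one
    have h2 := sum_vdeg_eq_twice_card_edges (G.deleteEdges {s(u, v)})
    have h3 := sum_vdeg_deleteEdges huv
    rw [Nat.card_eq_fintype_card] at h1
    omega

theorem G3.adj_iff {a j : ℕ} {x y : G3Vertex a j} :
    (G3 a j).Adj x y ↔ G3Edge a j x y ∨ G3Edge a j y x := by
  rw [G3, SimpleGraph.fromRel_adj, and_iff_right_iff_imp]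
  rintro (h | h) <;> cases h <;> simp [Fin.ext_iff]

theorem G3.adj_of_edge {a j : ℕ} {x y : G3Vertex a j} (h : G3Edge a j x y) : (G3 a j).Adj x y :=
  adj_iff.2 (.inl h)

theorem G4.adj_iff {a c j : ℕ} {x y : G4Vertex a c j} :
    (G4 a c j).Adj x y ↔ G4Edge a c j x y ∨ G4Edge a c j y x := by
  rw [G4, SimpleGraph.fromRel_adj, and_iff_right_iff_imp]
  rintro (h | h) <;> cases h <;> simp [Fin.ext_iff]

theorem G4.adj_of_edge {a c j : ℕ} {x y : G4Vertex a c j} (h : G4Edge a c j x y) :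
    (G4 a c j).Adj x y :=
  adj_iff.2 (.inl h)

theorem G3.connected (a j : ℕ) : (G3 a j).Connected := by
  rw [SimpleGraph.connected_iff_exists_forall_reachable]
  have hA : ∀ i, (G3 a j).Reachable (G3Vertex.A 0) (G3Vertex.A i) := fun i => by
    induction i using Fin.induction with
    | zero => exact .refl _
    | succ i ih => exact ih.trans (adj_of_edge (.path i)).reachable
  refine ⟨G3Vertex.A 0, ?_⟩
  rintro (i | i | i)
  · exact hA i
  · fin_cases i
    · exact (adj_of_edge .ab).reachable
    · exact (adj_of_edge .ca).symm.reachable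
  · exact (hA _).trans (adj_of_edge (.pendant i)).reachable

theorem G4.connected (a c j : ℕ) : (G4 a c j).Connected := by
  rw [SimpleGraph.connected_iff_exists_forall_reachable]
  have hA : ∀ i, (G4 a c j).Reachable (G4Vertex.A 0) (G4Vertex.A i) := fun i => by
    induction i using Fin.induction with
    | zero => exact .refl _
    | succ i ih => exact ih.trans (adj_of_edge (.path i)).reachable
  have hB : (G4 a c j).Reachable (G4Vertex.A 0) G4Vertex.B := (adj_of_edge .ab).reachable
  have hC : (G4 a c j).Reachable (G4Vertex.A 0) G4Vertex.C :=
    hB.trans (adj_of_edge .bc).reachable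
  refine ⟨G4Vertex.A 0, ?_⟩
  rintro (i | i | i | i)
  · exact hA i
  · fin_cases i
    · exact hB
    · exact hC
    · exact hC.trans (adj_of_edge .cd).reachable
  · exact (hA _).trans (adj_of_edge (.pendantA i)).reachable
  · exact hC.trans (adj_of_edge (.pendantC i)).reachable

theorem G3.sum_vdeg (a j : ℕ) :
    ∑ x, vdeg (G3 a j) x = 2 * Fintype.card (G3Vertex a j) := by
  -- One edge is assigned to each vertex so that every edge is hit; hence there are at most as many
  -- edges as vertices.
  let F : G3Vertex a j → Sym2 (G3Vertex a j) := Sum.elim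
    (fun i => Fin.cases s(G3Vertex.A 0, G3Vertex.B)
      (fun i => s(G3Vertex.A i.castSucc, G3Vertex.A i.succ)) i)
    (Sum.elim ![s(G3Vertex.B, G3Vertex.C), s(G3Vertex.C, G3Vertex.A 0)]
      fun i => s(G3Vertex.A (Fin.last j), G3Vertex.leaf i))
  refine sum_vdeg_eq_of_edgeSet_subset_range (G3.connected a j) (u := G3Vertex.A 0)
    (v := G3Vertex.B) (adj_of_edge .ab) ?_ F ?_
  · rw [SimpleGraph.isBridge_iff, not_not]
    have h1 : ((G3 a j).deleteEdges {s(G3Vertex.A 0, G3Vertex.B)}).Adj G3Vertex.B G3Vertex.C := by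
      rw [SimpleGraph.deleteEdges_adj]
      exact ⟨adj_of_edge .bc, by simp⟩
    have h2 : ((G3 a j).deleteEdges {s(G3Vertex.A 0, G3Vertex.B)}).Adj G3Vertex.C
        (G3Vertex.A 0) := by
      rw [SimpleGraph.deleteEdges_adj]
      exact ⟨adj_of_edge .ca, by simp⟩
    exact (h1.reachable.trans h2.reachable).symm
  · intro e he
    induction e with | h x y
    have key : ∀ {x y}, G3Edge a j x y → s(x, y) ∈ Set.range F := by
      rintro _ _ (_ | _ | _ | i | i)
      · exact ⟨.inl 0, rfl⟩
      · exact ⟨.inr (.inl 0), rfl⟩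
      · exact ⟨.inr (.inl 1), rfl⟩
      · exact ⟨.inl i.succ, rfl⟩
      · exact ⟨.inr (.inr i), rfl⟩
    rcases adj_iff.1 he with h | h
    · exact key h
    · rw [Sym2.eq_swap]
      exact key h

theorem G4.sum_vdeg (a c j : ℕ) :
    ∑ x, vdeg (G4 a c j) x = 2 * Fintype.card (G4Vertex a c j) := by
  let F : G4Vertex a c j → Sym2 (G4Vertex a c j) := Sum.elim
    (fun i => Fin.cases s(G4Vertex.A 0, G4Vertex.B)
      (fun i => s(G4Vertex.A i.castSucc, G4Vertex.A i.succ)) i)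
    (Sum.elim ![s(G4Vertex.B, G4Vertex.C), s(G4Vertex.C, G4Vertex.D), s(G4Vertex.D, G4Vertex.A 0)]
      (Sum.elim (fun i => s(G4Vertex.A (Fin.last j), G4Vertex.leafA i))
        fun i => s(G4Vertex.C, G4Vertex.leafC i)))
  refine sum_vdeg_eq_of_edgeSet_subset_range (G4.connected a c j) (u := G4Vertex.A 0)
    (v := G4Vertex.B) (adj_of_edge .ab) ?_ F ?_
  · rw [SimpleGraph.isBridge_iff, not_not]
    have h1 : ((G4 a c j).deleteEdges {s(G4Vertex.A 0, G4Vertex.B)}).Adj G4Vertex.B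
        G4Vertex.C := by
      rw [SimpleGraph.deleteEdges_adj]
      exact ⟨adj_of_edge .bc, by simp⟩
    have h2 : ((G4 a c j).deleteEdges {s(G4Vertex.A 0, G4Vertex.B)}).Adj G4Vertex.C
        G4Vertex.D := by
      rw [SimpleGraph.deleteEdges_adj]
      exact ⟨adj_of_edge .cd, by simp⟩
    have h3 : ((G4 a c j).deleteEdges {s(G4Vertex.A 0, G4Vertex.B)}).Adj G4Vertex.D
        (G4Vertex.A 0) := by
      rw [SimpleGraph.deleteEdges_adj]
      exact ⟨adj_of_edge .da, by simp⟩
    exact (h1.reachable.trans (h2.reachable.trans h3.reachable)).symm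
  · intro e he
    induction e with | h x y
    have key : ∀ {x y}, G4Edge a c j x y → s(x, y) ∈ Set.range F := by
      rintro _ _ (_ | _ | _ | _ | i | i | i)
      · exact ⟨.inl 0, rfl⟩
      · exact ⟨.inr (.inl 0), rfl⟩
      · exact ⟨.inr (.inl 1), rfl⟩
      · exact ⟨.inr (.inl 2), rfl⟩
      · exact ⟨.inl i.succ, rfl⟩
      · exact ⟨.inr (.inr (.inl i)), rfl⟩
      · exact ⟨.inr (.inr (.inr i)), rfl⟩
    rcases adj_iff.1 he with h | h
    · exact key h
    · rw [Sym2.eq_swap]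
      exact key h

theorem exists_fin_enumeration {V : Type*} [Finite V] {S : Set V} {a : ℕ} (h : S.ncard = a) :
    ∃ f : Fin a → V, (∀ i, f i ∈ S) ∧ ∀ x ∈ S, ∃ i, f i = x := by
  let e := Finite.equivFinOfCardEq (α := S) h
  exact ⟨fun i => e.symm i, fun i => (e.symm i).2, fun x hx => ⟨e ⟨x, hx⟩, by simp⟩⟩

/-! ### Recognising the extremal graphs -/

section extremal

variable {V : Type*} [Fintype V] {G : SimpleGraph V} {S : Set V} {r : V → (Sᶜ : Set V)}

/-- The path `φ` starts at the far end of the tail, so `A_i` is `φ (t - i)`, and `B₀`, `C₀` are the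
two vertices after `φ t`. Preserving adjacency in one direction is enough because the degree sums
agree. -/
theorem graphIso_G3_of_isLollipop (hr : IsPendantRetraction G S r) {a t : ℕ}
    {φ : ℕ → (Sᶜ : Set V)} (hl : IsLollipop (G.induce Sᶜ) (t + 3) t φ)
    (ha : {x | x ∈ S ∧ r x = φ 0}.ncard = a) (h0 : ∀ x ∈ S, r x = φ 0)
    (hd : ∑ x, vdeg G x = 2 * Fintype.card V) (hc : Fintype.card V = a + t + 3) :
    GraphIso G (G3 a t) := by
  obtain ⟨f, hf, hf'⟩ := exists_fin_enumeration ha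
  have hadj : ∀ i, i + 1 < t + 3 → G.Adj (φ i) (φ (i + 1)) := fun i hi => hl.adj i hi
  have hchord : G.Adj (φ (t + 2)) (φ t) := hl.chord
  let F : G3Vertex a t → V := Sum.elim (fun i => φ (t - i))
    (Sum.elim (fun i => φ (t + 1 + i)) f)
  have hcard : Fintype.card (G3Vertex a t) = Fintype.card V := by
    simp
    omega
  have hF : F.Bijective := by
    rw [Fintype.bijective_iff_surjective_and_card]
    refine ⟨fun x => ?_, hcard⟩
    by_cases hx : x ∈ S
    · obtain ⟨i, hi⟩ := hf' x ⟨hx, h0 x hx⟩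
      exact ⟨.inr (.inr i), hi⟩
    · obtain ⟨i, hi, hi'⟩ := hl.surj ⟨x, hx⟩
      by_cases hit : i ≤ t
      · refine ⟨.inl ⟨t - i, by omega⟩, ?_⟩
        simp only [F, Sum.elim_inl]
        rw [Nat.sub_sub_self hit, hi']
      · refine ⟨.inr (.inl ⟨i - (t + 1), by omega⟩), ?_⟩
        simp only [F, Sum.elim_inl, Sum.elim_inr]
        rw [Nat.add_sub_cancel' (by omega), hi']
  refine graphIso_of_bijective F hF (fun x y hxy => ?_) (by rw [hd, G3.sum_vdeg, hcard])
  have key : ∀ {x y}, G3Edge a t x y → G.Adj (F x) (F y) := by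
    rintro _ _ (_ | _ | _ | i | i)
    · exact hadj t (by omega)
    · exact hadj (t + 1) (by omega)
    · exact hchord
    · simp only [F, Sum.elim_inl, Fin.val_castSucc, Fin.val_succ]
      have := hadj (t - (i + 1)) (by omega)
      rw [show t - (i + 1) + 1 = t - i by omega] at this
      exact this.symm
    · simp only [F, Sum.elim_inl, Sum.elim_inr, Fin.val_last, Nat.sub_self]
      refine ((hr.adj_iff _ (hf i).1 _).2 ?_).symm
      rw [(hf i).2]
  rcases G3.adj_iff.1 hxy with h | h
  · exact key h
  · exact (key h).symm

theorem graphIso_G4_of_isLollipop (hr : IsPendantRetraction G S r) {a c t : ℕ}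
    {φ : ℕ → (Sᶜ : Set V)} (hl : IsLollipop (G.induce Sᶜ) (t + 4) t φ)
    (ha : {x | x ∈ S ∧ r x = φ 0}.ncard = a) (hc : {x | x ∈ S ∧ r x = φ (t + 2)}.ncard = c)
    (h0 : ∀ x ∈ S, r x = φ 0 ∨ r x = φ (t + 2)) (hd : ∑ x, vdeg G x = 2 * Fintype.card V)
    (hcV : Fintype.card V = a + c + t + 4) : GraphIso G (G4 a c t) := by
  obtain ⟨f, hf, hf'⟩ := exists_fin_enumeration ha
  obtain ⟨g, hg, hg'⟩ := exists_fin_enumeration hc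
  have hadj : ∀ i, i + 1 < t + 4 → G.Adj (φ i) (φ (i + 1)) := fun i hi => hl.adj i hi
  have hchord : G.Adj (φ (t + 3)) (φ t) := hl.chord
  let F : G4Vertex a c t → V := Sum.elim (fun i => φ (t - i))
    (Sum.elim (fun i => φ (t + 1 + i)) (Sum.elim f g))
  have hcard : Fintype.card (G4Vertex a c t) = Fintype.card V := by
    simp
    omega
  have hF : F.Bijective := by
    rw [Fintype.bijective_iff_surjective_and_card]
    refine ⟨fun x => ?_, hcard⟩
    by_cases hx : x ∈ S
    · rcases h0 x hx with h1 | h1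
      · obtain ⟨i, hi⟩ := hf' x ⟨hx, h1⟩
        exact ⟨.inr (.inr (.inl i)), hi⟩
      · obtain ⟨i, hi⟩ := hg' x ⟨hx, h1⟩
        exact ⟨.inr (.inr (.inr i)), hi⟩
    · obtain ⟨i, hi, hi'⟩ := hl.surj ⟨x, hx⟩
      by_cases hit : i ≤ t
      · refine ⟨.inl ⟨t - i, by omega⟩, ?_⟩
        simp only [F, Sum.elim_inl]
        rw [Nat.sub_sub_self hit, hi']
      · refine ⟨.inr (.inl ⟨i - (t + 1), by omega⟩), ?_⟩
        simp only [F, Sum.elim_inl, Sum.elim_inr]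
        rw [Nat.add_sub_cancel' (by omega), hi']
  refine graphIso_of_bijective F hF (fun x y hxy => ?_) (by rw [hd, G4.sum_vdeg, hcard])
  have key : ∀ {x y}, G4Edge a c t x y → G.Adj (F x) (F y) := by
    rintro _ _ (_ | _ | _ | _ | i | i | i)
    · exact hadj t (by omega)
    · exact hadj (t + 1) (by omega)
    · exact hadj (t + 2) (by omega)
    · exact hchord
    · simp only [F, Sum.elim_inl, Fin.val_castSucc, Fin.val_succ]
      have := hadj (t - (i + 1)) (by omega)
      rw [show t - (i + 1) + 1 = t - i by omega] at this
      exact this.symm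
    · simp only [F, Sum.elim_inl, Sum.elim_inr, Fin.val_last, Nat.sub_self]
      refine ((hr.adj_iff _ (hf i).1 _).2 ?_).symm
      rw [(hf i).2]
    · refine ((hr.adj_iff _ (hg i).1 _).2 ?_).symm
      rw [(hg i).2]
      rfl
  rcases G4.adj_iff.1 hxy with h | h
  · exact key h
  · exact (key h).symm

/-- The extremal graphs are those of the theorem. -/
theorem graphIso_of_isExtremal (hr : IsPendantRetraction G S r) {m e : ℕ} (hm : 2 ≤ m)
    (hS : S.ncard = e) (hd : ∑ x, vdeg G x = 2 * Fintype.card V)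
    (hc : Fintype.card V = 2 * m + e)
    (hE : IsExtremal (G.induce Sᶜ) (pushWeight r fun _ => 1) (2 * m) e) :
    (e ≤ 2 ∧ GraphIso G (G3 e (2 * m - 3))) ∨
    ((3 ≤ e ∨ (m = 2 ∧ (e = 0 ∨ e = 2))) ∧ GraphIso G (G4 ((e + 1) / 2) (e / 2) (2 * m - 4))) := by
  obtain ⟨φ, h⟩ := hE
  simp only [hr.pushWeight_one] at h
  have hmem : ∀ x ∈ S, {y | y ∈ S ∧ r y = r x}.ncard ≠ 0 := by
    intro x hx h1
    rw [Set.ncard_eq_zero] at h1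
    exact (Set.eq_empty_iff_forall_notMem.1 h1) x ⟨hx, rfl⟩
  rcases h with ⟨h1, hl, h2, h3⟩ | ⟨h1, hl, h2, h3, h4⟩
  · refine .inl ⟨h1, ?_⟩
    have h2m : 2 * m = 2 * m - 3 + 3 := by omega
    rw [h2m, Nat.add_sub_cancel] at hl
    refine graphIso_G3_of_isLollipop hr hl (by omega) (fun x hx => ?_) hd (by omega)
    obtain ⟨i, hi, hi'⟩ := hl.surj (r x)
    rcases Nat.eq_zero_or_pos i with rfl | hi0
    · exact hi'.symm
    · have h4 := h3 i hi0 (by omega)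
      rw [hi'] at h4
      exact absurd (by omega) (hmem x hx)
  · refine .inr ⟨by omega, ?_⟩
    have h2m : 2 * m = 2 * m - 4 + 4 := by omega
    rw [h2m, Nat.add_sub_cancel] at hl
    rw [show 2 * m - 2 = 2 * m - 4 + 2 by omega] at h3 h4
    refine graphIso_G4_of_isLollipop hr hl (by omega) (by omega) (fun x hx => ?_) hd (by omega)
    obtain ⟨i, hi, hi'⟩ := hl.surj (r x)
    by_cases hi0 : i = 0
    · subst hi0
      exact .inl hi'.symm
    by_cases hi2 : i = 2 * m - 4 + 2
    · rw [← hi2]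
      exact .inr hi'.symm
    have h5 := h4 i (by omega) hi0 hi2
    rw [hi'] at h5
    exact absurd (by omega) (hmem x hx)

end extremal

end isomorphism

/-! ### Matching numbers and distances in the listed graphs -/

section sharpness

/-- A matching has at most one edge in each class of pairwise intersecting edges. -/
theorem matchingNumber_le_of_cover {V : Type*} [Finite V] {G : SimpleGraph V} {m : ℕ}
    (Q : ℕ → Set (Sym2 V)) (hcov : ∀ e ∈ G.edgeSet, ∃ i < m, e ∈ Q i)
    (hint : ∀ i, ∀ e ∈ Q i, ∀ e' ∈ Q i, ∃ v, v ∈ e ∧ v ∈ e') : matchingNumber G ≤ m := by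
  refine csSup_le ⟨0, ⊥, fun v hv => hv.elim, by simp⟩ ?_
  rintro k ⟨M, hM, rfl⟩
  choose! l hl hlQ using hcov
  have h1 := Set.ncard_le_ncard_of_injOn (s := M.edgeSet) (t := Set.Iio m) l
    (fun e he => hl e (M.edgeSet_subset he)) (fun e he e' he' hee => by
      have hQ := hlQ e (M.edgeSet_subset he)
      rw [hee] at hQ
      obtain ⟨v, hv, hv'⟩ := hint _ _ hQ _ (hlQ e' (M.edgeSet_subset he'))
      obtain ⟨w, rfl⟩ := hv
      obtain ⟨w', rfl⟩ := hv'
      rw [SimpleGraph.Subgraph.mem_edgeSet] at he he'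
      rw [(hM he.fst_mem).unique he he']) (Set.toFinite _)
  simpa [Set.ncard_eq_toFinset_card'] using h1

theorem card_le_matchingNumber_of_injective {V ι : Type*} [Finite V] [Fintype ι]
    {G : SimpleGraph V} (f g : ι → V) (hadj : ∀ i, G.Adj (f i) (g i)) (hf : f.Injective)
    (hg : g.Injective) (hfg : ∀ i j, f i ≠ g j) : Fintype.card ι ≤ matchingNumber G := by
  classical
  rw [← card_univ, ← card_image_of_injective univ hf]
  refine card_le_matchingNumber _ (Function.extend f g id) ?_ ?_ ?_
  · intro x hx
    obtain ⟨i, -, rfl⟩ := mem_image.1 hx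
    rw [hf.extend_apply]
    exact hadj i
  · intro x hx y hy hxy
    obtain ⟨i, -, rfl⟩ := mem_image.1 hx
    obtain ⟨k, -, rfl⟩ := mem_image.1 hy
    rw [hf.extend_apply, hf.extend_apply] at hxy
    rw [hg hxy]
  · intro x hx hx'
    obtain ⟨i, -, rfl⟩ := mem_image.1 hx
    rw [hf.extend_apply] at hx'
    obtain ⟨k, -, hk⟩ := mem_image.1 hx'
    exact hfg k i hk

theorem matchingNumber_G3 (a p : ℕ) : matchingNumber (G3 a (2 * p + 1)) = p + 2 := by
  refine le_antisymm ?_ ?_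
  -- The classes are the stars at the path vertices of odd index, the last of which carries the
  -- leaves, and the triangle.
  · refine matchingNumber_le_of_cover (fun i => if h : i < p + 1 then
      {e | G3Vertex.A ⟨2 * i + 1, by omega⟩ ∈ e} else {s(G3Vertex.A 0, G3Vertex.B),
        s(G3Vertex.B, G3Vertex.C), s(G3Vertex.C, G3Vertex.A 0)}) ?_ ?_
    · intro e he
      induction e with | h x y
      wlog h : G3Edge a (2 * p + 1) x y generalizing x y
      · rw [Sym2.eq_swap (a := x) (b := y)]
        exact this y x (show (G3 a (2 * p + 1)).Adj x y from he).symm ((G3.adj_iff.1 he).resolve_left h)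
      rcases h with _ | _ | _ | i | i
      · exact ⟨p + 1, by omega, by simp⟩
      · exact ⟨p + 1, by omega, by simp⟩
      · exact ⟨p + 1, by omega, by simp⟩
      · refine ⟨i / 2, by omega, ?_⟩
        rw [dif_pos (by omega)]
        rcases Nat.even_or_odd' (i : ℕ) with ⟨l, hl | hl⟩
        · simp [Fin.ext_iff]
          omega
        · simp [Fin.ext_iff]
          omega
      · refine ⟨p, by omega, ?_⟩
        rw [dif_pos (by omega)]
        simp [Fin.ext_iff]
    · intro i e he e' he'
      split_ifs at he he' with h
      · exact ⟨_, he, he'⟩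
      · rcases he with rfl | rfl | rfl <;> rcases he' with rfl | rfl | rfl <;> simp
  · have h1 := card_le_matchingNumber_of_injective (G := G3 a (2 * p + 1))
      (ι := Fin (p + 1) ⊕ Fin 1)
      (Sum.elim (fun i => G3Vertex.A ⟨2 * i, by omega⟩) fun _ => G3Vertex.B)
      (Sum.elim (fun i => G3Vertex.A ⟨2 * i + 1, by omega⟩) fun _ => G3Vertex.C) ?_ ?_ ?_ ?_
    · simp at h1
      omega
    · rintro (i | i)
      · exact G3.adj_of_edge (.path ⟨2 * i, by omega⟩)
      · exact G3.adj_of_edge .bc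
    · rintro (i | i) (k | k) h <;> simp [Fin.ext_iff] at h ⊢
      omega
    · rintro (i | i) (k | k) h <;> simp [Fin.ext_iff] at h ⊢
      omega
    · rintro (i | i) (k | k) <;> simp [Fin.ext_iff]
      omega

theorem matchingNumber_G4 (a c p : ℕ) : matchingNumber (G4 a c (2 * p)) = p + 2 := by
  refine le_antisymm ?_ ?_
  -- The classes are the stars at the path vertices of even index and the star at `C₀`.
  · refine matchingNumber_le_of_cover (fun i => if h : i < p + 1 then
      {e | G4Vertex.A ⟨2 * i, by omega⟩ ∈ e} else {e | G4Vertex.C ∈ e}) ?_ ?_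
    · intro e he
      induction e with | h x y
      wlog h : G4Edge a c (2 * p) x y generalizing x y
      · rw [Sym2.eq_swap (a := x) (b := y)]
        exact this y x (show (G4 a c (2 * p)).Adj x y from he).symm ((G4.adj_iff.1 he).resolve_left h)
      rcases h with _ | _ | _ | _ | i | i | i
      · exact ⟨0, by omega, by simp⟩
      · exact ⟨p + 1, by omega, by simp⟩
      · exact ⟨p + 1, by omega, by simp⟩
      · exact ⟨0, by omega, by simp⟩
      · refine ⟨(i + 1) / 2, by omega, ?_⟩
        rw [dif_pos (by omega)]
        simp [Fin.ext_iff]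
        omega
      · refine ⟨p, by omega, ?_⟩
        rw [dif_pos (by omega)]
        simp [Fin.ext_iff]
      · exact ⟨p + 1, by omega, by simp⟩
    · intro i e he e' he'
      split_ifs at he he' with h
      · exact ⟨_, he, he'⟩
      · exact ⟨_, he, he'⟩
  · have h1 := card_le_matchingNumber_of_injective (G := G4 a c (2 * p))
      (ι := Fin p ⊕ Fin 1 ⊕ Fin 1)
      (Sum.elim (fun i => G4Vertex.A ⟨2 * i + 1, by omega⟩)
        (Sum.elim (fun _ => G4Vertex.A 0) fun _ => G4Vertex.C))
      (Sum.elim (fun i => G4Vertex.A ⟨2 * i + 2, by omega⟩)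
        (Sum.elim (fun _ => G4Vertex.B) fun _ => G4Vertex.D)) ?_ ?_ ?_ ?_
    · simpa using h1
    · rintro (i | i | i)
      · exact G4.adj_of_edge (.path ⟨2 * i + 1, by omega⟩)
      · exact G4.adj_of_edge .ab
      · exact G4.adj_of_edge .cd
    · rintro (i | i | i) (k | k | k) h <;> simp [Fin.ext_iff] at h ⊢ <;> omega
    · rintro (i | i | i) (k | k | k) h <;> simp [Fin.ext_iff] at h ⊢
      omega
    · rintro (i | i | i) (k | k | k) <;> simp [Fin.ext_iff] <;> omega

theorem abs_sub_le_dist {V : Type*} {G : SimpleGraph V} (hG : G.Connected) (h : V → ℤ)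
    (hh : ∀ x y, G.Adj x y → |h x - h y| ≤ 1) (x y : V) : |h x - h y| ≤ G.dist x y := by
  obtain ⟨p, hp⟩ := hG.exists_walk_length_eq_dist x y
  rw [← hp]
  clear hp
  induction p with
  | nil => simp
  | cons hxy p ih =>
    have h1 := hh _ _ hxy
    rw [SimpleGraph.Walk.length_cons]
    push_cast
    rw [abs_le] at *
    omega

theorem two_mul_sum_fin (n : ℕ) : 2 * ∑ i : Fin n, (i : ℤ) = n * (n - 1) := by
  induction n with
  | zero => simp
  | succ n ih =>
    rw [Fin.sum_univ_castSucc, mul_add]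
    simp only [Fin.val_castSucc, Fin.val_last, ih]
    push_cast
    ring

theorem three_mul_sum_fin_abs_sub (n : ℕ) :
    3 * ∑ i : Fin n, ∑ k : Fin n, |(i : ℤ) - k| = n ^ 3 - n := by
  induction n with
  | zero => simp
  | succ n ih =>
    have h0 : ∀ i : Fin n, |(n : ℤ) - (i : ℕ)| = n - (i : ℕ) := fun i =>
      abs_of_nonneg (by have := i.2; omega)
    have h1 : ∀ i : Fin n, |((i : ℕ) : ℤ) - n| = n - (i : ℕ) := fun i => by rw [abs_sub_comm, h0]
    have h2 := two_mul_sum_fin n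
    rw [Fin.sum_univ_castSucc]
    simp only [Fin.sum_univ_castSucc (n := n), Fin.val_castSucc, Fin.val_last, sum_add_distrib,
      sub_self, abs_zero, add_zero, h0, h1, sum_sub_distrib, sum_const, card_univ, Fintype.card_fin,
      nsmul_eq_mul]
    push_cast
    linarith

/-- Differences of the level function `h` bound the distances from below; only distinct vertices on
a common level need a separate bound of one or two. A lower bound suffices, as the upper bound is
already known. -/
theorem six_mul_wienerIndex_G3 (a j : ℕ) :
    ((j + 1) ^ 3 - (j + 1) + 6 * j * (j + 1) + 12 * (j + 1) + 3 * a * (j + 1) * (j + 2) + 6 +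
      12 * a * (j + 2) + 6 * a ^ 2 - 6 * a : ℤ) ≤ 6 * wienerIndex (G3 a j) := by
  let h : G3Vertex a j → ℤ := Sum.elim (fun i => i) (Sum.elim (fun _ => -1) fun _ => j + 1)
  let D : G3Vertex a j → G3Vertex a j → ℤ := Sum.elim
    (fun i => Sum.elim (fun k => |(i : ℤ) - k|) (Sum.elim (fun _ => i + 1) fun _ => j + 1 - i))
    (Sum.elim
      (fun l => Sum.elim (fun k => k + 1)
        (Sum.elim (fun k => 1 - if l = k then 1 else 0) fun _ => j + 2))
      fun l => Sum.elim (fun k => j + 1 - k)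
        (Sum.elim (fun _ => j + 2) fun k => 2 - if l = k then 2 else 0))
  have hconn := G3.connected a j
  have hdist := abs_sub_le_dist hconn h (by
    intro x y hxy
    wlog hE : G3Edge a j x y generalizing x y
    · rw [abs_sub_comm]
      exact this y x hxy.symm ((G3.adj_iff.1 hxy).resolve_left hE)
    rcases hE with _ | _ | _ | i | i <;> simp [h])
  have hD : ∀ x y, D x y ≤ (G3 a j).dist x y := by
    intro x y
    have h1 := hdist x y
    have hle : D x y ≤ |h x - h y| → D x y ≤ (G3 a j).dist x y := fun h2 => h2.trans h1
    rcases x with i | i | i <;> rcases y with k | k | k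
    · exact hle le_rfl
    · exact hle (le_abs.2 (.inl (by simp [h, D])))
    · exact hle (le_abs.2 (.inr (by simp [h, D])))
    · exact hle (le_abs.2 (.inr (by simp [h, D])))
    · by_cases hik : i = k
      · simp [D, hik]
      · have := hconn.pos_dist_of_ne (u := .inr (.inl i)) (v := .inr (.inl k)) (by simpa using hik)
        simp only [D, Sum.elim_inl, Sum.elim_inr, if_neg hik]
        omega
    · exact hle (le_abs.2 (.inr (by simp [h, D]; omega)))
    · exact hle (le_abs.2 (.inl (by simp [h, D])))
    · exact hle (le_abs.2 (.inl (by simp [h, D]; omega)))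
    · by_cases hik : i = k
      · simp [D, hik]
      · have := hconn.one_lt_dist_of_ne_of_not_adj (u := .inr (.inr i)) (v := .inr (.inr k))
          (by simpa using hik) (by
            rw [G3.adj_iff]
            rintro (h | h) <;> cases h)
        simp only [D, Sum.elim_inr, if_neg hik]
        omega
  have hsum : ∑ x, ∑ y, D x y ≤ weightedWiener (G3 a j) fun _ => 1 := by
    simp only [weightedWiener, Nat.cast_one, one_mul]
    exact sum_le_sum fun x _ => sum_le_sum fun y _ => hD x y
  rw [weightedWiener_one_eq] at hsum
  have e1 := two_mul_sum_fin (j + 1)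
  have e2 := three_mul_sum_fin_abs_sub (j + 1)
  simp only [D, Fintype.sum_sum_type, Sum.elim_inl, Sum.elim_inr, sum_add_distrib,
    sum_sub_distrib, sum_const, card_univ, Fintype.card_fin, sum_ite_eq, mem_univ, if_true,
    nsmul_eq_mul, ← mul_sum] at hsum
  push_cast at *
  generalize ∑ i : Fin (j + 1), (i : ℤ) = S at *
  generalize ∑ i : Fin (j + 1), ∑ k : Fin (j + 1), |(i : ℤ) - k| = T at *
  nlinarith

theorem six_mul_wienerIndex_G4 (a c j : ℕ) :
    ((j + 1) ^ 3 - (j + 1) + 9 * j * (j + 1) + 24 * (j + 1) + 3 * a * (j + 1) * (j + 2) +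
      3 * c * (j + 1) * (j + 6) + 24 + 6 * a * (3 * j + 7) + 30 * c + 6 * a ^ 2 - 6 * a +
      6 * c ^ 2 - 6 * c + 6 * a * c * (j + 4) : ℤ) ≤ 6 * wienerIndex (G4 a c j) := by
  -- Levels are measured from `A₀`, positive along the tail and negative across the 4-cycle. Only
  -- `B₀, D₀` and leaves with a common neighbour are distinct on the same level, and they are at
  -- distance at least two.
  let h : G4Vertex a c j → ℤ := Sum.elim (fun i => i)
    (Sum.elim ![-1, -2, -1] (Sum.elim (fun _ => j + 1) fun _ => -3))
  let D : G4Vertex a c j → G4Vertex a c j → ℤ := Sum.elim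
    (fun i => Sum.elim (fun k => |(i : ℤ) - k|)
      (Sum.elim (fun k => i + ![1, 2, 1] k) (Sum.elim (fun _ => j + 1 - i) fun _ => i + 3)))
    (Sum.elim
      (fun l => Sum.elim (fun k => k + ![1, 2, 1] l)
        (Sum.elim (fun k => ![![0, 1, 2], ![1, 0, 1], ![2, 1, 0]] l k)
          (Sum.elim (fun _ => j + 1 + ![1, 2, 1] l) fun _ => ![2, 1, 2] l)))
      (Sum.elim
        (fun l => Sum.elim (fun k => j + 1 - k) (Sum.elim (fun k => j + 1 + ![1, 2, 1] k)
          (Sum.elim (fun k => 2 - if l = k then 2 else 0) fun _ => j + 4)))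
        fun l => Sum.elim (fun k => k + 3) (Sum.elim (fun k => ![2, 1, 2] k)
          (Sum.elim (fun _ => j + 4) fun k => 2 - if l = k then 2 else 0))))
  have hconn := G4.connected a c j
  have hdist := abs_sub_le_dist hconn h (by
    intro x y hxy
    wlog hE : G4Edge a c j x y generalizing x y
    · rw [abs_sub_comm]
      exact this y x hxy.symm ((G4.adj_iff.1 hxy).resolve_left hE)
    rcases hE with _ | _ | _ | _ | i | i | i <;> simp [h])
  have hD : ∀ x y, D x y ≤ (G4 a c j).dist x y := by
    intro x y
    have h1 := hdist x y
    have hle : D x y ≤ |h x - h y| → D x y ≤ (G4 a c j).dist x y := fun h2 => h2.trans h1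
    have htwo : x ≠ y → (¬ (G4Edge a c j x y ∨ G4Edge a c j y x)) → D x y ≤ 2 →
        D x y ≤ (G4 a c j).dist x y := fun h2 h3 h4 => by
      have := hconn.one_lt_dist_of_ne_of_not_adj h2 (fun h5 => h3 (G4.adj_iff.1 h5))
      omega
    rcases x with i | i | i | i <;> rcases y with k | k | k | k
    · exact hle le_rfl
    · exact hle (le_abs.2 (.inl (by fin_cases k <;> simp [h, D])))
    · exact hle (le_abs.2 (.inr (by simp [h, D])))
    · exact hle (le_abs.2 (.inl (by simp [h, D])))
    · exact hle (le_abs.2 (.inr (by fin_cases i <;> simp [h, D])))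
    · fin_cases i <;> fin_cases k <;>
        first
        | refine hle (le_abs.2 (.inl ?_)); simp [h, D]; done
        | refine hle (le_abs.2 (.inr ?_)); simp [h, D]; done
        | exact htwo (by simp) (by rintro (h | h) <;> cases h) (by simp [D])
    · exact hle (le_abs.2 (.inr (by fin_cases i <;> simp [h, D])))
    · exact hle (le_abs.2 (.inl (by fin_cases i <;> simp [h, D])))
    · exact hle (le_abs.2 (.inl (by simp [h, D])))
    · exact hle (le_abs.2 (.inl (by fin_cases k <;> simp [h, D])))
    · by_cases hik : i = k
      · simp [D, hik]
      · exact htwo (by simpa using hik) (by rintro (h | h) <;> cases h) (by simp [D, hik])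
    · exact hle (le_abs.2 (.inl (by simp [h, D]; omega)))
    · exact hle (le_abs.2 (.inr (by simp [h, D])))
    · exact hle (le_abs.2 (.inr (by fin_cases k <;> simp [h, D])))
    · exact hle (le_abs.2 (.inr (by simp [h, D]; omega)))
    · by_cases hik : i = k
      · simp [D, hik]
      · exact htwo (by simpa using hik) (by rintro (h | h) <;> cases h) (by simp [D, hik])
  have hsum : ∑ x, ∑ y, D x y ≤ weightedWiener (G4 a c j) fun _ => 1 := by
    simp only [weightedWiener, Nat.cast_one, one_mul]
    exact sum_le_sum fun x _ => sum_le_sum fun y _ => hD x y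
  rw [weightedWiener_one_eq] at hsum
  have e1 := two_mul_sum_fin (j + 1)
  have e2 := three_mul_sum_fin_abs_sub (j + 1)
  simp only [D, Fintype.sum_sum_type, Sum.elim_inl, Sum.elim_inr, sum_add_distrib,
    sum_sub_distrib, sum_const, card_univ, Fintype.card_fin, sum_ite_eq, mem_univ, if_true,
    nsmul_eq_mul, ← mul_sum, Fin.sum_univ_three, Matrix.cons_val_zero, Matrix.cons_val_one,
    Matrix.cons_val] at hsum
  push_cast at *
  generalize ∑ i : Fin (j + 1), (i : ℤ) = S at *
  generalize ∑ i : Fin (j + 1), ∑ k : Fin (j + 1), |(i : ℤ) - k| = T at *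
  nlinarith

end sharpness

/-! ### Closed forms, attained values and the theorem -/

section bounds

theorem three_mul_cutSum_even (p M : ℕ) (h : p ≤ M) :
    3 * cutSum (2 * p) (2 * M) = 6 * p * M ^ 2 - p * (2 * p ^ 2 + 1) := by
  induction p with
  | zero => simp [cutSum]
  | succ p ih =>
    rw [show 2 * (p + 1) = 2 * p + 1 + 1 by ring, cutSum_succ, cutSum_succ,
      show (2 * M - (2 * p + 1)) / 2 = M - (p + 1) by omega,
      show (2 * M - 2 * p) / 2 = M - p by omega, Nat.cast_sub h, Nat.cast_sub (by omega)]
    have := ih (by omega)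
    unfold cutVal
    push_cast
    linear_combination this

theorem three_mul_cutSum_odd (p M : ℕ) (h : p ≤ M) :
    3 * cutSum (2 * p) (2 * M + 1) = 6 * p * M * (M + 1) - 2 * (p - 1) * p * (p + 1) := by
  induction p with
  | zero => simp [cutSum]
  | succ p ih =>
    rw [show 2 * (p + 1) = 2 * p + 1 + 1 by ring, cutSum_succ, cutSum_succ,
      show (2 * M + 1 - (2 * p + 1)) / 2 = M - p by omega,
      show (2 * M + 1 - 2 * p) / 2 = M - p by omega, Nat.cast_sub (by omega)]
    have := ih (by omega)
    unfold cutVal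
    push_cast
    linear_combination this

/-- The maximum of the Wiener index of unicyclic graphs with matching number `m` and `2 * m + e`
vertices. -/
def unicyclicMax (m e : ℕ) : ℤ := e * ((2 * m + e : ℕ) - 1) + sparseMax (2 * m) e

theorem unicyclicMax_eq_boundSmall {p e : ℕ} (he : e ≤ 2) :
    (unicyclicMax (p + 2) e : ℚ) = boundSmall (2 * (p + 2) + e : ℕ) (p + 2 : ℕ) := by
  unfold unicyclicMax sparseMax boundSmall
  rw [if_pos he, show 2 * (p + 2) - 2 = 2 * (p + 1) by omega]
  interval_cases e
  · have := three_mul_cutSum_even (p + 1) (p + 2) (by omega)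
    rw [add_zero]
    have h2 : (3 : ℚ) * (cutSum (2 * (p + 1)) (2 * (p + 2)) : ℤ) =
        6 * (p + 1) * (p + 2) ^ 2 - (p + 1) * (2 * (p + 1) ^ 2 + 1) := by exact_mod_cast this
    push_cast at *
    linear_combination (1 / 3 : ℚ) * h2
  · have := three_mul_cutSum_odd (p + 1) (p + 2) (by omega)
    have h2 : (3 : ℚ) * (cutSum (2 * (p + 1)) (2 * (p + 2) + 1) : ℤ) =
        6 * (p + 1) * (p + 2) * (p + 2 + 1) - 2 * (p + 1 - 1) * (p + 1) * (p + 1 + 1) := by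
      exact_mod_cast this
    push_cast at *
    linear_combination (1 / 3 : ℚ) * h2
  · have := three_mul_cutSum_even (p + 1) (p + 3) (by omega)
    rw [show 2 * (p + 2) + 2 = 2 * (p + 3) by ring]
    have h2 : (3 : ℚ) * (cutSum (2 * (p + 1)) (2 * (p + 3)) : ℤ) =
        6 * (p + 1) * (p + 3) ^ 2 - (p + 1) * (2 * (p + 1) ^ 2 + 1) := by exact_mod_cast this
    push_cast at *
    linear_combination (1 / 3 : ℚ) * h2

theorem unicyclicMax_eq_boundOdd (p c : ℕ) :
    (unicyclicMax (p + 2) (2 * c + 3) : ℚ) =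
      boundOdd (2 * (p + 2) + (2 * c + 3) : ℕ) (p + 2 : ℕ) := by
  unfold unicyclicMax sparseMax boundOdd
  have := three_mul_cutSum_odd (p + 1) (p + c + 3) (by omega)
  rw [if_neg (by omega), if_neg (by simp [parity_simps]),
    show 2 * (p + 2) - 2 = 2 * (p + 1) by omega,
    show 2 * (p + 2) + (2 * c + 3) = 2 * (p + c + 3) + 1 by ring]
  have h2 : (3 : ℚ) * (cutSum (2 * (p + 1)) (2 * (p + c + 3) + 1) : ℤ) =
      6 * (p + 1) * (p + c + 3) * (p + c + 3 + 1) - 2 * (p + 1 - 1) * (p + 1) * (p + 1 + 1) := by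
    exact_mod_cast this
  push_cast at *
  linear_combination (1 / 3 : ℚ) * h2

theorem unicyclicMax_eq_boundEven (p c : ℕ) :
    (unicyclicMax (p + 2) (2 * c + 4) : ℚ) =
      boundEven (2 * (p + 2) + (2 * c + 4) : ℕ) (p + 2 : ℕ) := by
  unfold unicyclicMax sparseMax boundEven
  have := three_mul_cutSum_even (p + 1) (p + c + 4) (by omega)
  rw [if_neg (by omega), if_pos (by simp [parity_simps]),
    show 2 * (p + 2) - 2 = 2 * (p + 1) by omega,
    show 2 * (p + 2) + (2 * c + 4) = 2 * (p + c + 4) by ring]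
  have h2 : (3 : ℚ) * (cutSum (2 * (p + 1)) (2 * (p + c + 4)) : ℤ) =
      6 * (p + 1) * (p + c + 4) ^ 2 - (p + 1) * (2 * (p + 1) ^ 2 + 1) := by exact_mod_cast this
  push_cast at *
  linear_combination (1 / 3 : ℚ) * h2

theorem wienerIndex_le_unicyclicMax {V : Type*} [Fintype V] {G : SimpleGraph V} {m e : ℕ}
    (hm : 2 ≤ m) (h : MemU (2 * m + e) m G) :
    (wienerIndex G : ℤ) ≤ unicyclicMax m e ∧ ((wienerIndex G : ℤ) = unicyclicMax m e →
      (e ≤ 2 ∧ GraphIso G (G3 e (2 * m - 3))) ∨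
      ((3 ≤ e ∨ (m = 2 ∧ (e = 0 ∨ e = 2))) ∧
        GraphIso G (G4 ((e + 1) / 2) (e / 2) (2 * m - 4)))) := by
  obtain ⟨h1, h2, h3, h4⟩ := memU_iff.1 h
  obtain ⟨h5, h6⟩ := weightedWiener_unicyclic_le h1 h2 hm h4 h3
  rw [weightedWiener_one_eq] at h5 h6
  unfold unicyclicMax
  refine ⟨by linarith, fun heq => ?_⟩
  obtain ⟨S, r, hr, hS, hE⟩ := h6 (by rw [heq])
  exact graphIso_of_isExtremal hr hm hS h2 h3 hE

theorem memU_G3 (a p : ℕ) : MemU (2 * (p + 2) + a) (p + 2) (G3 a (2 * p + 1)) := by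
  refine memU_iff.2 ⟨G3.connected _ _, G3.sum_vdeg _ _, ?_, matchingNumber_G3 a p⟩
  simp
  omega

theorem memU_G4 (a c p : ℕ) : MemU (2 * (p + 2) + (a + c)) (p + 2) (G4 a c (2 * p)) := by
  refine memU_iff.2 ⟨G4.connected _ _ _, G4.sum_vdeg _ _ _, ?_, matchingNumber_G4 a c p⟩
  simp
  omega

/-- The general upper bound applies since the graph is a member of the class, and the distance
estimate matches it. -/
theorem wienerIndex_G3 {e : ℕ} (he : e ≤ 2) (p : ℕ) :
    (wienerIndex (G3 e (2 * p + 1)) : ℚ) = boundSmall (2 * (p + 2) + e : ℕ) (p + 2 : ℕ) := by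
  have h1 := (wienerIndex_le_unicyclicMax (by omega) (memU_G3 e p)).1
  have h2 : ((wienerIndex (G3 e (2 * p + 1)) : ℤ) : ℚ) ≤ unicyclicMax (p + 2) e := by
    exact_mod_cast h1
  rw [unicyclicMax_eq_boundSmall he] at h2
  refine le_antisymm (by exact_mod_cast h2) ?_
  have h3 := (Int.cast_le (R := ℚ)).2 (six_mul_wienerIndex_G3 e (2 * p + 1))
  unfold boundSmall
  interval_cases e <;> push_cast at * <;> linarith

theorem wienerIndex_G4_small {a : ℕ} (ha : a ≤ 1) :
    (wienerIndex (G4 a a (2 * 0)) : ℚ) = boundSmall (2 * (0 + 2) + (a + a) : ℕ) (0 + 2 : ℕ) := by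
  have h1 := (wienerIndex_le_unicyclicMax (by omega) (memU_G4 a a 0)).1
  have h2 : ((wienerIndex (G4 a a (2 * 0)) : ℤ) : ℚ) ≤ unicyclicMax (0 + 2) (a + a) := by
    exact_mod_cast h1
  rw [unicyclicMax_eq_boundSmall (by omega)] at h2
  refine le_antisymm (by exact_mod_cast h2) ?_
  have h3 := (Int.cast_le (R := ℚ)).2 (six_mul_wienerIndex_G4 a a (2 * 0))
  unfold boundSmall
  interval_cases a <;> push_cast at * <;> linarith

theorem wienerIndex_G4_odd (p c : ℕ) : (wienerIndex (G4 (c + 2) (c + 1) (2 * p)) : ℚ) =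
    boundOdd (2 * (p + 2) + (2 * c + 3) : ℕ) (p + 2 : ℕ) := by
  have hmem := memU_G4 (c + 2) (c + 1) p
  rw [show c + 2 + (c + 1) = 2 * c + 3 by ring] at hmem
  have h1 := (wienerIndex_le_unicyclicMax (by omega) hmem).1
  have h2 : ((wienerIndex (G4 (c + 2) (c + 1) (2 * p)) : ℤ) : ℚ) ≤
      unicyclicMax (p + 2) (2 * c + 3) := by exact_mod_cast h1
  rw [unicyclicMax_eq_boundOdd] at h2
  refine le_antisymm (by exact_mod_cast h2) ?_
  have h3 := (Int.cast_le (R := ℚ)).2 (six_mul_wienerIndex_G4 (c + 2) (c + 1) (2 * p))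
  unfold boundOdd
  push_cast at *
  linarith

theorem wienerIndex_G4_even (p c : ℕ) : (wienerIndex (G4 (c + 2) (c + 2) (2 * p)) : ℚ) =
    boundEven (2 * (p + 2) + (2 * c + 4) : ℕ) (p + 2 : ℕ) := by
  have hmem := memU_G4 (c + 2) (c + 2) p
  rw [show c + 2 + (c + 2) = 2 * c + 4 by ring] at hmem
  have h1 := (wienerIndex_le_unicyclicMax (by omega) hmem).1
  have h2 : ((wienerIndex (G4 (c + 2) (c + 2) (2 * p)) : ℤ) : ℚ) ≤
      unicyclicMax (p + 2) (2 * c + 4) := by exact_mod_cast h1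
  rw [unicyclicMax_eq_boundEven] at h2
  refine le_antisymm (by exact_mod_cast h2) ?_
  have h3 := (Int.cast_le (R := ℚ)).2 (six_mul_wienerIndex_G4 (c + 2) (c + 2) (2 * p))
  unfold boundEven
  push_cast at *
  linarith

theorem memU_and_wienerIndex_eq_of_graphIso {n m : ℕ} {b : ℚ} {V W : Type*} [Fintype V] [Fintype W]
    {G : SimpleGraph V} {H : SimpleGraph W} (hH : MemU n m H) (hb : (wienerIndex H : ℚ) = b)
    (f : GraphIso G H) : MemU n m G ∧ (wienerIndex G : ℚ) = b := by
  obtain ⟨f⟩ := f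
  refine ⟨hH.of_iso f.symm, ?_⟩
  rw [wienerIndex_iso f.symm hH.1.1, hb]

theorem exists_fin_memU {n m : ℕ} {b : ℚ} {W : Type*} [Fintype W] {H : SimpleGraph W}
    (hH : MemU n m H) (hb : (wienerIndex H : ℚ) = b) :
    ∃ G : SimpleGraph (Fin n), MemU n m G ∧ (wienerIndex G : ℚ) = b :=
  ⟨H.map (Fintype.equivFinOfCardEq hH.2.1).toEmbedding,
    memU_and_wienerIndex_eq_of_graphIso hH hb ⟨(SimpleGraph.Iso.map _ H).symm⟩⟩

end bounds

end WienerIndexUnicyclic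

/-- In each of the three ranges of `n`: the bound holds on `𝒰(n, m)`; the members of `𝒰(n, m)`
attaining it are exactly the graphs isomorphic to one of the listed graphs (which therefore lie in
`𝒰(n, m)`); and the bound is attained. -/
theorem mainTheorem1 (n m : ℕ) (hm : 2 ≤ m) (hmn : m ≤ n / 2) :
    (n ≤ 2 * m + 2 →
      (∀ (V : Type*) [Fintype V] (G : SimpleGraph V),
        (MemU n m G → (wienerIndex G : ℚ) ≤ boundSmall n m) ∧
        (MemU n m G ∧ (wienerIndex G : ℚ) = boundSmall n m ↔
          GraphIso G (G3 (n - 2 * m) (2 * m - 3)) ∨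
          ((n, m) = (4, 2) ∧ GraphIso G (G4 0 0 0)) ∨
          ((n, m) = (6, 2) ∧ GraphIso G (G4 1 1 0)))) ∧
      ∃ G : SimpleGraph (Fin n), MemU n m G ∧ (wienerIndex G : ℚ) = boundSmall n m) ∧
    (2 * m + 3 ≤ n → Odd n →
      (∀ (V : Type*) [Fintype V] (G : SimpleGraph V),
        (MemU n m G → (wienerIndex G : ℚ) ≤ boundOdd n m) ∧
        (MemU n m G ∧ (wienerIndex G : ℚ) = boundOdd n m ↔
          GraphIso G (G4 ((n + 1) / 2 - m) ((n - 1) / 2 - m) (2 * m - 4)))) ∧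
      ∃ G : SimpleGraph (Fin n), MemU n m G ∧ (wienerIndex G : ℚ) = boundOdd n m) ∧
    (2 * m + 4 ≤ n → Even n →
      (∀ (V : Type*) [Fintype V] (G : SimpleGraph V),
        (MemU n m G → (wienerIndex G : ℚ) ≤ boundEven n m) ∧
        (MemU n m G ∧ (wienerIndex G : ℚ) = boundEven n m ↔
          GraphIso G (G4 (n / 2 - m) (n / 2 - m) (2 * m - 4)))) ∧
      ∃ G : SimpleGraph (Fin n), MemU n m G ∧ (wienerIndex G : ℚ) = boundEven n m) := by
  obtain ⟨e, rfl⟩ : ∃ e, n = 2 * m + e := ⟨n - 2 * m, by omega⟩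
  obtain ⟨p, rfl⟩ : ∃ p, m = p + 2 := ⟨m - 2, by omega⟩
  refine ⟨fun hn => ?_, fun hn hodd => ?_, fun hn heven => ?_⟩
  · have he : e ≤ 2 := by omega
    rw [Nat.add_sub_cancel_left, show 2 * (p + 2) - 3 = 2 * p + 1 by omega]
    refine ⟨fun V _ G => ⟨fun hG => ?_, fun hG => ?_, fun hG => ?_⟩,
      exists_fin_memU (memU_G3 e p) (wienerIndex_G3 he p)⟩
    · have h1 := (wienerIndex_le_unicyclicMax hm hG).1
      rw [← unicyclicMax_eq_boundSmall he]
      exact_mod_cast h1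
    · obtain ⟨hG, hb⟩ := hG
      rw [← unicyclicMax_eq_boundSmall he] at hb
      rcases (wienerIndex_le_unicyclicMax hm hG).2 (by exact_mod_cast hb) with
        ⟨-, h⟩ | ⟨h1, h⟩
      · exact .inl (by rwa [show 2 * (p + 2) - 3 = 2 * p + 1 by omega] at h)
      -- A 4-cycle is optimal in this range only in the ties `m = 2` with `e = 0` or `e = 2`, the
      -- pairs `(4, 2)` and `(6, 2)`.
      · obtain ⟨h2, h3⟩ := h1.resolve_left (by omega)
        obtain rfl : p = 0 := by omega
        rcases h3 with rfl | rfl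
        · exact .inr (.inl ⟨rfl, h⟩)
        · exact .inr (.inr ⟨rfl, h⟩)
    · rcases hG with h | ⟨h1, h⟩ | ⟨h1, h⟩
      · exact memU_and_wienerIndex_eq_of_graphIso (memU_G3 e p) (wienerIndex_G3 he p) h
      · rw [Prod.mk.injEq] at h1
        obtain rfl : p = 0 := by omega
        obtain rfl : e = 0 := by omega
        exact memU_and_wienerIndex_eq_of_graphIso (memU_G4 0 0 0)
          (wienerIndex_G4_small (by omega)) h
      · rw [Prod.mk.injEq] at h1
        obtain rfl : p = 0 := by omega
        obtain rfl : e = 2 := by omega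
        exact memU_and_wienerIndex_eq_of_graphIso (memU_G4 1 1 0)
          (wienerIndex_G4_small (by omega)) h
  · obtain ⟨c, rfl⟩ : ∃ c, e = 2 * c + 3 := by
      obtain ⟨k, hk⟩ := hodd
      exact ⟨(e - 3) / 2, by omega⟩
    have hmem := memU_G4 (c + 2) (c + 1) p
    rw [show c + 2 + (c + 1) = 2 * c + 3 by ring] at hmem
    rw [show (2 * (p + 2) + (2 * c + 3) + 1) / 2 - (p + 2) = c + 2 by omega,
      show (2 * (p + 2) + (2 * c + 3) - 1) / 2 - (p + 2) = c + 1 by omega,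
      show 2 * (p + 2) - 4 = 2 * p by omega]
    refine ⟨fun V _ G => ⟨fun hG => ?_, fun hG => ?_, fun hG => ?_⟩,
      exists_fin_memU hmem (wienerIndex_G4_odd p c)⟩
    · have h1 := (wienerIndex_le_unicyclicMax hm hG).1
      rw [← unicyclicMax_eq_boundOdd]
      exact_mod_cast h1
    · obtain ⟨hG, hb⟩ := hG
      rw [← unicyclicMax_eq_boundOdd] at hb
      rcases (wienerIndex_le_unicyclicMax hm hG).2 (by exact_mod_cast hb) with
        ⟨h1, -⟩ | ⟨-, h⟩
      · omega
      · rwa [show (2 * c + 3 + 1) / 2 = c + 2 by omega, show (2 * c + 3) / 2 = c + 1 by omega,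
          show 2 * (p + 2) - 4 = 2 * p by omega] at h
    · exact memU_and_wienerIndex_eq_of_graphIso hmem (wienerIndex_G4_odd p c) hG
  · obtain ⟨c, rfl⟩ : ∃ c, e = 2 * c + 4 := by
      obtain ⟨k, hk⟩ := heven
      exact ⟨(e - 4) / 2, by omega⟩
    have hmem := memU_G4 (c + 2) (c + 2) p
    rw [show c + 2 + (c + 2) = 2 * c + 4 by ring] at hmem
    rw [show (2 * (p + 2) + (2 * c + 4)) / 2 - (p + 2) = c + 2 by omega,
      show 2 * (p + 2) - 4 = 2 * p by omega]
    refine ⟨fun V _ G => ⟨fun hG => ?_, fun hG => ?_, fun hG => ?_⟩,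
      exists_fin_memU hmem (wienerIndex_G4_even p c)⟩
    · have h1 := (wienerIndex_le_unicyclicMax hm hG).1
      rw [← unicyclicMax_eq_boundEven]
      exact_mod_cast h1
    · obtain ⟨hG, hb⟩ := hG
      rw [← unicyclicMax_eq_boundEven] at hb
      rcases (wienerIndex_le_unicyclicMax hm hG).2 (by exact_mod_cast hb) with
        ⟨h1, -⟩ | ⟨-, h⟩
      · omega
      · rwa [show (2 * c + 4 + 1) / 2 = c + 2 by omega, show (2 * c + 4) / 2 = c + 2 by omega,
          show 2 * (p + 2) - 4 = 2 * p by omega] at h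
    · exact memU_and_wienerIndex_eq_of_graphIso hmem (wienerIndex_G4_even p c) hG
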